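/- Let $(j_\ell)_{\ell\ge1}$ and $(n_\ell)_{\ell\ge1}$ be sequences of integers $\ge 2$, and put $J_i=\prod_{\ell=1}^i j_\ell$, $N_i=\prod_{\ell=1}^i n_\ell$, $L_i=\pi/J_i$ and $[m]=\{1,\dots,m\}$. Let $F_0=\mathbb S^1=\mathbb R/2\pi\mathbb Z$. For $i\ge1$ let $B_i\subseteq F_{i-1}$ be the set of points whose angle in $\mathbb S^1$ is a multiple of $L_i$, and let $F_i$ be the quotient of $F_{i-1}\times[n_i]$ in which the $n_i$ copies of each point of $B_i$ are glued to one point. Let $\phi_i\colon F_i\to F_{i-1}$ be the projection. A point of $F_i$ is written $\eta w_1\dots w_i$ with $\eta\in\mathbb S^1$ and $w_\ell\in[n_\ell]$. The cells of $F_i$ are the arcs $\{(\vartheta+\theta)w_1\dots w_i:0\le\theta\le L_i\}$, where $\vartheta=kL_i$ with $0\le k<2J_i$, parametrized by $\varphi_\alpha(\theta)=(\vartheta+\theta)w_1\dots w_i$ for $\alpha=(\vartheta,w_1,\dots,w_i)$. The measure $\mu_i$ on $F_i$ is $1/N_i$ times arc length on each cell, and $\theta_x\in[0,L_i)$ denotes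 the position of $x$ in its cell (the angle of $x$ modulo $L_i$). Two points of $F_i$ lie in the same strand if they are interior points of the same cell. They lie in the same bundle if they are interior points of cells that have the same $\vartheta$ and the same letters $w_1,\dots,w_{i-1}$. In all other cases (in particular if one of the points is an endpoint of a cell) they are said to lie in different bundles. Let $$p^{F_0}_t(\theta_1,\theta_2)=\frac1{2\pi}+\frac1\pi\sum_{k\ge1}e^{-k^2t}\cos(k(\theta_2-\theta_1)),\qquad p^{[0,L]_D}_t(\theta_1,\theta_2)=\frac2L\sum_{k\ge1}e^{-k^2\pi^2t/L^2}\sin\frac{k\pi\theta_1}{L}\sin\frac{k\pi\theta_2}{L}$$ be the heat kernels of the circle and of the interval $[0,L]$ with Dirichlet boundary conditions. **Theorem.** For each $i\ge1$ the heat kernel on $F_i$ is the function given recursively, for $t>0$ and $x,y\in F_i$, by $$p^{F_i}_t(x,y)=p^{F_{i-1}}_t(\phi_i(x),\phi_i(y))+\begin{cases}0&\text{if } x,y \text{ lie in different bundles},\\ -N_{i-1}\,D_t(x,y)&\text{if } x,y\text{ lie in different strands of the same bundle},\\ N_{i-1}(n_i-1)\,D_t(x,y)&\text{if }x,y\text{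 lie in the same strand},\end{cases}$$ where $$D_t(x,y)=J_i\big(p^{F_0}_{J_i^2t}(J_i\theta_x,J_i\theta_y)-p^{F_0}_{J_i^2t}(J_i\theta_x,-J_i\theta_y)\big)=p^{[0,L_i]_D}_t(\theta_x,\theta_y).$$ That is, $p^{F_i}_t$ is symmetric, nonnegative and continuous on $F_i\times F_i$ for each $t>0$. The operators $T_0=\mathrm{id}$ and $T_tf(x)=\int_{F_i}p^{F_i}_t(x,y)f(y)\,\mu_i(dy)$, $t>0$, form a strongly continuous, conservative Markov semigroup on $C(F_i)$ with the strong Feller property (for $t>0$, $T_t$ maps bounded Borel functions to continuous functions). This semigroup is the one of the energy form $$\mathcal E(f,g)=\sum_\alpha\frac1{N_i}\int_0^{L_i}f_\alpha'\,g_\alpha'\,d\theta,\qquad f_\alpha=f\circ\varphi_\alpha,$$ with domain the continuous functions $f$ on $F_i$ such that $f_\alpha\in H^1(0,L_i)$ for each cell $\alpha$: for $f\in C(F_i)$, $t>0$ and each $g$ in the domain, $T_tf$ lies in the domain and $\frac{d}{dt}\int_{F_i}T_tf\,g\,d\mu_i=-\mathcal E(T_tf,g)$. -/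

import Mathlib

open MeasureTheory Filter Topology Set
open scoped ContDiff

namespace DiamondFractal

noncomputable section

/-! ### Parameters -/

/-- `J_i = j_1 ⋯ j_i` (the value `j 0` plays no role). -/
def J (j : ℕ → ℕ) (i : ℕ) : ℕ := ∏ l ∈ Finset.Icc 1 i, j l

/-- `N_i = n_1 ⋯ n_i` (the value `n 0` plays no role). -/
def N (n : ℕ → ℕ) (i : ℕ) : ℕ := ∏ l ∈ Finset.Icc 1 i, n l

/-- `L_i = π / J_i`, the length of the `i`-cells. -/
def L (j : ℕ → ℕ) (i : ℕ) : ℝ := Real.pi / J j i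

instance instFactTwoPi : Fact ((0 : ℝ) < 2 * Real.pi) := ⟨Real.two_pi_pos⟩

/-- The circle `𝕊¹`, as `ℝ / 2πℤ`. -/
abbrev S1 : Type := AddCircle (2 * Real.pi)

/-- The representative in `[0, 2π)` of a point of the circle. -/
def rep (η : S1) : ℝ := (AddCircle.equivIco (2 * Real.pi) 0 η : ℝ)

/-- The angles `π k / J_i`, `0 ≤ k < 2 J_i`.  This is `ϑ_0 ∪ ⋯ ∪ ϑ_i`, where `ϑ_0 = {0, π}` and,
for `l ≥ 1`, `ϑ_l` consists of the `π k / J_l` with `0 < k < 2 J_l` and `j_l ∤ k`. -/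
def junctionAngles (j : ℕ → ℕ) (i : ℕ) : Set S1 :=
  {η | ∃ k : ℕ, k < 2 * J j i ∧ η = ((Real.pi * k / J j i : ℝ) : S1)}

/-! ### The spaces `F_i` -/

/-- A topological space together with an angle map to the circle. -/
structure Stage where
  carrier : Type
  top : TopologicalSpace carrier
  angle : carrier → S1

/-- The identification on `X × [m]` that glues the `m` copies of each point of `B`. -/
def glue {X : Type} (B : Set X) (m : ℕ) : Setoid (X × Fin m) where
  r p q := p.1 = q.1 ∧ (p.2 = q.2 ∨ p.1 ∈ B)
  iseqv :=
    { refl := fun _ => ⟨rfl, Or.inl rfl⟩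
      symm := by
        rintro p q ⟨h, h'⟩
        refine ⟨h.symm, ?_⟩
        rcases h' with h' | h'
        · exact Or.inl h'.symm
        · exact Or.inr (h ▸ h')
      trans := by
        rintro p q r ⟨h₁, h₁'⟩ ⟨h₂, h₂'⟩
        refine ⟨h₁.trans h₂, ?_⟩
        rcases h₁' with h₁' | h₁'
        · rcases h₂' with h₂' | h₂'
          · exact Or.inl (h₁'.trans h₂')
          · exact Or.inr (h₁ ▸ h₂')
        · exact Or.inr h₁' }

/-- `F_0 = 𝕊¹`, and `F_{i+1}` is `F_i × [n_{i+1}]` (quotient topology) where the copies of each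
point of `B_{i+1} = {x ∈ F_i : the angle of x lies in ϑ_0 ∪ ⋯ ∪ ϑ_{i+1}}` are glued together. -/
def stage (j n : ℕ → ℕ) : ℕ → Stage
  | 0 => ⟨S1, inferInstance, id⟩
  | i + 1 =>
    let S := stage j n i
    let B : Set S.carrier := {x | S.angle x ∈ junctionAngles j (i + 1)}
    { carrier := Quotient (glue B (n (i + 1)))
      top :=
        letI := S.top
        letI : Setoid (S.carrier × Fin (n (i + 1))) := glue B (n (i + 1))
        instTopologicalSpaceQuotient
      angle := Quotient.lift (fun p => S.angle p.1)
        (fun _ _ h => congrArg S.angle (And.left h)) }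

/-- The `i`-th approximating space `F_i`. -/
def F (j n : ℕ → ℕ) (i : ℕ) : Type := (stage j n i).carrier

instance instTopF (j n : ℕ → ℕ) (i : ℕ) : TopologicalSpace (F j n i) := (stage j n i).top

instance instMeasF (j n : ℕ → ℕ) (i : ℕ) : MeasurableSpace (F j n i) := borel _

instance instBorelF (j n : ℕ → ℕ) (i : ℕ) : BorelSpace (F j n i) := ⟨rfl⟩

/-- The angle `η ∈ 𝕊¹` of a point `η w_1 … w_l` of `F_i`. -/
def angle (j n : ℕ → ℕ) (i : ℕ) : F j n i → S1 := (stage j n i).angle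

/-- The set `B_{i+1} ⊆ F_i` of identification points. -/
def B (j n : ℕ → ℕ) (i : ℕ) : Set (F j n i) := {x | angle j n i x ∈ junctionAngles j (i + 1)}

/-- The canonical map `π_{i+1} : F_i × [n_{i+1}] → F_{i+1}`. -/
def proj (j n : ℕ → ℕ) (i : ℕ) (p : F j n i × Fin (n (i + 1))) : F j n (i + 1) :=
  Quotient.mk (glue (B j n i) (n (i + 1))) p

/-- The map `φ_{i+1} : F_{i+1} → F_i` that forgets the last letter. -/
def phi (j n : ℕ → ℕ) (i : ℕ) : F j n (i + 1) → F j n i :=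
  Quotient.lift (s := glue (B j n i) (n (i + 1))) (fun p => p.1) (fun _ _ h => And.left h)

/-- Words `w_1 … w_i ∈ [n_1] × ⋯ × [n_i]`. -/
abbrev Word (n : ℕ → ℕ) (i : ℕ) : Type := (m : Fin i) → Fin (n (m + 1))

/-- The point `η w_1 … w_i` of `F_i`. -/
def point (j n : ℕ → ℕ) : (i : ℕ) → S1 → Word n i → F j n i
  | 0, η, _ => η
  | i + 1, η, w => proj j n i (point j n i η (fun m => w m.castSucc), w (Fin.last i))

/-! ### Cells, positions, measure -/

/-- The index set of the `i`-cells: starting angle `π k / J_i`, `0 ≤ k < 2 J_i`, and a word.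
(For `i = 0` the circle is thereby seen as the union of two arcs of length `π`.) -/
abbrev Cell (j n : ℕ → ℕ) (i : ℕ) : Type := Fin (2 * J j i) × Word n i

/-- The parametrization `φ_α : [0, L_i] → I_α ⊆ F_i` of the cell `α`, counter-clockwise by arc
length. -/
def cellMap (j n : ℕ → ℕ) (i : ℕ) (α : Cell j n i) (θ : ℝ) : F j n i :=
  point j n i ((Real.pi * (α.1 : ℕ) / J j i + θ : ℝ) : S1) α.2

/-- The position `θ_x ∈ [0, L_i)` of `x ∈ F_i` inside its cell. -/
def theta (j n : ℕ → ℕ) (i : ℕ) (x : F j n i) : ℝ :=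
  L j i * Int.fract (rep (angle j n i x) / L j i)

/-- The measure `μ_i`: on each cell, `1 / N_i` times arc length. -/
def mu (j n : ℕ → ℕ) (i : ℕ) : Measure (F j n i) :=
  ∑ α : Cell j n i,
    ((N n i : ENNReal)⁻¹) • (volume.restrict (Icc 0 (L j i))).map (cellMap j n i α)

/-- `x` and `y` lie (in the interior) in the same strand, i.e. in the same `i`-cell. -/
def SameStrand (j n : ℕ → ℕ) (i : ℕ) (x y : F j n i) : Prop :=
  ∃ α : Cell j n i, x ∈ cellMap j n i α '' Ioo 0 (L j i) ∧ y ∈ cellMap j n i α '' Ioo 0 (L j i)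

/-- `x` and `y` lie (in the interior) in cells `α`, `β` of the same bundle of `F_{i+1}`: these have
the same starting angle and the same word except possibly for the last letter. -/
def SameBundle (j n : ℕ → ℕ) (i : ℕ) (x y : F j n (i + 1)) : Prop :=
  ∃ α β : Cell j n (i + 1),
    α.1 = β.1 ∧ (∀ m : Fin i, α.2 m.castSucc = β.2 m.castSucc) ∧
    x ∈ cellMap j n (i + 1) α '' Ioo 0 (L j (i + 1)) ∧
    y ∈ cellMap j n (i + 1) β '' Ioo 0 (L j (i + 1))

/-! ### Kernels -/

/-- The heat kernel of the circle:
`1/(2π) + (1/π) ∑_{k ≥ 1} exp (-k² t) cos (k (θ₂ - θ₁))`. -/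
def circleKernel (t θ₁ θ₂ : ℝ) : ℝ :=
  1 / (2 * Real.pi) + 1 / Real.pi *
    ∑' k : ℕ, Real.exp (-((k : ℝ) + 1) ^ 2 * t) * Real.cos (((k : ℝ) + 1) * (θ₂ - θ₁))

/-- The Dirichlet heat kernel of the interval `[0, l]`:
`(2/l) ∑_{k ≥ 1} exp (-k² π² t / l²) sin (k π θ₁ / l) sin (k π θ₂ / l)`. -/
def dirichletKernel (l t θ₁ θ₂ : ℝ) : ℝ :=
  2 / l * ∑' k : ℕ, Real.exp (-(((k : ℝ) + 1) ^ 2 * Real.pi ^ 2 / l ^ 2) * t) *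
    Real.sin (((k : ℝ) + 1) * Real.pi * θ₁ / l) * Real.sin (((k : ℝ) + 1) * Real.pi * θ₂ / l)

/-- `J_i (p_{J_i² t}(J_i θ₁, J_i θ₂) - p_{J_i² t}(J_i θ₁, - J_i θ₂))`, with `p` the heat kernel of
the circle. -/
def correction (j : ℕ → ℕ) (i : ℕ) (t θ₁ θ₂ : ℝ) : ℝ :=
  (J j i : ℝ) * (circleKernel ((J j i : ℝ) ^ 2 * t) (J j i * θ₁) (J j i * θ₂) -
    circleKernel ((J j i : ℝ) ^ 2 * t) (J j i * θ₁) (-(J j i * θ₂)))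

open Classical in
/-- The function `p_t^{F_i}(x, y)`, defined recursively in `i`. -/
def p (j n : ℕ → ℕ) : (i : ℕ) → ℝ → F j n i → F j n i → ℝ
  | 0, t, x, y => circleKernel t (rep (angle j n 0 x)) (rep (angle j n 0 y))
  | i + 1, t, x, y =>
    if SameStrand j n (i + 1) x y then
      p j n i t (phi j n i x) (phi j n i y) + (N n i : ℝ) * ((n (i + 1) : ℝ) - 1) *
        correction j (i + 1) t (theta j n (i + 1) x) (theta j n (i + 1) y)
    else if SameBundle j n i x y then
      p j n i t (phi j n i x) (phi j n i y) - (N n i : ℝ) *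
        correction j (i + 1) t (theta j n (i + 1) x) (theta j n (i + 1) y)
    else p j n i t (phi j n i x) (phi j n i y)

/-! ### Markov semigroups -/

/-- `T_0 = id` and `T_t f (x) = ∫ q_t(x, y) f(y) dμ(y)` for `t > 0`. -/
def kernelOp {X : Type*} [MeasurableSpace X] (μ : Measure X) (q : ℝ → X → X → ℝ) (t : ℝ)
    (f : X → ℝ) (x : X) : ℝ :=
  if t = 0 then f x else ∫ y, q t x y * f y ∂μ

/-- `(T_t)_{t ≥ 0}` is a strongly continuous, conservative Markov semigroup on `C(X)` (`X` compact)
with the strong Feller property. -/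
structure IsStrongFellerSemigroup {X : Type*} [TopologicalSpace X] [MeasurableSpace X]
    (T : ℝ → (X → ℝ) → X → ℝ) : Prop where
  map_continuous : ∀ t, 0 ≤ t → ∀ f, Continuous f → Continuous (T t f)
  linear : ∀ t, 0 ≤ t → ∀ f g, Continuous f → Continuous g → ∀ a b : ℝ,
    T t (fun x => a * f x + b * g x) = fun x => a * T t f x + b * T t g x
  zero : ∀ f, Continuous f → T 0 f = f
  add : ∀ s t, 0 ≤ s → 0 ≤ t → ∀ f, Continuous f → T (s + t) f = T s (T t f)
  nonneg : ∀ t, 0 ≤ t → ∀ f, Continuous f → (∀ x, 0 ≤ f x) → ∀ x, 0 ≤ T t f x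
  contractive : ∀ t, 0 ≤ t → ∀ f, Continuous f → ∀ C : ℝ, (∀ x, |f x| ≤ C) → ∀ x, |T t f x| ≤ C
  conservative : ∀ t, 0 ≤ t → T t (fun _ => 1) = fun _ => 1
  strongly_continuous : ∀ f, Continuous f → TendstoUniformly (fun t => T t f) f (𝓝[>] 0)
  strong_feller : ∀ t, 0 < t → ∀ f, Measurable f → (∃ C : ℝ, ∀ x, |f x| ≤ C) → Continuous (T t f)

/-! ### The energy form of the metric graph `F_i` -/

/-- `h ∈ L²(0, l)` is a weak derivative of `f` on `(0, l)`. -/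
def IsWeakDeriv (l : ℝ) (f h : ℝ → ℝ) : Prop :=
  MemLp h 2 (volume.restrict (Ioo 0 l)) ∧
    ∀ ψ : ℝ → ℝ, ContDiff ℝ ∞ ψ → HasCompactSupport ψ → tsupport ψ ⊆ Ioo 0 l →
      ∫ θ in Ioo 0 l, f θ * deriv ψ θ = -∫ θ in Ioo 0 l, h θ * ψ θ

/-- `f ∈ H¹(0, l)`. -/
def MemH1 (l : ℝ) (f : ℝ → ℝ) : Prop :=
  MemLp f 2 (volume.restrict (Ioo 0 l)) ∧ ∃ h, IsWeakDeriv l f h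

open Classical in
/-- The weak derivative of `f` on `(0, l)` (unique up to null sets; zero if there is none). -/
def weakDeriv (l : ℝ) (f : ℝ → ℝ) : ℝ → ℝ :=
  if h : ∃ g, IsWeakDeriv l f g then h.choose else 0

/-- The domain of the energy form: continuous functions on `F_i` that are `H¹` on each cell. -/
def InDomain (j n : ℕ → ℕ) (i : ℕ) (f : F j n i → ℝ) : Prop :=
  Continuous f ∧ ∀ α : Cell j n i, MemH1 (L j i) (fun θ => f (cellMap j n i α θ))

/-- The energy form `∑_α (1 / N_i) ∫_0^{L_i} f_α' g_α' dθ`, where `f_α = f ∘ φ_α`. -/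
def energy (j n : ℕ → ℕ) (i : ℕ) (f g : F j n i → ℝ) : ℝ :=
  ∑ α : Cell j n i, 1 / (N n i : ℝ) * ∫ θ in Ioo 0 (L j i),
    weakDeriv (L j i) (fun s => f (cellMap j n i α s)) θ *
      weakDeriv (L j i) (fun s => g (cellMap j n i α s)) θ

/-- `q` is the heat kernel of the metric measure graph `(F_i, μ_i)`: a symmetric, nonnegative,
continuous kernel whose integral operators form a strongly continuous, conservative, strong Feller
Markov semigroup on `C(F_i)`, namely the one that solves the heat equation of the energy form: for
each initial datum `f ∈ C(F_i)`, the function `u_t = T_t f` lies in the domain of the energy for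
`t > 0` and `d/dt ⟨u_t, g⟩ = - energy (u_t, g)` for each `g` in the domain. -/
structure IsHeatKernel (j n : ℕ → ℕ) (i : ℕ) (q : ℝ → F j n i → F j n i → ℝ) : Prop where
  continuous : ∀ t, 0 < t → Continuous fun z : F j n i × F j n i => q t z.1 z.2
  symm : ∀ t, 0 < t → ∀ x y, q t x y = q t y x
  nonneg : ∀ t, 0 < t → ∀ x y, 0 ≤ q t x y
  semigroup : IsStrongFellerSemigroup (kernelOp (mu j n i) q)
  inDomain : ∀ t, 0 < t → ∀ f, Continuous f → InDomain j n i (kernelOp (mu j n i) q t f)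
  heat_equation : ∀ t, 0 < t → ∀ f, Continuous f → ∀ g, InDomain j n i g →
    HasDerivAt (fun s => ∫ x, kernelOp (mu j n i) q s f x * g x ∂(mu j n i))
      (-energy j n i (kernelOp (mu j n i) q t f) g) t

end

end DiamondFractal

/-!
Everything about `F_i` is reduced to the heat semigroup `circleHeat` of the circle.

*The recursion.* A function `f` on `F_{i+1}` splits into its average `fiberAvg f` over the last
letter, which is a function on `F_i`, and the deviations `fiberDev f α` from this average along the
cells `α`, which vanish at the ends of the cells because the copies are glued there. Integrating the
recursive kernel against `f` shows (`kernelOp_succ`) that the operators of level `i + 1` act on the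
average as the operators of level `i` and on the deviations as the Dirichlet heat operators of the
cells. By the reflection principle and scaling (`circleHeat_cellExt`), the Dirichlet evolution of
`g` on a cell is the evolution on the circle of the odd periodic extension `cellExt j i k g` of `g`.
By induction, for each continuous `f` there is one continuous function on the circle for each cell
whose evolution on the circle is the evolution of `f` along the cell (`IsCellRep`,
`exists_isCellRep`). The derivatives of these evolutions satisfy the Kirchhoff condition at the
vertices: they do on `F_i` by induction, and the deviations in the cells of one bundle add up to
zero.

*Consequences.* Strong continuity at time zero is inherited from the circle. The semigroup property
follows by induction, as averages evolve into averages (`fiberAvg_kernelOp`) and odd reflection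
symmetry is preserved (`cellExt_eq_circleHeat`). Positivity is proved by induction with the
parabolic maximum principle on a cell (`circleHeat_nonneg_of_boundary`): at the ends of a cell the
Dirichlet part vanishes, and the evolution is that of the average, on the previous level. As `p` is
continuous and `μ_i` has full support, `p` itself is nonnegative (`p_nonneg`). The heat equation for
the energy form is an integration by parts on each cell, where the Kirchhoff condition removes the
boundary terms; the elements of the domain only have weak derivatives, and the lemma of
du Bois-Reymond gives their integration by parts up to the boundary
(`IsWeakDeriv.integral_deriv_mul`).

*The circle.* The circle kernel is nonnegative by the functional equation of the Jacobi theta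
function, which turns its Fourier series into a sum of Gaussians. Identities between operators that
are contractions for the supremum norm need only be checked on `cos (n x + a)`, since trigonometric
polynomials are dense (`ContractiveFunctional.ext`).
-/

namespace DiamondFractal

/-! ### Heat series -/

/-- Sequences of subexponential growth: the coefficients for which the heat series converges for
every positive time. -/
def Subexp (c : ℕ → ℝ) : Prop := ∀ r : ℝ, 0 < r → Summable fun k : ℕ => |c k| * Real.exp (-r * k)

lemma Subexp.of_bounded {c : ℕ → ℝ} {C : ℝ} (h : ∀ k, |c k| ≤ C) : Subexp c := by
  intro r hr
  have := (Real.summable_pow_mul_exp_neg_nat_mul 0 hr).mul_left C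
  refine Summable.of_nonneg_of_le (fun k => by positivity) (fun k => ?_) this
  simpa using mul_le_mul_of_nonneg_right (h k) (Real.exp_pos _).le

lemma Subexp.mul_nat {c : ℕ → ℝ} (h : Subexp c) : Subexp fun k => k * c k := by
  intro r hr
  refine Summable.of_nonneg_of_le (fun k => by positivity) (fun k => ?_)
    ((h (r / 2) (by positivity)).mul_left (2 / r))
  have h1 : (k : ℝ) ≤ 2 / r * Real.exp (r / 2 * k) := by
    have := Real.add_one_le_exp (r / 2 * k)
    calc (k : ℝ) = 2 / r * (r / 2 * k) := by field_simp
      _ ≤ _ := by gcongr; linarith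
  have h2 : Real.exp (-r * k) = Real.exp (-(r / 2) * k) * Real.exp (-(r / 2) * k) := by
    rw [← Real.exp_add]; ring_nf
  have h3 : Real.exp (r / 2 * k) * Real.exp (-(r / 2) * k) = 1 := by
    rw [← Real.exp_add]; ring_nf; simp
  rw [abs_mul, Nat.abs_cast, h2]
  calc (k : ℝ) * |c k| * (Real.exp (-(r / 2) * k) * Real.exp (-(r / 2) * k))
      ≤ (2 / r * Real.exp (r / 2 * k)) * |c k| *
        (Real.exp (-(r / 2) * k) * Real.exp (-(r / 2) * k)) := by gcongr
    _ = 2 / r * (|c k| * Real.exp (-(r / 2) * k)) *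
        (Real.exp (r / 2 * k) * Real.exp (-(r / 2) * k)) := by ring
    _ = _ := by rw [h3, mul_one]

lemma Subexp.neg {c : ℕ → ℝ} (h : Subexp c) : Subexp fun k => -c k := by
  intro r hr; simpa using h r hr

/-- A term of the heat series. -/
noncomputable def heatTerm (c s : ℕ → ℝ) (t x : ℝ) (k : ℕ) : ℝ :=
  Real.exp (-(k : ℝ) ^ 2 * t) * (c k * Real.cos (k * x) + s k * Real.sin (k * x))

/-- The solution `∑ exp (-k² t) (c_k cos (k x) + s_k sin (k x))` of the heat equation on the
circle. -/
noncomputable def heatSeries (c s : ℕ → ℝ) (t x : ℝ) : ℝ := ∑' k, heatTerm c s t x k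

lemma abs_heatTerm_le (c s : ℕ → ℝ) {r t : ℝ} (hr : 0 ≤ r) (ht : r ≤ t) (x : ℝ) (k : ℕ) :
    |heatTerm c s t x k| ≤ |c k| * Real.exp (-r * k) + |s k| * Real.exp (-r * k) := by
  have hk : r * k ≤ (k : ℝ) ^ 2 * t := by
    have h0 : (k : ℝ) ≤ (k : ℝ) ^ 2 := by
      exact_mod_cast Nat.le_self_pow two_ne_zero k
    nlinarith [mul_le_mul ht h0 (by positivity) (hr.trans ht)]
  have h1 : Real.exp (-(k : ℝ) ^ 2 * t) ≤ Real.exp (-r * k) := by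
    apply Real.exp_le_exp.2; linarith
  have h2 : |c k * Real.cos (k * x) + s k * Real.sin (k * x)| ≤ |c k| + |s k| := by
    refine (abs_add_le _ _).trans (add_le_add ?_ ?_) <;> rw [abs_mul]
    · exact mul_le_of_le_one_right (abs_nonneg _) (Real.abs_cos_le_one _)
    · exact mul_le_of_le_one_right (abs_nonneg _) (Real.abs_sin_le_one _)
  rw [heatTerm, abs_mul, Real.abs_exp, ← add_mul, mul_comm]
  exact mul_le_mul h2 h1 (Real.exp_pos _).le (by positivity)

lemma summable_heatTerm {c s : ℕ → ℝ} (hc : Subexp c) (hs : Subexp s) {t : ℝ} (ht : 0 < t) (x : ℝ) :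
    Summable (heatTerm c s t x) :=
  Summable.of_norm_bounded ((hc t ht).add (hs t ht)) fun k => by
    simpa using abs_heatTerm_le c s ht.le le_rfl x k

lemma abs_heatSeries_le {c s : ℕ → ℝ} (hc : Subexp c) (hs : Subexp s) {r : ℝ} (hr : 0 < r) :
    ∃ C, ∀ t, r ≤ t → ∀ x, |heatSeries c s t x| ≤ C :=
  ⟨_, fun t ht x => by
    have hsum := (hc r hr).add (hs r hr)
    have := tsum_of_norm_bounded (f := heatTerm c s t x) hsum.hasSum fun k =>
      abs_heatTerm_le c s hr.le ht x k
    exact this⟩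

lemma hasDerivAt_heatSeries_space {c s : ℕ → ℝ} (hc : Subexp c) (hs : Subexp s) {t : ℝ}
    (ht : 0 < t) (x : ℝ) :
    HasDerivAt (heatSeries c s t) (heatSeries (fun k => k * s k) (fun k => -(k * c k)) t x) x := by
  refine hasDerivAt_tsum (y₀ := 0) (g := fun k x => heatTerm c s t x k)
    (g' := fun k x => heatTerm (fun k => k * s k) (fun k => -(k * c k)) t x k)
    (u := fun k => |k * s k| * Real.exp (-t * k) + |-(k * c k)| * Real.exp (-t * k))
    (hs.mul_nat t ht |>.add (hc.mul_nat.neg t ht)) (fun k y => ?_) (fun k y => ?_)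
    (summable_heatTerm hc hs ht 0) x
  · have h0 : HasDerivAt (fun y : ℝ => (k : ℝ) * y) k y := by
      simpa using (hasDerivAt_id y).const_mul (k : ℝ)
    exact (((h0.cos.const_mul (c k)).add (h0.sin.const_mul (s k))).const_mul
      (Real.exp (-(k : ℝ) ^ 2 * t))).congr_deriv (by simp only [heatTerm]; ring)
  · exact abs_heatTerm_le _ _ ht.le le_rfl y k

lemma hasDerivAt_heatSeries_time {c s : ℕ → ℝ} (hc : Subexp c) (hs : Subexp s) {t : ℝ}
    (ht : 0 < t) (x : ℝ) :
    HasDerivAt (fun t => heatSeries c s t x)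
      (heatSeries (fun k => k * -(k * c k)) (fun k => -(k * (k * s k))) t x) t := by
  refine hasDerivAt_tsum_of_isPreconnected (t := Ioi (t / 2)) (y₀ := t)
    (g := fun k t => heatTerm c s t x k)
    (g' := fun k t => heatTerm (fun k => k * -(k * c k)) (fun k => -(k * (k * s k))) t x k)
    (u := fun k => |k * -(k * c k)| * Real.exp (-(t / 2) * k) +
      |-(k * (k * s k))| * Real.exp (-(t / 2) * k))
    (hc.mul_nat.neg.mul_nat (t / 2) (by positivity) |>.add
      (hs.mul_nat.mul_nat.neg (t / 2) (by positivity))) isOpen_Ioi isPreconnected_Ioi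
    (fun k y hy => ?_) (fun k y hy => ?_) (mem_Ioi.2 (by linarith))
    (summable_heatTerm hc hs ht x) (mem_Ioi.2 (by linarith))
  · have h0 : HasDerivAt (fun y : ℝ => -(k : ℝ) ^ 2 * y) (-(k : ℝ) ^ 2) y := by
      simpa using (hasDerivAt_id y).const_mul (-(k : ℝ) ^ 2)
    exact (h0.exp.mul_const (c k * Real.cos (k * x) + s k * Real.sin (k * x))).congr_deriv
      (by simp only [heatTerm]; ring)
  · exact abs_heatTerm_le _ _ (by positivity) (le_of_lt hy) x k

/-- Differentiation replaces the coefficients `(c_k, s_k)` by `(k s_k, -k c_k)`, which again grow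
subexponentially. -/
lemma contDiff_heatSeries {c s : ℕ → ℝ} (hc : Subexp c) (hs : Subexp s) {t : ℝ} (ht : 0 < t) :
    ContDiff ℝ ∞ (heatSeries c s t) := by
  rw [contDiff_infty]
  intro m
  induction m generalizing c s with
  | zero =>
    exact contDiff_zero.2 (continuous_iff_continuousAt.2 fun x =>
      (hasDerivAt_heatSeries_space hc hs ht x).continuousAt)
  | succ m ih =>
    have hd : deriv (heatSeries c s t) =
        heatSeries (fun k => k * s k) (fun k => -(k * c k)) t :=
      funext fun x => (hasDerivAt_heatSeries_space hc hs ht x).deriv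
    push_cast
    refine contDiff_succ_iff_deriv.2 ⟨fun x =>
      (hasDerivAt_heatSeries_space hc hs ht x).differentiableAt, fun h => by simp at h, ?_⟩
    rw [hd]
    exact ih hs.mul_nat hc.mul_nat.neg

lemma continuousOn_heatSeries {c s : ℕ → ℝ} (hc : Subexp c) (hs : Subexp s) {r : ℝ} (hr : 0 < r) :
    ContinuousOn (fun z : ℝ × ℝ => heatSeries c s z.1 z.2) (Ici r ×ˢ univ) := by
  refine continuousOn_tsum (fun k => ?_) ((hc r hr).add (hs r hr)) fun k z hz => ?_
  · unfold heatTerm; fun_prop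
  · exact abs_heatTerm_le c s hr.le hz.1 z.2 k

/-! ### The heat semigroup of the circle -/

/-- The normalization of the `k`-th mode in the heat kernel of the circle. -/
noncomputable def modeWeight (k : ℕ) : ℝ := if k = 0 then 1 / (2 * Real.pi) else 1 / Real.pi

lemma abs_modeWeight_le (k : ℕ) : |modeWeight k| ≤ 1 := by
  have := Real.pi_gt_three
  unfold modeWeight
  split_ifs <;> rw [abs_of_pos (by positivity), div_le_one (by positivity)] <;> linarith

lemma subexp_modeWeight : Subexp modeWeight := .of_bounded abs_modeWeight_le

lemma subexp_zero : Subexp fun _ => 0 := .of_bounded (C := 0) (by simp)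

lemma circleKernel_eq_heatSeries {t : ℝ} (ht : 0 < t) (x y : ℝ) :
    circleKernel t x y = heatSeries modeWeight (fun _ => 0) t (y - x) := by
  rw [heatSeries, (summable_heatTerm subexp_modeWeight subexp_zero ht _).tsum_eq_zero_add,
    circleKernel, ← tsum_mul_left]
  congr 1
  · simp [heatTerm, modeWeight]
  · refine tsum_congr fun k => ?_
    simp only [heatTerm, modeWeight, Nat.succ_ne_zero, if_false]
    push_cast
    ring

lemma continuous_circleKernel {t : ℝ} (ht : 0 < t) :
    Continuous fun z : ℝ × ℝ => circleKernel t z.1 z.2 := by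
  simp_rw [circleKernel_eq_heatSeries ht]
  exact (contDiff_heatSeries subexp_modeWeight subexp_zero ht).continuous.comp (by fun_prop)

lemma circleKernel_symm (t x y : ℝ) : circleKernel t x y = circleKernel t y x := by
  simp only [circleKernel]
  congr 3 with k
  rw [← Real.cos_neg]
  ring_nf

lemma circleKernel_nonneg {t : ℝ} (ht : 0 < t) (x y : ℝ) : 0 ≤ circleKernel t x y := by
  have hpi := Real.pi_pos
  have ht' : 0 < t / Real.pi := by positivity
  have h1 := HurwitzZeta.hasSum_nat_cosKernel₀ ((y - x) / (2 * Real.pi)) ht'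
  -- the functional equation turns the Fourier series into a sum of Gaussians
  have h2 := HurwitzZeta.evenKernel_functional_equation
    (((y - x) / (2 * Real.pi) : ℝ) : UnitAddCircle) (1 / (t / Real.pi))
  have h3 := HurwitzZeta.hasSum_int_evenKernel ((y - x) / (2 * Real.pi))
    (t := 1 / (t / Real.pi)) (by positivity)
  have h4 := h3.nonneg fun k => (Real.exp_pos _).le
  rw [h2, one_div_one_div] at h4
  have h5 : 0 ≤ HurwitzZeta.cosKernel (((y - x) / (2 * Real.pi) : ℝ) : UnitAddCircle)
      (t / Real.pi) := by
    refine nonneg_of_mul_nonneg_right h4 ?_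
    positivity
  have h6 : circleKernel t x y = 1 / (2 * Real.pi) *
      HurwitzZeta.cosKernel (((y - x) / (2 * Real.pi) : ℝ) : UnitAddCircle) (t / Real.pi) := by
    rw [← sub_add_cancel (HurwitzZeta.cosKernel _ _) 1, ← h1.tsum_eq, circleKernel, mul_add,
      ← tsum_mul_left, ← tsum_mul_left, add_comm, mul_one]
    congr 1
    refine tsum_congr fun k => ?_
    have e1 : 2 * Real.pi * ((y - x) / (2 * Real.pi)) * ((k : ℝ) + 1) = (k + 1) * (y - x) := by
      field_simp
    have e2 : -Real.pi * ((k : ℝ) + 1) ^ 2 * (t / Real.pi) = -((k : ℝ) + 1) ^ 2 * t := by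
      field_simp
    rw [e1, e2]
    field_simp
  rw [h6]
  positivity

/-- The heat semigroup of the circle, acting on functions on the line (which only enter through
their values on `[0, 2π]`). -/
noncomputable def circleHeat (H : ℝ → ℝ) (t x : ℝ) : ℝ :=
  ∫ y in (0)..(2 * Real.pi), circleKernel t x y * H y

lemma hasSum_circleHeat {H : ℝ → ℝ} (hH : Continuous H) {t : ℝ} (ht : 0 < t) (x : ℝ) :
    HasSum (fun k : ℕ => modeWeight k * Real.exp (-(k : ℝ) ^ 2 * t) *
      ∫ y in (0)..(2 * Real.pi), Real.cos (k * (y - x)) * H y) (circleHeat H t x) := by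
  obtain ⟨C, hC⟩ := (isCompact_uIcc (a := 0) (b := 2 * Real.pi)).exists_bound_of_continuousOn
    hH.continuousOn
  have hs := ((subexp_modeWeight t ht).add (subexp_zero t ht))
  have key := intervalIntegral.hasSum_integral_of_dominated_convergence (μ := volume)
    (a := 0) (b := 2 * Real.pi)
    (F := fun k y => heatTerm modeWeight (fun _ => 0) t (y - x) k * H y)
    (f := fun y => circleKernel t x y * H y)
    (fun k _ => (|modeWeight k| * Real.exp (-t * k) + |(0 : ℝ)| * Real.exp (-t * k)) * C)
    (fun k => by
      have : Continuous fun y => heatTerm modeWeight (fun _ => 0) t (y - x) k * H y := by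
        unfold heatTerm; fun_prop
      exact this.aestronglyMeasurable)
    (fun k => ae_of_all _ fun y hy => by
      rw [norm_mul]
      exact mul_le_mul (abs_heatTerm_le _ _ ht.le le_rfl _ _) (hC y (uIoc_subset_uIcc hy))
        (norm_nonneg _) (by positivity))
    (ae_of_all _ fun y _ => hs.mul_right C) intervalIntegrable_const
    (ae_of_all _ fun y _ => by
      rw [circleKernel_eq_heatSeries ht]
      exact (summable_heatTerm subexp_modeWeight subexp_zero ht _).hasSum.mul_right _)
  refine Eq.mp (congrArg (fun F => HasSum F (circleHeat H t x)) (funext fun k => ?_)) key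
  rw [← intervalIntegral.integral_const_mul]
  refine intervalIntegral.integral_congr fun y _ => ?_
  simp only [heatTerm]
  ring

/-- The cosine coefficients of a function on the circle. -/
noncomputable def cosCoeff (H : ℝ → ℝ) (k : ℕ) : ℝ :=
  modeWeight k * ∫ y in (0)..(2 * Real.pi), Real.cos (k * y) * H y

/-- The sine coefficients of a function on the circle. -/
noncomputable def sinCoeff (H : ℝ → ℝ) (k : ℕ) : ℝ :=
  modeWeight k * ∫ y in (0)..(2 * Real.pi), Real.sin (k * y) * H y

lemma subexp_coeff {H : ℝ → ℝ} (hH : Continuous H) {g : ℝ → ℝ} (hg : ∀ x, |g x| ≤ 1) :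
    Subexp fun k => modeWeight k * ∫ y in (0)..(2 * Real.pi), g (k * y) * H y := by
  obtain ⟨C, hC⟩ := (isCompact_uIcc (a := 0) (b := 2 * Real.pi)).exists_bound_of_continuousOn
    hH.continuousOn
  refine .of_bounded (C := 1 * (C * |2 * Real.pi - 0|)) fun k => ?_
  rw [abs_mul]
  refine mul_le_mul (abs_modeWeight_le k) ?_ (abs_nonneg _) zero_le_one
  rw [← Real.norm_eq_abs]
  refine intervalIntegral.norm_integral_le_of_norm_le_const fun y hy => ?_
  rw [norm_mul]
  exact (mul_le_of_le_one_left (norm_nonneg _) (hg _)).trans (hC y (uIoc_subset_uIcc hy))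

lemma subexp_cosCoeff {H : ℝ → ℝ} (hH : Continuous H) : Subexp (cosCoeff H) :=
  subexp_coeff hH Real.abs_cos_le_one

lemma subexp_sinCoeff {H : ℝ → ℝ} (hH : Continuous H) : Subexp (sinCoeff H) :=
  subexp_coeff hH Real.abs_sin_le_one

/-- The evolution of `H` is the heat series with the Fourier coefficients of `H`. -/
lemma circleHeat_eq_heatSeries {H : ℝ → ℝ} (hH : Continuous H) {t : ℝ} (ht : 0 < t) :
    circleHeat H t = heatSeries (cosCoeff H) (sinCoeff H) t := by
  funext x
  rw [← (hasSum_circleHeat hH ht x).tsum_eq, heatSeries]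
  refine tsum_congr fun k => ?_
  have : ∫ y in (0)..(2 * Real.pi), Real.cos (k * (y - x)) * H y =
      Real.cos (k * x) * (∫ y in (0)..(2 * Real.pi), Real.cos (k * y) * H y) +
      Real.sin (k * x) * ∫ y in (0)..(2 * Real.pi), Real.sin (k * y) * H y := by
    rw [← intervalIntegral.integral_const_mul, ← intervalIntegral.integral_const_mul,
      ← intervalIntegral.integral_add
        (Continuous.intervalIntegrable (by fun_prop) _ _)
        (Continuous.intervalIntegrable (by fun_prop) _ _)]
    refine intervalIntegral.integral_congr fun y _ => ?_
    simp only [mul_sub, Real.cos_sub]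
    ring
  rw [this, heatTerm, cosCoeff, sinCoeff]
  ring

lemma continuous_circleHeat {H : ℝ → ℝ} (hH : Continuous H) {t : ℝ} (ht : 0 < t) :
    Continuous (circleHeat H t) := by
  rw [circleHeat_eq_heatSeries hH ht]
  exact (contDiff_heatSeries (subexp_cosCoeff hH) (subexp_sinCoeff hH) ht).continuous

lemma intervalIntegrable_circleKernel_mul {H : ℝ → ℝ} (hH : Continuous H) {t : ℝ} (ht : 0 < t)
    (x a b : ℝ) : IntervalIntegrable (fun y => circleKernel t x y * H y) volume a b :=
  (((continuous_circleKernel ht).comp (Continuous.prodMk_right x)).mul hH).intervalIntegrable a b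

lemma circleHeat_add {H G : ℝ → ℝ} (hH : Continuous H) (hG : Continuous G) {t : ℝ} (ht : 0 < t)
    (x : ℝ) : circleHeat (fun y => H y + G y) t x = circleHeat H t x + circleHeat G t x := by
  simp only [circleHeat, mul_add]
  exact intervalIntegral.integral_add (intervalIntegrable_circleKernel_mul hH ht x _ _)
    (intervalIntegrable_circleKernel_mul hG ht x _ _)

lemma circleHeat_const_mul (H : ℝ → ℝ) (c t x : ℝ) :
    circleHeat (fun y => c * H y) t x = c * circleHeat H t x := by
  simp only [circleHeat, mul_left_comm _ c, intervalIntegral.integral_const_mul]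

lemma integral_cos_int_mul_add (m : ℤ) (b : ℝ) :
    ∫ y in (0)..(2 * Real.pi), Real.cos (m * y + b) =
      if m = 0 then 2 * Real.pi * Real.cos b else 0 := by
  split_ifs with h
  · simp [h]
  · have hm : (m : ℝ) ≠ 0 := by exact_mod_cast h
    rw [intervalIntegral.integral_comp_mul_add _ hm, integral_cos, mul_zero, zero_add,
      add_comm _ b, Real.sin_add_int_mul_two_pi, sub_self, smul_zero]

/-- The functions `cos (n x + a)` are eigenfunctions. -/
lemma circleHeat_cos {t : ℝ} (ht : 0 < t) (n : ℕ) (a x : ℝ) :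
    circleHeat (fun y => Real.cos (n * y + a)) t x =
      Real.exp (-(n : ℝ) ^ 2 * t) * Real.cos (n * x + a) := by
  rw [← (hasSum_circleHeat (by fun_prop) ht x).tsum_eq]
  have hpi := Real.pi_ne_zero
  have key : ∀ k : ℕ, ∫ y in (0)..(2 * Real.pi), Real.cos (k * (y - x)) * Real.cos (n * y + a) =
      2⁻¹ * ((if (k : ℤ) - n = 0 then 2 * Real.pi * Real.cos (-(k * x) - a) else 0) +
        (if (k : ℤ) + n = 0 then 2 * Real.pi * Real.cos (-(k * x) + a) else 0)) := by
    intro k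
    rw [← integral_cos_int_mul_add, ← integral_cos_int_mul_add,
      ← intervalIntegral.integral_add
        (Continuous.intervalIntegrable (by fun_prop) _ _)
        (Continuous.intervalIntegrable (by fun_prop) _ _), ← intervalIntegral.integral_const_mul]
    refine intervalIntegral.integral_congr fun y _ => ?_
    change Real.cos (k * (y - x)) * Real.cos (n * y + a) = 2⁻¹ * (_ + _)
    have := Real.two_mul_cos_mul_cos (k * (y - x)) (n * y + a)
    have e1 : (k : ℝ) * (y - x) - (n * y + a) = ((k - n : ℤ) : ℝ) * y + (-(k * x) - a) := by
      push_cast; ring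
    have e2 : (k : ℝ) * (y - x) + (n * y + a) = ((k + n : ℤ) : ℝ) * y + (-(k * x) + a) := by
      push_cast; ring
    rw [e1, e2] at this
    linarith
  rw [tsum_eq_single n]
  · rw [key, sub_self, if_pos rfl]
    have e : Real.cos (-(n * x) - a) = Real.cos (n * x + a) := by
      rw [← Real.cos_neg]; ring_nf
    rw [e]
    by_cases hn : n = 0
    · subst hn
      simp [modeWeight]
      field_simp
      ring
    · rw [if_neg (by omega)]
      simp only [modeWeight, hn, if_false]
      field_simp
      ring
  · intro k hk
    rw [key, if_neg (by omega), if_neg (by omega)]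
    simp

lemma circleHeat_one {t : ℝ} (ht : 0 < t) (x : ℝ) : circleHeat (fun _ => 1) t x = 1 := by
  simpa using circleHeat_cos ht 0 0 x

lemma abs_circleHeat_le {H : ℝ → ℝ} {C : ℝ} (hC : ∀ x, |H x| ≤ C) {t : ℝ}
    (ht : 0 < t) (x : ℝ) : |circleHeat H t x| ≤ C := by
  have h : circleHeat (fun _ => C) t x = C := by
    simpa [circleHeat_one ht] using circleHeat_const_mul (fun _ => 1) C t x
  rw [← h, ← Real.norm_eq_abs]
  refine intervalIntegral.norm_integral_le_of_norm_le (by positivity)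
    (ae_of_all _ fun y _ => ?_)
    (intervalIntegrable_circleKernel_mul continuous_const ht x _ _)
  rw [norm_mul, Real.norm_of_nonneg (circleKernel_nonneg ht _ _)]
  exact mul_le_mul_of_nonneg_left (hC y) (circleKernel_nonneg ht _ _)

lemma circleHeat_nonneg {H : ℝ → ℝ} (hH : ∀ x, 0 ≤ H x) {t : ℝ} (ht : 0 < t) (x : ℝ) :
    0 ≤ circleHeat H t x :=
  intervalIntegral.integral_nonneg (by positivity)
    fun y _ => mul_nonneg (circleKernel_nonneg ht x y) (hH y)

/-! ### Density of trigonometric polynomials -/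

/-- A property of functions that holds for `cos (n x + a)` and is stable under linear combinations
of continuous functions holds for functions arbitrarily close to a given continuous periodic
function. -/
lemma exists_trig_approx {Q : (ℝ → ℝ) → Prop}
    (hcos : ∀ (n : ℕ) (c a : ℝ), Q fun x => c * Real.cos (n * x + a))
    (hadd : ∀ f g, Continuous f → Continuous g → Q f → Q g → Q fun x => f x + g x)
    {H : ℝ → ℝ} (hH : Continuous H) (hp : Function.Periodic H (2 * Real.pi)) {ε : ℝ} (hε : 0 < ε) :
    ∃ q, Q q ∧ Continuous q ∧ ∀ x, |H x - q x| ≤ ε := by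
  have hlift : Continuous (hp.lift : S1 → ℝ) := hH.quotient_lift _
  let h : C(S1, ℂ) := ⟨fun x => (hp.lift x : ℂ), by fun_prop⟩
  have hmem : h ∈ (Submodule.span ℂ (range (@fourier (2 * Real.pi)))).topologicalClosure := by
    rw [span_fourier_closure_eq_top]; trivial
  obtain ⟨f, hf, hfh⟩ := Metric.mem_closure_iff.1 hmem ε hε
  have hspan : ∀ f ∈ Submodule.span ℂ (range (@fourier (2 * Real.pi))),
      ∀ z : ℂ, Q fun x : ℝ => (z * f (x : S1)).re := by
    intro f hf
    induction hf using Submodule.span_induction with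
    | mem f hf =>
      obtain ⟨m, rfl⟩ := hf
      intro z
      have key : ∀ x : ℝ, (z * fourier m (x : S1)).re = ‖z‖ * Real.cos (m * x + z.arg) := by
        intro x
        have e : (2 * Real.pi * Complex.I * m * x / (2 * Real.pi : ℝ) : ℂ) =
            ((m * x : ℝ) : ℂ) * Complex.I := by
          have : (Real.pi : ℂ) ≠ 0 := by exact_mod_cast Real.pi_ne_zero
          push_cast
          field_simp
        rw [fourier_coe_apply, e, ← Complex.norm_mul_exp_arg_mul_I z, mul_assoc, ← Complex.exp_add,
          ← add_mul, Complex.re_ofReal_mul, ← Complex.ofReal_add, Complex.exp_ofReal_mul_I_re,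
          Complex.norm_mul_exp_arg_mul_I, add_comm]
      simp_rw [key]
      obtain ⟨n, rfl | rfl⟩ := m.eq_nat_or_neg
      · simpa using hcos n ‖z‖ z.arg
      · have : ∀ x : ℝ, Real.cos (((-n : ℤ) : ℝ) * x + z.arg) = Real.cos (n * x + -z.arg) := by
          intro x
          rw [← Real.cos_neg]
          congr 1
          push_cast
          ring
        simp_rw [this]
        exact hcos n ‖z‖ (-z.arg)
    | zero => intro z; simpa using hcos 0 0 0
    | add f g _ _ ihf ihg =>
      intro z
      have := hadd _ _ (Complex.continuous_re.comp (continuous_const.mul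
          (f.continuous.comp (AddCircle.continuous_mk' _))))
        (Complex.continuous_re.comp (continuous_const.mul
          (g.continuous.comp (AddCircle.continuous_mk' _)))) (ihf z) (ihg z)
      simpa [mul_add] using this
    | smul a f _ ih =>
      intro z
      simpa [mul_assoc] using ih (z * a)
  refine ⟨fun x => (f (x : S1)).re, by simpa using hspan f hf 1,
    Complex.continuous_re.comp (f.continuous.comp (AddCircle.continuous_mk' _)), fun x => ?_⟩
  have h1 : ‖(h - f) (x : S1)‖ ≤ ε :=
    ((h - f).norm_coe_le_norm _).trans (by rw [← dist_eq_norm]; exact hfh.le)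
  refine le_trans ?_ h1
  have h2 : (h - f) (x : S1) = (H x : ℂ) - f (x : S1) := rfl
  rw [h2]
  simpa using Complex.abs_re_le_norm ((H x : ℂ) - f (x : S1))

/-- A linear functional on functions on the circle that is bounded by the supremum norm. -/
structure ContractiveFunctional (A : (ℝ → ℝ) → ℝ) : Prop where
  add : ∀ f g, Continuous f → Continuous g → A (fun x => f x + g x) = A f + A g
  const_mul : ∀ (c : ℝ) f, Continuous f → A (fun x => c * f x) = c * A f
  bound : ∀ f (C : ℝ), Continuous f → (∀ x, |f x| ≤ C) → |A f| ≤ C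

lemma ContractiveFunctional.map_sub {A : (ℝ → ℝ) → ℝ} (hA : ContractiveFunctional A) {f g : ℝ → ℝ}
    (hf : Continuous f) (hg : Continuous g) : A (fun x => f x - g x) = A f - A g := by
  have h := hA.add f (fun x => -1 * g x) hf (by fun_prop)
  rw [hA.const_mul _ _ hg] at h
  simpa [sub_eq_add_neg] using h

/-- By density of the trigonometric polynomials, contractive functionals are determined by their
values on `cos (n x + a)`. -/
lemma ContractiveFunctional.ext {A B : (ℝ → ℝ) → ℝ} (hA : ContractiveFunctional A)
    (hB : ContractiveFunctional B)
    (h : ∀ (n : ℕ) (a : ℝ), A (fun x => Real.cos (n * x + a)) = B fun x => Real.cos (n * x + a))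
    {H : ℝ → ℝ} (hH : Continuous H) (hp : Function.Periodic H (2 * Real.pi)) : A H = B H := by
  refine eq_of_forall_dist_le fun ε hε => ?_
  obtain ⟨q, hq, hqc, hHq⟩ := exists_trig_approx (Q := fun f => A f = B f)
    (fun n c a => by
      rw [hA.const_mul c _ (by fun_prop), hB.const_mul c _ (by fun_prop), h])
    (fun f g hf hg h1 h2 => by rw [hA.add _ _ hf hg, hB.add _ _ hf hg, h1, h2])
    hH hp (half_pos hε)
  have h1 := hA.bound (fun x => H x - q x) _ (hH.sub hqc) hHq
  have h2 := hB.bound (fun x => H x - q x) _ (hH.sub hqc) hHq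
  rw [hA.map_sub hH hqc] at h1
  rw [hB.map_sub hH hqc, ← hq] at h2
  rw [Real.dist_eq]
  calc |A H - B H| = |(A H - A q) - (B H - A q)| := by ring_nf
    _ ≤ |A H - A q| + |B H - A q| := abs_sub _ _
    _ ≤ ε := by linarith

lemma contractive_circleHeat {t : ℝ} (ht : 0 < t) (x : ℝ) :
    ContractiveFunctional fun H => circleHeat H t x where
  add _ _ hf hg := circleHeat_add hf hg ht x
  const_mul c f _ := circleHeat_const_mul f c t x
  bound _ _ _ h := abs_circleHeat_le h ht x

/-- The semigroup property on the circle. -/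
lemma circleHeat_circleHeat {H : ℝ → ℝ} (hH : Continuous H)
    (hp : Function.Periodic H (2 * Real.pi)) {s t : ℝ} (hs : 0 < s) (ht : 0 < t) (x : ℝ) :
    circleHeat (circleHeat H t) s x = circleHeat H (s + t) x := by
  refine ContractiveFunctional.ext (A := fun H => circleHeat (circleHeat H t) s x)
    ⟨fun f g hf hg => ?_, fun c f hf => ?_, fun f C _ h => ?_⟩
    (contractive_circleHeat (add_pos hs ht) x) (fun n a => ?_) hH hp
  · rw [← circleHeat_add (continuous_circleHeat hf ht) (continuous_circleHeat hg ht) hs]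
    exact congrArg (fun F => circleHeat F s x) (funext fun y => circleHeat_add hf hg ht y)
  · rw [← circleHeat_const_mul]
    exact congrArg (fun F => circleHeat F s x) (funext fun y => circleHeat_const_mul f c t y)
  · exact abs_circleHeat_le (fun y => abs_circleHeat_le h ht y) hs x
  · have h1 : circleHeat (fun y => Real.cos (n * y + a)) t =
        fun y => Real.exp (-(n : ℝ) ^ 2 * t) * Real.cos (n * y + a) :=
      funext fun y => circleHeat_cos ht n a y
    simp only [h1, circleHeat_const_mul, circleHeat_cos hs, circleHeat_cos (add_pos hs ht)]
    rw [← mul_assoc, ← Real.exp_add]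
    ring_nf

/-- Scaling: speeding up the circle `m` times replaces `t` by `m² t`. -/
lemma circleHeat_comp_mul_sub {H : ℝ → ℝ} (hH : Continuous H)
    (hp : Function.Periodic H (2 * Real.pi)) {m : ℕ} (hm : 0 < m) (c : ℝ) {t : ℝ} (ht : 0 < t)
    (x : ℝ) :
    circleHeat (fun y => H (m * y - c)) t x = circleHeat H ((m : ℝ) ^ 2 * t) (m * x - c) := by
  have hm' : (0 : ℝ) < m := by exact_mod_cast hm
  have hmt : 0 < (m : ℝ) ^ 2 * t := by positivity
  refine ContractiveFunctional.ext (A := fun H => circleHeat (fun y => H (m * y - c)) t x)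
    ⟨fun f g hf hg => ?_, fun c f hf => ?_, fun f C _ h => ?_⟩
    (contractive_circleHeat hmt _) (fun n a => ?_) hH hp
  · exact circleHeat_add (hf.comp (by fun_prop)) (hg.comp (by fun_prop)) ht x
  · exact circleHeat_const_mul _ _ _ _
  · exact abs_circleHeat_le (fun y => h _) ht x
  · have e : (fun y : ℝ => Real.cos (n * (m * y - c) + a)) =
        fun y => Real.cos ((n * m : ℕ) * y + (a - n * c)) := by
      funext y; push_cast; ring_nf
    simp only [e, circleHeat_cos ht, circleHeat_cos hmt]
    push_cast
    ring_nf

/-- Strong continuity at time zero on the circle. -/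
lemma tendstoUniformly_circleHeat {H : ℝ → ℝ} (hH : Continuous H)
    (hp : Function.Periodic H (2 * Real.pi)) :
    TendstoUniformly (fun t => circleHeat H t) H (𝓝[>] 0) := by
  rw [Metric.tendstoUniformly_iff]
  intro ε hε
  obtain ⟨q, hq, hqc, hHq⟩ := exists_trig_approx
    (Q := fun f => ∀ δ > 0, ∀ᶠ t in 𝓝[>] (0 : ℝ), ∀ x, |circleHeat f t x - f x| ≤ δ)
    (fun n c a δ hδ => by
      have hlim : Tendsto (fun t : ℝ => |c| * |Real.exp (-(n : ℝ) ^ 2 * t) - 1|) (𝓝[>] 0)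
          (𝓝 0) := by
        have : Continuous fun t : ℝ => |c| * |Real.exp (-(n : ℝ) ^ 2 * t) - 1| := by fun_prop
        simpa using (this.tendsto 0).mono_left nhdsWithin_le_nhds
      filter_upwards [hlim.eventually_le_const hδ, self_mem_nhdsWithin] with t h1 ht x
      rw [circleHeat_const_mul, circleHeat_cos ht]
      refine le_trans ?_ h1
      rw [show c * (Real.exp (-(n : ℝ) ^ 2 * t) * Real.cos (n * x + a)) - c * Real.cos (n * x + a)
        = c * (Real.exp (-(n : ℝ) ^ 2 * t) - 1) * Real.cos (n * x + a) by ring, abs_mul, abs_mul]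
      exact mul_le_of_le_one_right (by positivity) (Real.abs_cos_le_one _))
    (fun f g hf hg h1 h2 δ hδ => by
      filter_upwards [h1 _ (half_pos hδ), h2 _ (half_pos hδ), self_mem_nhdsWithin] with t h3 h4 ht x
      rw [circleHeat_add hf hg ht, add_sub_add_comm]
      exact (abs_add_le _ _).trans (by linarith [h3 x, h4 x]))
    hH hp (show 0 < ε / 4 by positivity)
  filter_upwards [hq (ε / 4) (by positivity), self_mem_nhdsWithin] with t h1 ht x
  have h2 : |circleHeat (fun y => H y - q y) t x| ≤ ε / 4 := abs_circleHeat_le hHq ht x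
  rw [(contractive_circleHeat ht x).map_sub hH hqc] at h2
  have h3 := hHq x
  have h4 := h1 x
  rw [Real.dist_eq, abs_lt]
  rw [abs_le] at h2 h3 h4
  constructor <;> linarith [h2.1, h2.2, h3.1, h3.2, h4.1, h4.2]

/-! ### The parabolic maximum principle -/

/-- At an interior local minimum the second derivative is nonnegative. -/
lemma second_deriv_nonneg_of_isLocalMin {f f' : ℝ → ℝ} {f'' x₀ : ℝ}
    (hf : ∀ x, HasDerivAt f (f' x) x) (hf' : HasDerivAt f' f'' x₀) (hmin : IsLocalMin f x₀) :
    0 ≤ f'' := by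
  by_contra! hneg
  have hd : deriv f = f' := funext fun x => (hf x).deriv
  have hd2 : deriv (fun x => -f x) = fun x => -f' x := funext fun x => (hf x).neg.deriv
  have h0 : f' x₀ = 0 := by rw [← hd]; exact hmin.deriv_eq_zero
  have hmax : IsLocalMin (fun x => -f x) x₀ := by
    refine isLocalMin_of_deriv_deriv_pos ?_ ?_ (hf x₀).neg.continuousAt
    · rw [hd2, hf'.fun_neg.deriv]; linarith
    · rw [hd2]; simp [h0]
  -- a point that is both a local minimum and a local maximum
  have hconst : f =ᶠ[𝓝 x₀] fun _ => f x₀ := by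
    filter_upwards [hmin, hmax] with x h1 h2
    linarith
  have h1 : f' =ᶠ[𝓝 x₀] fun _ => 0 := by
    have := hconst.deriv
    rw [hd] at this
    simpa using this
  have h2 := h1.deriv_eq
  rw [hf'.deriv] at h2
  simp at h2
  linarith

/-- The weak maximum principle for the heat equation on a rectangle. -/
lemma le_of_heat_equation {u ux uxx : ℝ → ℝ → ℝ} {s T a b m : ℝ}
    (hc : ContinuousOn (fun z : ℝ × ℝ => u z.1 z.2) (Icc s T ×ˢ Icc a b))
    (hx : ∀ t ∈ Ioc s T, ∀ x, HasDerivAt (u t) (ux t x) x)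
    (hxx : ∀ t ∈ Ioc s T, ∀ x, HasDerivAt (ux t) (uxx t x) x)
    (ht : ∀ t ∈ Ioc s T, ∀ x, HasDerivAt (fun t => u t x) (uxx t x) t)
    (h0 : ∀ x ∈ Icc a b, m ≤ u s x) (ha : ∀ t ∈ Icc s T, m ≤ u t a)
    (hb : ∀ t ∈ Icc s T, m ≤ u t b) {t x : ℝ} (htm : t ∈ Icc s T) (hxm : x ∈ Icc a b) :
    m ≤ u t x := by
  by_contra! hlt
  have hst : s < t := by
    rcases htm.1.lt_or_eq with h | h
    · exact h
    · subst h; exact absurd (h0 x hxm) (not_le.2 hlt)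
  -- a small drift `δ (t - s)` makes the differential inequality at a minimum strict, while the
  -- minimum stays below `m`
  set δ := (m - u t x) / (2 * (t - s)) with hδ
  have hδ0 : 0 < δ := div_pos (by linarith) (by linarith)
  have hδt : δ * (t - s) = (m - u t x) / 2 := by
    rw [hδ]; field_simp [(sub_pos.2 hst).ne']
  obtain ⟨⟨t₀, x₀⟩, hz, hmin⟩ := (isCompact_Icc.prod isCompact_Icc).exists_isMinOn
    (f := fun z : ℝ × ℝ => u z.1 z.2 + δ * (z.1 - s)) ⟨(t, x), htm, hxm⟩
    (hc.add (by fun_prop))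
  have hmin' : ∀ t' ∈ Icc s T, ∀ x' ∈ Icc a b,
      u t₀ x₀ + δ * (t₀ - s) ≤ u t' x' + δ * (t' - s) := fun t' ht' x' hx' =>
    hmin (show ((t', x') : ℝ × ℝ) ∈ _ from ⟨ht', hx'⟩)
  obtain ⟨ht₀, hx₀⟩ : t₀ ∈ Icc s T ∧ x₀ ∈ Icc a b := hz
  have hltm : u t₀ x₀ + δ * (t₀ - s) < m := by
    have := hmin' t htm x hxm
    linarith
  have hum : u t₀ x₀ < m := by nlinarith [ht₀.1]
  have hst₀ : s < t₀ := by
    rcases ht₀.1.lt_or_eq with h | h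
    · exact h
    · subst h; exact absurd (h0 x₀ hx₀) (not_le.2 hum)
  have hax : a < x₀ := by
    rcases hx₀.1.lt_or_eq with h | h
    · exact h
    · subst h; exact absurd (ha t₀ ht₀) (not_le.2 hum)
  have hxb : x₀ < b := by
    rcases hx₀.2.lt_or_eq with h | h
    · exact h
    · subst h; exact absurd (hb t₀ ht₀) (not_le.2 hum)
  have htI : t₀ ∈ Ioc s T := ⟨hst₀, ht₀.2⟩
  have hpos : 0 ≤ uxx t₀ x₀ := by
    refine second_deriv_nonneg_of_isLocalMin (hx t₀ htI) (hxx t₀ htI x₀) ?_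
    filter_upwards [Ioo_mem_nhds hax hxb] with y hy
    have := hmin' t₀ ht₀ y ⟨hy.1.le, hy.2.le⟩
    linarith
  have hder : HasDerivAt (fun t => u t x₀ + δ * (t - s)) (uxx t₀ x₀ + δ) t₀ := by
    simpa using (ht t₀ htI x₀).fun_add (((hasDerivAt_id t₀).sub_const s).const_mul δ)
  -- the time derivative at the minimum is nonpositive, seen from the left
  have hneg : uxx t₀ x₀ + δ ≤ 0 := by
    have h1 := hder.hasDerivWithinAt (s := Iio t₀)
    rw [hasDerivWithinAt_iff_tendsto_slope' (by simp)] at h1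
    refine le_of_tendsto h1 ?_
    filter_upwards [Ioo_mem_nhdsLT hst₀] with r hr
    have := hmin' r ⟨hr.1.le, hr.2.le.trans ht₀.2⟩ x₀ hx₀
    rw [slope_def_field]
    exact div_nonpos_of_nonneg_of_nonpos (by linarith) (by linarith [hr.2])
  linarith

/-- If the solution of the heat equation with initial value `H` is nonnegative at the ends of an
interval on which `H` is nonnegative, then it is nonnegative on this interval. -/
lemma circleHeat_nonneg_of_boundary {H : ℝ → ℝ} (hH : Continuous H)
    (hp : Function.Periodic H (2 * Real.pi)) {a b : ℝ} (h0 : ∀ x ∈ Icc a b, 0 ≤ H x)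
    (ha : ∀ t, 0 < t → 0 ≤ circleHeat H t a) (hb : ∀ t, 0 < t → 0 ≤ circleHeat H t b)
    {t : ℝ} (ht : 0 < t) {x : ℝ} (hx : x ∈ Icc a b) : 0 ≤ circleHeat H t x := by
  refine le_of_forall_pos_le_add fun ε hε => ?_
  have hunif := Metric.tendstoUniformly_iff.1 (tendstoUniformly_circleHeat hH hp) ε hε
  obtain ⟨s, hs, hst⟩ := (hunif.and (Ioo_mem_nhdsGT ht)).exists
  have hc := subexp_cosCoeff hH
  have hsn := subexp_sinCoeff hH
  have key := le_of_heat_equation (u := heatSeries (cosCoeff H) (sinCoeff H)) (m := -ε) (s := s)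
    (T := t) (a := a) (b := b)
    (ux := heatSeries (fun k => k * sinCoeff H k) (fun k => -(k * cosCoeff H k)))
    (uxx := heatSeries (fun k => k * -(k * cosCoeff H k)) (fun k => -(k * (k * sinCoeff H k))))
    ((continuousOn_heatSeries hc hsn hst.1).mono
      (prod_mono Icc_subset_Ici_self (subset_univ _)))
    (fun r hr y => hasDerivAt_heatSeries_space hc hsn (hst.1.trans hr.1) y)
    (fun r hr y => hasDerivAt_heatSeries_space hsn.mul_nat hc.mul_nat.neg (hst.1.trans hr.1) y)
    (fun r hr y => hasDerivAt_heatSeries_time hc hsn (hst.1.trans hr.1) y)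
    (fun y hy => by
      rw [← circleHeat_eq_heatSeries hH hst.1]
      have h1 := hs y
      rw [Real.dist_eq, abs_lt] at h1
      linarith [h0 y hy, h1.2])
    (fun r hr => by
      have hr0 := hst.1.trans_le hr.1
      rw [← circleHeat_eq_heatSeries hH hr0]
      linarith [ha r hr0])
    (fun r hr => by
      have hr0 := hst.1.trans_le hr.1
      rw [← circleHeat_eq_heatSeries hH hr0]
      linarith [hb r hr0]) (t := t) ⟨hst.2.le, le_rfl⟩ hx
  rw [← circleHeat_eq_heatSeries hH ht] at key
  linarith

/-! ### The spaces `F_i` and their cells -/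

section Parameters

variable (j n : ℕ → ℕ) (i : ℕ)

lemma J_succ : J j (i + 1) = J j i * j (i + 1) := by
  simp [J, Finset.prod_Icc_succ_top]

lemma N_succ : N n (i + 1) = N n i * n (i + 1) := by
  simp [N, Finset.prod_Icc_succ_top]

lemma J_pos {j : ℕ → ℕ} (hj : ∀ l, 1 ≤ l → 2 ≤ j l) (i : ℕ) : 0 < J j i :=
  Finset.prod_pos fun l hl => by have := hj l (Finset.mem_Icc.1 hl).1; omega

lemma N_pos {n : ℕ → ℕ} (hn : ∀ l, 1 ≤ l → 2 ≤ n l) (i : ℕ) : 0 < N n i := J_pos hn i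

lemma J_cast_pos {j : ℕ → ℕ} (hj : ∀ l, 1 ≤ l → 2 ≤ j l) (i : ℕ) : (0 : ℝ) < J j i := by
  exact_mod_cast J_pos hj i

lemma L_pos {j : ℕ → ℕ} (hj : ∀ l, 1 ≤ l → 2 ≤ j l) (i : ℕ) : 0 < L j i :=
  div_pos Real.pi_pos (J_cast_pos hj i)

lemma J_mul_L {j : ℕ → ℕ} (hj : ∀ l, 1 ≤ l → 2 ≤ j l) (i : ℕ) : J j i * L j i = Real.pi := by
  have := (J_cast_pos hj i).ne'
  rw [L]; field_simp

/-- The starting angle of the cells with index `k`. -/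
noncomputable def cellStart (k : ℕ) : ℝ := Real.pi * k / J j i

lemma cellStart_eq (k : ℕ) : cellStart j i k = k * L j i := by
  rw [cellStart, L]; ring

lemma cellStart_succ (k : ℕ) : cellStart j i (k + 1) = cellStart j i k + L j i := by
  rw [cellStart_eq, cellStart_eq]; push_cast; ring

lemma cellStart_zero : cellStart j i 0 = 0 := by simp [cellStart]

lemma cellStart_two_mul_J {j : ℕ → ℕ} (hj : ∀ l, 1 ≤ l → 2 ≤ j l) (i : ℕ) :
    cellStart j i (2 * J j i) = 2 * Real.pi := by
  rw [cellStart_eq]; push_cast; linarith [J_mul_L hj i]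

lemma cast_succ_ne_zero {m : ℕ → ℕ} (hm : ∀ l, 1 ≤ l → 2 ≤ m l) (i : ℕ) :
    (m (i + 1) : ℝ) ≠ 0 := by
  have := hm (i + 1) (by omega)
  positivity

end Parameters

variable {j n : ℕ → ℕ} {i : ℕ}

/-! ### Points, angles and projections -/

lemma cellMap_eq (α : Cell j n i) (θ : ℝ) :
    cellMap j n i α θ = point j n i ((cellStart j i α.1 + θ : ℝ) : S1) α.2 := rfl

/-- The word without its last letter. -/
def wordInit (w : Word n (i + 1)) : Word n i := fun m => w m.castSucc

/-- The word with one more letter. -/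
def wordSnoc (w : Word n i) (a : Fin (n (i + 1))) : Word n (i + 1) :=
  Fin.snoc (α := fun m : Fin (i + 1) => Fin (n (m + 1))) w a

@[simp] lemma wordInit_snoc (w : Word n i) (a : Fin (n (i + 1))) : wordInit (wordSnoc w a) = w := by
  funext m; simp [wordInit, wordSnoc]

@[simp] lemma wordSnoc_last (w : Word n i) (a : Fin (n (i + 1))) :
    wordSnoc w a (Fin.last i) = a := by
  simp [wordSnoc]

lemma wordSnoc_init_last (w : Word n (i + 1)) : wordSnoc (wordInit w) (w (Fin.last i)) = w :=
  Fin.snoc_init_self w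

lemma word_ext {w w' : Word n (i + 1)} (h : wordInit w = wordInit w')
    (h' : w (Fin.last i) = w' (Fin.last i)) : w = w' := by
  rw [← wordSnoc_init_last w, ← wordSnoc_init_last w', h, h']

/-- Words with one more letter are pairs of a word and a letter. -/
def wordEquiv : Word n (i + 1) ≃ Word n i × Fin (n (i + 1)) where
  toFun w := (wordInit w, w (Fin.last i))
  invFun p := wordSnoc p.1 p.2
  left_inv := wordSnoc_init_last
  right_inv p := by simp

lemma point_succ (η : S1) (w : Word n (i + 1)) :
    point j n (i + 1) η w = proj j n i (point j n i η (wordInit w), w (Fin.last i)) := rfl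

lemma angle_proj (p : F j n i × Fin (n (i + 1))) :
    angle j n (i + 1) (proj j n i p) = angle j n i p.1 := rfl

lemma phi_proj (p : F j n i × Fin (n (i + 1))) : phi j n i (proj j n i p) = p.1 := rfl

lemma phi_point (η : S1) (w : Word n (i + 1)) :
    phi j n i (point j n (i + 1) η w) = point j n i η (wordInit w) := rfl

lemma proj_eq_iff {p q : F j n i × Fin (n (i + 1))} :
    proj j n i p = proj j n i q ↔ p.1 = q.1 ∧ (p.2 = q.2 ∨ p.1 ∈ B j n i) :=
  Quotient.eq (r := glue (B j n i) (n (i + 1)))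

lemma proj_surjective : Function.Surjective (proj j n i) := fun x =>
  Quotient.exists_rep (s := glue (B j n i) (n (i + 1))) x

lemma angle_point (η : S1) (w : Word n i) : angle j n i (point j n i η w) = η := by
  induction i with
  | zero => rfl
  | succ i ih => rw [point_succ, angle_proj, ih]

/-- Multiples of `L_i` are multiples of `L_{i+1}`. -/
lemma junctionAngles_mono (hj : ∀ l, 1 ≤ l → 2 ≤ j l) :
    junctionAngles j i ⊆ junctionAngles j (i + 1) := by
  rintro η ⟨k, hk, rfl⟩
  have h1 := hj (i + 1) (by omega)
  refine ⟨k * j (i + 1), ?_, ?_⟩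
  · rw [J_succ, ← mul_assoc]
    exact Nat.mul_lt_mul_of_pos_right hk (by omega)
  · have h2 := (J_cast_pos hj i).ne'
    have h3 : (j (i + 1) : ℝ) ≠ 0 := by positivity
    rw [J_succ]
    congr 1
    push_cast
    field_simp

/-- Points off the identification angles have a unique word. -/
lemma point_injective (hj : ∀ l, 1 ≤ l → 2 ≤ j l) {η : S1} (hη : η ∉ junctionAngles j i)
    {w w' : Word n i} (h : point j n i η w = point j n i η w') : w = w' := by
  induction i with
  | zero => exact Subsingleton.elim _ _
  | succ i ih =>
    rw [point_succ, point_succ, proj_eq_iff] at h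
    refine word_ext (ih (fun h' => hη (junctionAngles_mono hj h')) h.1) (h.2.resolve_right ?_)
    change angle j n i (point j n i η _) ∉ junctionAngles j (i + 1)
    rwa [angle_point]

lemma point_eq_of_mem_junctionAngles {η : S1} (hη : η ∈ junctionAngles j (i + 1))
    {w w' : Word n (i + 1)} (h : wordInit w = wordInit w') :
    point j n (i + 1) η w = point j n (i + 1) η w' := by
  rw [point_succ, point_succ, h, proj_eq_iff]
  refine ⟨rfl, Or.inr ?_⟩
  change angle j n i (point j n i η _) ∈ junctionAngles j (i + 1)
  rwa [angle_point]

/-! ### Angles of cells -/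

lemma cellStart_add_mem (hj : ∀ l, 1 ≤ l → 2 ≤ j l) {k : ℕ} (hk : k < 2 * J j i) {θ : ℝ}
    (hθ : θ ∈ Ico 0 (L j i)) : cellStart j i k + θ ∈ Ico 0 (0 + 2 * Real.pi) := by
  have h1 : ((k : ℝ) + 1) ≤ 2 * J j i := by exact_mod_cast hk
  have h2 := mul_le_mul_of_nonneg_right h1 (L_pos hj i).le
  have h3 := J_mul_L hj i
  have h4 : 0 ≤ (k : ℝ) * L j i := mul_nonneg (Nat.cast_nonneg _) (L_pos hj i).le
  rw [cellStart_eq]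
  constructor <;> linarith [hθ.1, hθ.2]

lemma rep_coe {x : ℝ} (hx : x ∈ Ico 0 (0 + 2 * Real.pi)) : rep (x : S1) = x :=
  AddCircle.equivIco_coe_of_mem hx

lemma coe_rep (η : S1) : ((rep η : ℝ) : S1) = η :=
  (AddCircle.equivIco (2 * Real.pi) 0).symm_apply_apply η

lemma rep_mem (η : S1) : rep η ∈ Ico 0 (0 + 2 * Real.pi) :=
  (AddCircle.equivIco (2 * Real.pi) 0 η).2

lemma theta_cellMap (hj : ∀ l, 1 ≤ l → 2 ≤ j l) (α : Cell j n i) {θ : ℝ}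
    (hθ : θ ∈ Ico 0 (L j i)) : theta j n i (cellMap j n i α θ) = θ := by
  have hL := L_pos hj i
  rw [theta, cellMap_eq, angle_point, rep_coe (cellStart_add_mem hj α.1.2 hθ), cellStart_eq,
    add_div, mul_div_cancel_right₀ _ hL.ne', Int.fract_natCast_add,
    Int.fract_eq_self.2 ⟨div_nonneg hθ.1 hL.le, (div_lt_one hL).2 hθ.2⟩]
  field_simp

lemma eq_of_cellStart_add_eq (hj : ∀ l, 1 ≤ l → 2 ≤ j l) {k k' : ℕ} (hk : k < 2 * J j i)
    (hk' : k' < 2 * J j i) {θ θ' : ℝ} (hθ : θ ∈ Ico 0 (L j i)) (hθ' : θ' ∈ Ico 0 (L j i))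
    (h : ((cellStart j i k + θ : ℝ) : S1) = ((cellStart j i k' + θ' : ℝ) : S1)) :
    k = k' ∧ θ = θ' := by
  have hL := L_pos hj i
  have h1 : cellStart j i k + θ = cellStart j i k' + θ' :=
    (AddCircle.coe_eq_coe_iff_of_mem_Ico (cellStart_add_mem hj hk hθ)
      (cellStart_add_mem hj hk' hθ')).1 h
  have key : ∀ (m : ℕ) (σ : ℝ), σ ∈ Ico 0 (L j i) → ⌊(cellStart j i m + σ) / L j i⌋₊ = m := by
    intro m σ hσ
    rw [cellStart_eq, add_div, mul_div_cancel_right₀ _ hL.ne', add_comm,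
      Nat.floor_add_natCast (div_nonneg hσ.1 hL.le), Nat.floor_eq_zero.2 ((div_lt_one hL).2 hσ.2),
      zero_add]
  have h2 : k = k' := by rw [← key k θ hθ, h1, key k' θ' hθ']
  subst h2
  exact ⟨rfl, by linarith⟩

lemma interior_notMem_junctionAngles (hj : ∀ l, 1 ≤ l → 2 ≤ j l) {k : ℕ} (hk : k < 2 * J j i)
    {θ : ℝ} (hθ : θ ∈ Ioo 0 (L j i)) : ((cellStart j i k + θ : ℝ) : S1) ∉ junctionAngles j i := by
  rintro ⟨k', hk', h⟩
  have h' : ((cellStart j i k + θ : ℝ) : S1) = ((cellStart j i k' + 0 : ℝ) : S1) := by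
    rw [add_zero]; exact h
  have := (eq_of_cellStart_add_eq hj hk hk' (Ioo_subset_Ico_self hθ)
    ⟨le_rfl, L_pos hj i⟩ h').2
  exact hθ.1.ne' this

lemma cellStart_mem_junctionAngles (hj : ∀ l, 1 ≤ l → 2 ≤ j l) {k : ℕ} (hk : k ≤ 2 * J j i) :
    ((cellStart j i k : ℝ) : S1) ∈ junctionAngles j i := by
  rcases hk.lt_or_eq with h | h
  · exact ⟨k, h, rfl⟩
  · refine ⟨0, by have := J_pos hj i; omega, ?_⟩
    subst h
    rw [cellStart_two_mul_J hj]
    simp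

lemma boundary_mem_junctionAngles (hj : ∀ l, 1 ≤ l → 2 ≤ j l) {k : ℕ} (hk : k < 2 * J j i)
    {θ : ℝ} (hθ : θ = 0 ∨ θ = L j i) : ((cellStart j i k + θ : ℝ) : S1) ∈ junctionAngles j i := by
  rcases hθ with rfl | rfl
  · rw [add_zero]; exact cellStart_mem_junctionAngles hj hk.le
  · rw [← cellStart_succ]; exact cellStart_mem_junctionAngles hj hk

/-- The cells are injective in their interior, and an interior point of a cell lies in no other
closed cell. -/
lemma cellMap_inj (hj : ∀ l, 1 ≤ l → 2 ≤ j l) {α β : Cell j n i} {θ θ' : ℝ}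
    (hθ : θ ∈ Icc 0 (L j i)) (hθ' : θ' ∈ Ioo 0 (L j i))
    (h : cellMap j n i α θ = cellMap j n i β θ') : α = β ∧ θ = θ' := by
  have ha := congrArg (angle j n i) h
  rw [cellMap_eq, cellMap_eq, angle_point, angle_point] at ha
  have hint := interior_notMem_junctionAngles hj β.1.2 hθ'
  have hθI : θ ∈ Ioo 0 (L j i) := by
    refine ⟨hθ.1.lt_of_ne' fun h0 => ?_, hθ.2.lt_of_ne fun h0 => ?_⟩
    · exact hint (ha ▸ boundary_mem_junctionAngles hj α.1.2 (Or.inl h0))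
    · exact hint (ha ▸ boundary_mem_junctionAngles hj α.1.2 (Or.inr h0))
  obtain ⟨h1, h2⟩ := eq_of_cellStart_add_eq hj α.1.2 β.1.2 (Ioo_subset_Ico_self hθI)
    (Ioo_subset_Ico_self hθ') ha
  rw [cellMap_eq, cellMap_eq, ha] at h
  exact ⟨Prod.ext (Fin.ext h1) (point_injective hj hint h), h2⟩

lemma exists_point_eq (x : F j n i) : ∃ w, point j n i (angle j n i x) w = x := by
  induction i with
  | zero => exact ⟨fun m => m.elim0, rfl⟩
  | succ i ih =>
    obtain ⟨p, rfl⟩ := proj_surjective x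
    obtain ⟨w, hw⟩ := ih p.1
    refine ⟨wordSnoc w p.2, ?_⟩
    rw [point_succ, wordInit_snoc, wordSnoc_last, angle_proj, hw]

lemma exists_cellMap_eq (hj : ∀ l, 1 ≤ l → 2 ≤ j l) (x : F j n i) :
    ∃ α : Cell j n i, ∃ θ ∈ Icc 0 (L j i), cellMap j n i α θ = x := by
  obtain ⟨w, hw⟩ := exists_point_eq x
  have hL := L_pos hj i
  set r := rep (angle j n i x) with hr
  obtain ⟨h0, h1⟩ : r ∈ Ico 0 (0 + 2 * Real.pi) := rep_mem _
  have h2 : ⌊r / L j i⌋₊ < 2 * J j i := by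
    rw [Nat.floor_lt (div_nonneg h0 hL.le), div_lt_iff₀ hL]
    push_cast
    linarith [J_mul_L hj i]
  have h3 := Nat.floor_le (div_nonneg h0 hL.le)
  have h4 := Nat.lt_floor_add_one (r / L j i)
  rw [le_div_iff₀ hL] at h3
  rw [div_lt_iff₀ hL] at h4
  refine ⟨(⟨_, h2⟩, w), r - cellStart j i ⌊r / L j i⌋₊, ⟨?_, ?_⟩, ?_⟩
  · rw [cellStart_eq]; linarith
  · rw [cellStart_eq]; linarith
  · rw [cellMap_eq]
    simp only [add_sub_cancel]
    rw [hr, coe_rep, hw]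

/-! ### Topology of `F_i` -/

lemma continuous_proj : Continuous (proj j n i) :=
  continuous_quotient_mk' (s := glue (B j n i) (n (i + 1)))

lemma continuous_phi : Continuous (phi j n i) :=
  Continuous.quotient_lift (s := glue (B j n i) (n (i + 1))) continuous_fst _

lemma continuous_angle : Continuous (angle j n i) := by
  induction i with
  | zero => exact continuous_id
  | succ i ih =>
    exact Continuous.quotient_lift (s := glue (B j n i) (n (i + 1))) (ih.comp continuous_fst) _

lemma isClosed_B : IsClosed (B j n i) := by
  have : (junctionAngles j (i + 1)).Finite := by
    refine ((finite_lt_nat (2 * J j (i + 1))).image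
      fun k : ℕ => ((Real.pi * k / J j (i + 1) : ℝ) : S1)).subset ?_
    rintro η ⟨k, hk, rfl⟩
    exact ⟨k, hk, rfl⟩
  exact this.isClosed.preimage continuous_angle

/-- The preimage of the image of a closed set `C` is `C` together with all copies of the
points of the closed set `B` that have a copy in `C`. -/
lemma isClosedMap_proj : IsClosedMap (proj j n i) := by
  intro C hC
  have hq : IsQuotientMap (proj j n i) :=
    isQuotientMap_quotient_mk' (s := glue (B j n i) (n (i + 1)))
  rw [← hq.isClosed_preimage]
  have : proj j n i ⁻¹' (proj j n i '' C) =
      C ∪ (B j n i ×ˢ univ) ∩ ⋃ a : Fin (n (i + 1)), (fun p => (p.1, a)) ⁻¹' C := by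
    ext ⟨x, b⟩
    simp only [mem_preimage, mem_image, mem_union, mem_inter_iff, mem_prod, mem_univ, and_true,
      mem_iUnion]
    constructor
    · rintro ⟨⟨y, a⟩, hy, h⟩
      obtain ⟨h1, h2⟩ := proj_eq_iff.1 h
      obtain rfl : y = x := h1
      rcases h2 with h2 | h2
      · obtain rfl : a = b := h2
        exact Or.inl hy
      · exact Or.inr ⟨h2, a, hy⟩
    · rintro (h | ⟨h, a, ha⟩)
      · exact ⟨_, h, rfl⟩
      · exact ⟨_, ha, proj_eq_iff.2 ⟨rfl, Or.inr h⟩⟩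
  rw [this]
  refine hC.union ((isClosed_B.prod isClosed_univ).inter (isClosed_iUnion_of_finite fun a => ?_))
  exact hC.preimage (by fun_prop)

lemma isProperMap_proj : IsProperMap (proj j n i) := by
  refine isProperMap_iff_isClosedMap_and_compact_fibers.2
    ⟨continuous_proj, isClosedMap_proj, fun y => ?_⟩
  refine Finite.isCompact (Finite.subset
    (finite_range fun a : Fin (n (i + 1)) => (phi j n i y, a)) ?_)
  rintro ⟨x, a⟩ rfl
  exact ⟨a, rfl⟩

/-- The space `F_i` is a quotient of `𝕊¹ × [n_1] × ⋯ × [n_i]` by a closed map with compact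
fibers. -/
lemma isProperMap_point : IsProperMap fun q : S1 × Word n i => point j n i q.1 q.2 := by
  induction i with
  | zero => exact isProperMap_fst_of_compactSpace (X := S1) (Y := Word n 0)
  | succ i ih =>
    have h1 : IsProperMap fun q : S1 × Word n (i + 1) =>
        (((q.1, wordInit q.2), q.2 (Fin.last i)) : (S1 × Word n i) × Fin (n (i + 1))) := by
      refine Continuous.isProperMap ?_
      unfold wordInit
      fun_prop
    exact isProperMap_proj.comp ((ih.prodMap isProperMap_id).comp h1)

lemma continuous_cellMap (α : Cell j n i) : Continuous (cellMap j n i α) := by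
  have h : Continuous fun θ : ℝ => (((cellStart j i α.1 + θ : ℝ) : S1), α.2) :=
    ((AddCircle.continuous_mk' _).comp (by fun_prop)).prodMk continuous_const
  exact isProperMap_point.continuous.comp h

lemma isProperMap_cellMap : IsProperMap fun q : Cell j n i × Icc 0 (L j i) =>
    cellMap j n i q.1 q.2 := by
  have h : Continuous fun q : Cell j n i × Icc 0 (L j i) =>
      (((cellStart j i q.1.1 + q.2 : ℝ) : S1), q.1.2) :=
    continuous_prod_of_discrete_left.2 fun α =>
      ((AddCircle.continuous_mk' _).comp (by fun_prop)).prodMk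
        (continuous_const : Continuous fun _ : Icc 0 (L j i) => α.2)
  exact isProperMap_point.comp h.isProperMap

lemma surjective_cellMap (hj : ∀ l, 1 ≤ l → 2 ≤ j l) :
    Function.Surjective fun q : Cell j n i × Icc 0 (L j i) => cellMap j n i q.1 q.2 := fun x => by
  obtain ⟨α, θ, hθ, h⟩ := exists_cellMap_eq hj x
  exact ⟨(α, ⟨θ, hθ⟩), h⟩

lemma compactSpace_F (hj : ∀ l, 1 ≤ l → 2 ≤ j l) : CompactSpace (F j n i) :=
  (surjective_cellMap hj).compactSpace isProperMap_cellMap.continuous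

/-- A function on `F_i` is continuous as soon as it is continuous on the closed cells. -/
lemma continuous_of_cells (hj : ∀ l, 1 ≤ l → 2 ≤ j l) {g : F j n i → ℝ}
    (h : ∀ α : Cell j n i, ContinuousOn (fun θ => g (cellMap j n i α θ)) (Icc 0 (L j i))) :
    Continuous g := by
  refine (isProperMap_cellMap.isClosedMap.isQuotientMap isProperMap_cellMap.continuous
    (surjective_cellMap hj)).continuous_iff.2 ?_
  exact continuous_prod_of_discrete_left.2 fun α => (h α).domRestrict

/-- A function on `F_i × F_i` is continuous as soon as it is continuous on products of closed
cells. -/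
lemma continuous_of_cells₂ (hj : ∀ l, 1 ≤ l → 2 ≤ j l) {g : F j n i × F j n i → ℝ}
    (h : ∀ α β : Cell j n i, ContinuousOn
      (fun z : ℝ × ℝ => g (cellMap j n i α z.1, cellMap j n i β z.2))
      (Icc 0 (L j i) ×ˢ Icc 0 (L j i))) :
    Continuous g := by
  have hp := (isProperMap_cellMap (j := j) (n := n) (i := i)).prodMap
    (isProperMap_cellMap (j := j) (n := n) (i := i))
  refine (hp.isClosedMap.isQuotientMap hp.continuous
    ((surjective_cellMap hj).prodMap (surjective_cellMap hj))).continuous_iff.2 ?_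
  rw [← (Homeomorph.prodProdProdComm (Cell j n i) (Cell j n i) (Icc 0 (L j i))
    (Icc 0 (L j i))).comp_continuous_iff']
  refine continuous_prod_of_discrete_left.2 fun α => ?_
  exact (h α.1 α.2).comp_continuous (f := fun z : Icc 0 (L j i) × Icc 0 (L j i) =>
    ((z.1 : ℝ), (z.2 : ℝ))) (by fun_prop) fun z => ⟨z.1.2, z.2.2⟩

/-! ### Integration on `F_i` -/

lemma isFiniteMeasure_mu (hn : ∀ l, 1 ≤ l → 2 ≤ n l) : IsFiniteMeasure (mu j n i) := by
  have h : ((N n i : ENNReal)⁻¹) ≠ ⊤ := by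
    simpa using (N_pos hn i).ne'
  have : ∀ α : Cell j n i, IsFiniteMeasure
      (((N n i : ENNReal)⁻¹) • (volume.restrict (Icc 0 (L j i))).map (cellMap j n i α)) :=
    fun α => Measure.smul_finite _ h
  unfold mu
  infer_instance

lemma integral_mu (hj : ∀ l, 1 ≤ l → 2 ≤ j l) (hn : ∀ l, 1 ≤ l → 2 ≤ n l) {G : F j n i → ℝ}
    (hG : Continuous G) :
    ∫ x, G x ∂(mu j n i) =
      ∑ α : Cell j n i, 1 / (N n i : ℝ) * ∫ θ in (0)..(L j i), G (cellMap j n i α θ) := by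
  have hN := N_pos hn i
  have h : ((N n i : ENNReal)⁻¹) ≠ ⊤ := by simpa using hN.ne'
  have hint : ∀ α : Cell j n i, Integrable G
      (((N n i : ENNReal)⁻¹) • (volume.restrict (Icc 0 (L j i))).map (cellMap j n i α)) := by
    intro α
    refine Integrable.smul_measure ?_ h
    rw [integrable_map_measure hG.aestronglyMeasurable (continuous_cellMap α).aemeasurable]
    exact (hG.comp (continuous_cellMap α)).integrableOn_Icc
  rw [mu, integral_finsetSum_measure fun α _ => hint α]
  refine Finset.sum_congr rfl fun α _ => ?_
  rw [integral_smul_measure, integral_map (continuous_cellMap α).aemeasurable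
    hG.aestronglyMeasurable, integral_Icc_eq_integral_Ioc,
    intervalIntegral.integral_of_le (L_pos hj i).le]
  simp

lemma sum_integral_cells (hj : ∀ l, 1 ≤ l → 2 ≤ j l) {g : ℝ → ℝ} (hg : Continuous g) :
    ∑ k : Fin (2 * J j i), ∫ θ in (0)..(L j i), g (cellStart j i k + θ) =
      ∫ x in (0)..(2 * Real.pi), g x := by
  rw [Fin.sum_univ_eq_sum_range (fun k => ∫ θ in (0)..(L j i), g (cellStart j i k + θ))]
  simp_rw [intervalIntegral.integral_comp_add_left, add_zero, ← cellStart_succ]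
  rw [intervalIntegral.sum_integral_adjacent_intervals fun k _ => hg.intervalIntegrable _ _,
    cellStart_zero, cellStart_two_mul_J hj]

lemma continuous_point (w : Word n i) : Continuous fun x : ℝ => point j n i (x : S1) w :=
  isProperMap_point.continuous.comp
    ((AddCircle.continuous_mk' _).prodMk (continuous_const : Continuous fun _ : ℝ => w))

lemma integral_mu_eq_sum_word (hj : ∀ l, 1 ≤ l → 2 ≤ j l) (hn : ∀ l, 1 ≤ l → 2 ≤ n l)
    {G : F j n i → ℝ} (hG : Continuous G) :
    ∫ x, G x ∂(mu j n i) =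
      1 / (N n i : ℝ) * ∑ w : Word n i, ∫ x in (0)..(2 * Real.pi), G (point j n i (x : S1) w) := by
  rw [integral_mu hj hn hG, ← Finset.mul_sum, Fintype.sum_prod_type_right]
  congr 1
  refine Finset.sum_congr rfl fun w _ => ?_
  exact sum_integral_cells hj (hG.comp (continuous_point w))

/-- The average of a function over the last letter. -/
noncomputable def fiberAvg (f : F j n (i + 1) → ℝ) (x : F j n i) : ℝ :=
  1 / (n (i + 1) : ℝ) * ∑ a, f (proj j n i (x, a))

lemma continuous_fiberAvg {f : F j n (i + 1) → ℝ} (hf : Continuous f) :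
    Continuous (fiberAvg f) := by
  refine continuous_const.mul (continuous_finsetSum _ fun a _ => hf.comp (continuous_proj.comp ?_))
  exact Continuous.prodMk_left a

lemma fiberAvg_point (f : F j n (i + 1) → ℝ) (η : S1) (w : Word n i) :
    fiberAvg f (point j n i η w) =
      1 / (n (i + 1) : ℝ) * ∑ a, f (point j n (i + 1) η (wordSnoc w a)) := by
  simp only [fiberAvg, point_succ, wordInit_snoc, wordSnoc_last]

lemma fiberAvg_comp_phi_mul (g : F j n i → ℝ)
    (f : F j n (i + 1) → ℝ) (x : F j n i) :
    fiberAvg (fun y => g (phi j n i y) * f y) x = g x * fiberAvg f x := by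
  simp only [fiberAvg, phi_proj, ← Finset.mul_sum]
  ring

/-- The projection of `μ_{i+1}` to `F_i` is `μ_i`, with the uniform distribution on the fibers. -/
lemma integral_mu_succ (hj : ∀ l, 1 ≤ l → 2 ≤ j l) (hn : ∀ l, 1 ≤ l → 2 ≤ n l)
    {G : F j n (i + 1) → ℝ} (hG : Continuous G) :
    ∫ x, G x ∂(mu j n (i + 1)) = ∫ x, fiberAvg G x ∂(mu j n i) := by
  rw [integral_mu_eq_sum_word hj hn hG, integral_mu_eq_sum_word hj hn (continuous_fiberAvg hG)]
  have h1 : ∀ w : Word n i, ∫ x in (0)..(2 * Real.pi), fiberAvg G (point j n i (x : S1) w) =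
      1 / (n (i + 1) : ℝ) * ∑ a, ∫ x in (0)..(2 * Real.pi),
        G (point j n (i + 1) (x : S1) (wordSnoc w a)) := by
    intro w
    simp_rw [fiberAvg_point]
    rw [intervalIntegral.integral_const_mul, intervalIntegral.integral_finsetSum]
    exact fun a _ => (hG.comp (continuous_point _)).intervalIntegrable _ _
  simp_rw [h1]
  rw [← Finset.mul_sum, ← mul_assoc, ← Fintype.sum_prod_type', ← Equiv.sum_comp wordEquiv]
  rw [N_succ]
  congr 1
  · push_cast; rw [one_div_mul_one_div]
  · refine Finset.sum_congr rfl fun w _ => ?_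
    simp only [wordEquiv, Equiv.coe_fn_mk, wordSnoc_init_last]

/-! ### The Dirichlet correction -/

lemma correction_eq_dirichletKernel (hj : ∀ l, 1 ≤ l → 2 ≤ j l) {t : ℝ} (ht : 0 < t) (θ θ' : ℝ) :
    correction j i t θ θ' = dirichletKernel (L j i) t θ θ' := by
  have hJ := J_cast_pos hj i
  have hpi := Real.pi_pos
  have hs : ∀ x, Summable (heatTerm modeWeight (fun _ => 0) ((J j i : ℝ) ^ 2 * t) x) := fun x =>
    summable_heatTerm subexp_modeWeight subexp_zero (by positivity) x
  rw [correction, circleKernel_eq_heatSeries (by positivity), circleKernel_eq_heatSeries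
    (by positivity), heatSeries, heatSeries, ← (hs _).tsum_sub (hs _),
    ((hs _).sub (hs _)).tsum_eq_zero_add, dirichletKernel, ← tsum_mul_left]
  simp only [heatTerm, Nat.cast_zero, zero_mul, Real.cos_zero, sub_self, zero_add]
  rw [← tsum_mul_left]
  refine tsum_congr fun k => ?_
  have e1 : (((k : ℝ) + 1) ^ 2 * Real.pi ^ 2 / L j i ^ 2) * t =
      ((k : ℝ) + 1) ^ 2 * ((J j i : ℝ) ^ 2 * t) := by
    rw [L]; field_simp
  have e2 : ∀ φ, ((k : ℝ) + 1) * Real.pi * φ / L j i = (k + 1) * (J j i * φ) := by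
    intro φ; rw [L]; field_simp
  have e3 : 2 / L j i = 2 * J j i / Real.pi := by rw [L]; field_simp
  rw [neg_mul, neg_mul (_ / _), e1, e2, e2, e3]
  simp only [modeWeight, Nat.succ_ne_zero, if_false]
  push_cast
  rw [show ((k : ℝ) + 1) * (J j i * θ' - J j i * θ) =
      (k + 1) * (J j i * θ') - (k + 1) * (J j i * θ) by ring,
    show ((k : ℝ) + 1) * (-(J j i * θ') - J j i * θ) =
      -((k + 1) * (J j i * θ') + (k + 1) * (J j i * θ)) by ring, Real.cos_neg, Real.cos_sub,
      Real.cos_add]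
  ring_nf

/-- The correction vanishes at the ends of the cell. -/
lemma correction_boundary (hj : ∀ l, 1 ≤ l → 2 ≤ j l) {t : ℝ} (ht : 0 < t) {θ θ' : ℝ}
    (h : θ = 0 ∨ θ = L j i ∨ θ' = 0 ∨ θ' = L j i) : correction j i t θ θ' = 0 := by
  rw [correction_eq_dirichletKernel hj ht, dirichletKernel]
  have hL := (L_pos hj i).ne'
  have hs : ∀ k : ℕ, Real.sin (((k : ℝ) + 1) * Real.pi * L j i / L j i) = 0 := by
    intro k
    rw [mul_div_cancel_right₀ _ hL]
    exact_mod_cast Real.sin_nat_mul_pi (k + 1)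
  rcases h with rfl | rfl | rfl | rfl <;> simp [hs]

lemma continuous_correction (hj : ∀ l, 1 ≤ l → 2 ≤ j l) {t : ℝ} (ht : 0 < t) :
    Continuous fun z : ℝ × ℝ => correction j i t z.1 z.2 := by
  have hJ := J_cast_pos hj i
  have h := continuous_circleKernel (t := (J j i : ℝ) ^ 2 * t) (by positivity)
  unfold correction
  exact continuous_const.mul ((h.comp (f := fun z : ℝ × ℝ => (J j i * z.1, J j i * z.2))
    (by fun_prop)).sub (h.comp (f := fun z : ℝ × ℝ => (J j i * z.1, -(J j i * z.2)))
    (by fun_prop)))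

lemma correction_symm (t θ θ' : ℝ) : correction j i t θ θ' = correction j i t θ' θ := by
  have h : ∀ s x y, circleKernel s x (-y) = circleKernel s y (-x) := by
    intro s x y
    simp only [circleKernel]
    congr 3 with k
    ring_nf
  rw [correction, correction, circleKernel_symm, h]

/-- The odd `2π`-periodic extension of a function on `[0, π]` that vanishes at the ends; the map
`arccos ∘ cos` folds the line onto `[0, π]`. -/
noncomputable def oddExt (h : ℝ → ℝ) (x : ℝ) : ℝ :=
  if 0 ≤ Real.sin x then h (Real.arccos (Real.cos x)) else -h (Real.arccos (Real.cos x))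

lemma apply_arccos_cos_eq_zero {h : ℝ → ℝ} (h0 : h 0 = 0) (hpi : h Real.pi = 0) {x : ℝ}
    (hx : Real.sin x = 0) : h (Real.arccos (Real.cos x)) = 0 := by
  rcases Real.sin_eq_zero_iff_cos_eq.1 hx with hx | hx <;> simp [hx, h0, hpi]

lemma continuous_oddExt {h : ℝ → ℝ} (hc : Continuous h) (h0 : h 0 = 0) (hpi : h Real.pi = 0) :
    Continuous (oddExt h) := by
  have h1 : Continuous fun x => h (Real.arccos (Real.cos x)) :=
    hc.comp (Real.continuous_arccos.comp Real.continuous_cos)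
  refine Continuous.if_le h1 h1.neg continuous_const Real.continuous_sin fun x hx => ?_
  rw [apply_arccos_cos_eq_zero h0 hpi hx.symm, neg_zero]

lemma periodic_oddExt (h : ℝ → ℝ) : Function.Periodic (oddExt h) (2 * Real.pi) := fun x => by
  simp [oddExt]

lemma oddExt_neg {h : ℝ → ℝ} (h0 : h 0 = 0) (hpi : h Real.pi = 0) (x : ℝ) :
    oddExt h (-x) = -oddExt h x := by
  rcases lt_trichotomy (Real.sin x) 0 with hx | hx | hx
  · simp [oddExt, hx.not_ge, hx.le]
  · simp [oddExt, hx, apply_arccos_cos_eq_zero h0 hpi hx]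
  · simp [oddExt, hx.not_ge, hx.le]

lemma oddExt_of_mem {h : ℝ → ℝ} {x : ℝ} (hx : x ∈ Icc 0 Real.pi) : oddExt h x = h x := by
  rw [oddExt, if_pos (Real.sin_nonneg_of_mem_Icc hx), Real.arccos_cos hx.1 hx.2]

lemma circleKernel_periodic_right (t x : ℝ) :
    Function.Periodic (circleKernel t x) (2 * Real.pi) := fun y => by
  simp only [circleKernel]
  congr 3 with k
  rw [show ((k : ℝ) + 1) * (y + 2 * Real.pi - x) =
    (k + 1) * (y - x) + ((k + 1 : ℕ) : ℝ) * (2 * Real.pi) by push_cast; ring,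
    Real.cos_add_nat_mul_two_pi]

/-- The reflection principle on the circle. -/
lemma circleHeat_oddExt {h : ℝ → ℝ} (hc : Continuous h) (h0 : h 0 = 0) (hpi : h Real.pi = 0)
    {t : ℝ} (ht : 0 < t) (x : ℝ) :
    circleHeat (oddExt h) t x =
      ∫ y in (0)..Real.pi, (circleKernel t x y - circleKernel t x (-y)) * h y := by
  have hcont : Continuous fun y => circleKernel t x y * oddExt h y :=
    ((continuous_circleKernel ht).comp (Continuous.prodMk_right x)).mul
      (continuous_oddExt hc h0 hpi)
  have hper : Function.Periodic (fun y => circleKernel t x y * oddExt h y) (2 * Real.pi) :=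
    (circleKernel_periodic_right t x).mul (periodic_oddExt h)
  have h1 := hper.intervalIntegral_add_eq 0 (-Real.pi)
  rw [zero_add, show -Real.pi + 2 * Real.pi = Real.pi by ring] at h1
  rw [circleHeat, h1, ← intervalIntegral.integral_add_adjacent_intervals
    (hcont.intervalIntegrable (-Real.pi) 0) (hcont.intervalIntegrable 0 Real.pi)]
  have h2 := intervalIntegral.integral_comp_neg (a := 0) (b := Real.pi)
    (fun y => circleKernel t x y * oddExt h y)
  rw [neg_zero] at h2
  rw [← h2, ← intervalIntegral.integral_add
    (Continuous.intervalIntegrable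
      (by exact hcont.comp continuous_neg) _ _) (hcont.intervalIntegrable _ _)]
  refine intervalIntegral.integral_congr fun y hy => ?_
  rw [uIcc_of_le Real.pi_pos.le] at hy
  simp only [oddExt_neg h0 hpi, oddExt_of_mem hy]
  ring

/-- The initial value on the circle whose heat evolution, seen from the cell with index `k`, is
the Dirichlet heat evolution of `g` on this cell. -/
noncomputable def cellExt (j : ℕ → ℕ) (i k : ℕ) (g : ℝ → ℝ) (x : ℝ) : ℝ :=
  oddExt (fun s => g (s / J j i)) (J j i * x - k * Real.pi)

lemma continuous_cellExt {g : ℝ → ℝ} (hg : Continuous g) (h0 : g 0 = 0) (hL : g (L j i) = 0)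
    (k : ℕ) : Continuous (cellExt j i k g) :=
  (continuous_oddExt (h := fun s => g (s / J j i)) (hg.comp (by fun_prop)) (by simpa using h0)
    hL).comp (f := fun x : ℝ => J j i * x - k * Real.pi) (by fun_prop)

lemma circleHeat_cellExt {g : ℝ → ℝ} (hg : Continuous g) (h0 : g 0 = 0) (hL : g (L j i) = 0)
    (k : ℕ) (hj : ∀ l, 1 ≤ l → 2 ≤ j l) {t : ℝ} (ht : 0 < t) (θ : ℝ) :
    circleHeat (cellExt j i k g) t (cellStart j i k + θ) =
      ∫ θ' in (0)..(L j i), correction j i t θ θ' * g θ' := by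
  have hJ := J_cast_pos hj i
  have hh0 : (fun s => g (s / J j i)) 0 = 0 := by simpa using h0
  have hhc : Continuous fun s => g (s / J j i) := hg.comp (by fun_prop)
  have e : J j i * (cellStart j i k + θ) - k * Real.pi = J j i * θ := by
    rw [cellStart]; field_simp; ring
  unfold cellExt
  rw [circleHeat_comp_mul_sub (continuous_oddExt hhc hh0 hL) (periodic_oddExt _) (J_pos hj i) _ ht,
    e, circleHeat_oddExt hhc hh0 hL (by positivity)]
  have h1 := intervalIntegral.integral_comp_mul_left (a := 0) (b := L j i)
    (fun y => (circleKernel ((J j i : ℝ) ^ 2 * t) (J j i * θ) y -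
      circleKernel ((J j i : ℝ) ^ 2 * t) (J j i * θ) (-y)) * g (y / J j i)) hJ.ne'
  rw [mul_zero, J_mul_L hj, smul_eq_mul, eq_inv_mul_iff_mul_eq₀ hJ.ne'] at h1
  rw [← h1, ← intervalIntegral.integral_const_mul]
  refine intervalIntegral.integral_congr fun y _ => ?_
  simp only [correction, mul_div_cancel_left₀ _ hJ.ne']
  ring

lemma periodic_cellExt (j : ℕ → ℕ) (i k : ℕ) (g : ℝ → ℝ) :
    Function.Periodic (cellExt j i k g) (2 * Real.pi) := fun x => by
  have := (periodic_oddExt (fun s => g (s / J j i))).nat_mul (J j i) (J j i * x - k * Real.pi)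
  rw [cellExt, cellExt, ← this]
  congr 1
  ring

lemma cellExt_cellStart_add (hj : ∀ l, 1 ≤ l → 2 ≤ j l) (g : ℝ → ℝ) (k : ℕ) {θ : ℝ}
    (hθ : θ ∈ Icc 0 (L j i)) : cellExt j i k g (cellStart j i k + θ) = g θ := by
  have hJ := J_cast_pos hj i
  have e : J j i * (cellStart j i k + θ) - k * Real.pi = J j i * θ := by
    rw [cellStart]; field_simp; ring
  rw [cellExt, e, oddExt_of_mem, mul_div_cancel_left₀ _ hJ.ne']
  refine ⟨mul_nonneg hJ.le hθ.1, ?_⟩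
  rw [← J_mul_L hj i]
  exact mul_le_mul_of_nonneg_left hθ.2 hJ.le

/-! ### The kernel on pairs of cells -/

lemma sameStrand_cellMap_iff (hj : ∀ l, 1 ≤ l → 2 ≤ j l) {α β : Cell j n i} {θ θ' : ℝ}
    (hθ : θ ∈ Icc 0 (L j i)) (hθ' : θ' ∈ Icc 0 (L j i)) :
    SameStrand j n i (cellMap j n i α θ) (cellMap j n i β θ') ↔
      α = β ∧ θ ∈ Ioo 0 (L j i) ∧ θ' ∈ Ioo 0 (L j i) := by
  constructor
  · rintro ⟨γ, ⟨σ, hσ, h1⟩, ⟨σ', hσ', h2⟩⟩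
    obtain ⟨rfl, rfl⟩ := cellMap_inj hj hθ hσ h1.symm
    obtain ⟨rfl, rfl⟩ := cellMap_inj hj hθ' hσ' h2.symm
    exact ⟨rfl, hσ, hσ'⟩
  · rintro ⟨rfl, h1, h2⟩
    exact ⟨α, mem_image_of_mem _ h1, mem_image_of_mem _ h2⟩

/-- Two cells of `F_{i+1}` in the same bundle: they have the same image in `F_i`. -/
def Parallel (α β : Cell j n (i + 1)) : Prop := α.1 = β.1 ∧ wordInit α.2 = wordInit β.2

instance (α β : Cell j n (i + 1)) : Decidable (Parallel α β) :=
  inferInstanceAs (Decidable (_ ∧ _))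

lemma sameBundle_cellMap_iff (hj : ∀ l, 1 ≤ l → 2 ≤ j l) {α β : Cell j n (i + 1)} {θ θ' : ℝ}
    (hθ : θ ∈ Icc 0 (L j (i + 1))) (hθ' : θ' ∈ Icc 0 (L j (i + 1))) :
    SameBundle j n i (cellMap j n (i + 1) α θ) (cellMap j n (i + 1) β θ') ↔
      Parallel α β ∧ θ ∈ Ioo 0 (L j (i + 1)) ∧ θ' ∈ Ioo 0 (L j (i + 1)) := by
  constructor
  · rintro ⟨γ, δ, hγ, hδ, ⟨σ, hσ, h1⟩, ⟨σ', hσ', h2⟩⟩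
    obtain ⟨rfl, rfl⟩ := cellMap_inj hj hθ hσ h1.symm
    obtain ⟨rfl, rfl⟩ := cellMap_inj hj hθ' hσ' h2.symm
    exact ⟨⟨hγ, funext hδ⟩, hσ, hσ'⟩
  · rintro ⟨⟨h1, h2⟩, h3, h4⟩
    exact ⟨α, β, h1, congrFun h2, mem_image_of_mem _ h3, mem_image_of_mem _ h4⟩

/-- The coefficient of the Dirichlet kernel in the heat kernel on a pair of cells. -/
noncomputable def cellCoeff (α β : Cell j n (i + 1)) : ℝ :=
  N n i * (n (i + 1) * (if α = β then 1 else 0) - if Parallel α β then 1 else 0)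

/-- The recursion for the kernel on a pair of closed cells, without distinction of cases: at the
ends of the cells, which belong to no strand, the Dirichlet kernel vanishes. -/
lemma p_succ_cellMap (hj : ∀ l, 1 ≤ l → 2 ≤ j l) {t : ℝ} (ht : 0 < t) (α β : Cell j n (i + 1))
    {θ θ' : ℝ} (hθ : θ ∈ Icc 0 (L j (i + 1))) (hθ' : θ' ∈ Icc 0 (L j (i + 1))) :
    p j n (i + 1) t (cellMap j n (i + 1) α θ) (cellMap j n (i + 1) β θ') =
      p j n i t (phi j n i (cellMap j n (i + 1) α θ)) (phi j n i (cellMap j n (i + 1) β θ')) +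
        cellCoeff α β * correction j (i + 1) t θ θ' := by
  rw [p, sameStrand_cellMap_iff hj hθ hθ', sameBundle_cellMap_iff hj hθ hθ']
  by_cases hint : θ ∈ Ioo 0 (L j (i + 1)) ∧ θ' ∈ Ioo 0 (L j (i + 1))
  · have h1 := theta_cellMap hj α (Ioo_subset_Ico_self hint.1)
    have h2 := theta_cellMap hj β (Ioo_subset_Ico_self hint.2)
    rw [h1, h2, cellCoeff]
    by_cases hαβ : α = β
    · subst hαβ
      rw [if_pos ⟨rfl, hint⟩, if_pos rfl, if_pos ⟨rfl, rfl⟩]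
      ring
    · rw [if_neg (fun h => hαβ h.1), if_neg hαβ]
      by_cases hp : Parallel α β
      · rw [if_pos ⟨hp, hint⟩, if_pos hp]
        ring
      · rw [if_neg (fun h => hp h.1), if_neg hp]
        ring
  · rw [if_neg (fun h => hint h.2), if_neg (fun h => hint h.2), correction_boundary hj ht, mul_zero,
      add_zero]
    by_contra! h
    exact hint ⟨⟨hθ.1.lt_of_ne' h.1, hθ.2.lt_of_ne h.2.1⟩,
      ⟨hθ'.1.lt_of_ne' h.2.2.1, hθ'.2.lt_of_ne h.2.2.2⟩⟩

lemma circleKernel_periodic_left (t y : ℝ) :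
    Function.Periodic (fun x => circleKernel t x y) (2 * Real.pi) := fun x => by
  simpa only [circleKernel_symm t _ y] using circleKernel_periodic_right t y x

lemma apply_rep_coe {f : ℝ → ℝ} (hf : Function.Periodic f (2 * Real.pi)) (x : ℝ) :
    f (rep (x : S1)) = f x := by
  rw [← hf.lift_coe, coe_rep, hf.lift_coe]

lemma p_zero_point (t x y : ℝ) (w w' : Word n 0) :
    p j n 0 t (point j n 0 (x : S1) w) (point j n 0 (y : S1) w') = circleKernel t x y := by
  change circleKernel t (rep (x : S1)) (rep (y : S1)) = _
  rw [apply_rep_coe (circleKernel_periodic_right t _),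
    apply_rep_coe (circleKernel_periodic_left t y)]

lemma continuous_p (hj : ∀ l, 1 ≤ l → 2 ≤ j l) {t : ℝ} (ht : 0 < t) :
    Continuous fun z : F j n i × F j n i => p j n i t z.1 z.2 := by
  induction i with
  | zero =>
    refine continuous_of_cells₂ hj fun α β => Continuous.continuousOn ?_
    have : ∀ z : ℝ × ℝ, p j n 0 t (cellMap j n 0 α z.1) (cellMap j n 0 β z.2) =
        circleKernel t (cellStart j 0 α.1 + z.1) (cellStart j 0 β.1 + z.2) := fun z =>
      p_zero_point _ _ _ _ _
    simp_rw [this]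
    exact (continuous_circleKernel ht).comp (f := fun z : ℝ × ℝ =>
      (cellStart j 0 α.1 + z.1, cellStart j 0 β.1 + z.2)) (by fun_prop)
  | succ i ih =>
    refine continuous_of_cells₂ hj fun α β => ContinuousOn.congr (Continuous.continuousOn ?_)
      fun z hz => p_succ_cellMap hj ht α β hz.1 hz.2
    have h1 : Continuous fun z : ℝ × ℝ =>
        (phi j n i (cellMap j n (i + 1) α z.1), phi j n i (cellMap j n (i + 1) β z.2)) :=
      (continuous_phi.comp ((continuous_cellMap α).comp continuous_fst)).prodMk
        (continuous_phi.comp ((continuous_cellMap β).comp continuous_snd))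
    exact (ih.comp h1).add (continuous_const.mul (continuous_correction hj ht))

lemma sameStrand_comm {x y : F j n i} : SameStrand j n i x y ↔ SameStrand j n i y x :=
  exists_congr fun _ => and_comm

lemma sameBundle_comm {x y : F j n (i + 1)} : SameBundle j n i x y ↔ SameBundle j n i y x := by
  constructor <;> exact fun ⟨α, β, h1, h2, h3, h4⟩ => ⟨β, α, h1.symm, fun m => (h2 m).symm, h4, h3⟩

lemma SameStrand.sameBundle {x y : F j n (i + 1)} (h : SameStrand j n (i + 1) x y) :
    SameBundle j n i x y :=
  let ⟨α, h1, h2⟩ := h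
  ⟨α, α, rfl, fun _ => rfl, h1, h2⟩

lemma p_symm (t : ℝ) (x y : F j n i) : p j n i t x y = p j n i t y x := by
  induction i with
  | zero => exact circleKernel_symm _ _ _
  | succ i ih =>
    rw [p, p, ih, correction_symm, sameStrand_comm, sameBundle_comm]

/-! ### The recursion for the semigroup -/

lemma continuous_p_left (hj : ∀ l, 1 ≤ l → 2 ≤ j l) {t : ℝ} (ht : 0 < t) (x : F j n i) :
    Continuous fun y => p j n i t x y :=
  (continuous_p hj ht).comp (Continuous.prodMk_right x)

lemma continuous_p_mul (hj : ∀ l, 1 ≤ l → 2 ≤ j l) {t : ℝ} (ht : 0 < t) (x : F j n i)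
    {f : F j n i → ℝ} (hf : Continuous f) : Continuous fun y => p j n i t x y * f y :=
  (continuous_p_left hj ht x).mul hf

lemma continuous_correction_right (hj : ∀ l, 1 ≤ l → 2 ≤ j l) {t : ℝ} (ht : 0 < t) (θ : ℝ) :
    Continuous fun θ' => correction j i t θ θ' :=
  (continuous_correction (i := i) hj ht).comp (f := fun θ' : ℝ => (θ, θ')) (by fun_prop)

lemma kernelOp_of_pos {X : Type*} [MeasurableSpace X] (μ : Measure X) (q : ℝ → X → X → ℝ) {t : ℝ}
    (ht : 0 < t) (f : X → ℝ) (x : X) : kernelOp μ q t f x = ∫ y, q t x y * f y ∂μ :=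
  if_neg ht.ne'

lemma kernelOp_zero_point (hj : ∀ l, 1 ≤ l → 2 ≤ j l) (hn : ∀ l, 1 ≤ l → 2 ≤ n l)
    {f : F j n 0 → ℝ} (hf : Continuous f) {t : ℝ} (ht : 0 < t) (x : ℝ) (w : Word n 0) :
    kernelOp (mu j n 0) (p j n 0) t f (point j n 0 (x : S1) w) =
      circleHeat (fun y : ℝ => f (point j n 0 (y : S1) w)) t x := by
  rw [kernelOp_of_pos _ _ ht, integral_mu_eq_sum_word hj hn (continuous_p_mul hj ht _ hf)]
  have hN : N n 0 = 1 := by simp [N]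
  rw [hN, Fintype.sum_unique, circleHeat, Nat.cast_one, div_one, one_mul]
  refine intervalIntegral.integral_congr fun y _ => ?_
  rw [p_zero_point, Subsingleton.elim w default]

/-- The cell of the same bundle with last letter `a`. -/
def sibling (α : Cell j n (i + 1)) (a : Fin (n (i + 1))) : Cell j n (i + 1) :=
  (α.1, wordSnoc (wordInit α.2) a)

lemma fiberAvg_phi_cellMap (f : F j n (i + 1) → ℝ) (α : Cell j n (i + 1)) (θ : ℝ) :
    fiberAvg f (phi j n i (cellMap j n (i + 1) α θ)) =
      1 / (n (i + 1) : ℝ) * ∑ a, f (cellMap j n (i + 1) (sibling α a) θ) := by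
  rw [cellMap_eq, phi_point, fiberAvg_point]
  rfl

/-- Summation against the coefficients is projection onto the deviations from the mean of a
bundle. -/
lemma sum_cellCoeff_mul (hn : ∀ l, 1 ≤ l → 2 ≤ n l) (α : Cell j n (i + 1))
    (I : Cell j n (i + 1) → ℝ) :
    ∑ β, 1 / (N n (i + 1) : ℝ) * (cellCoeff α β * I β) =
      I α - 1 / (n (i + 1) : ℝ) * ∑ a, I (sibling α a) := by
  have hN : (N n i : ℝ) ≠ 0 := by exact_mod_cast (N_pos hn i).ne'
  have hn' := cast_succ_ne_zero hn i
  have h1 : ∑ β, (if Parallel α β then 1 else 0) * I β = ∑ a, I (sibling α a) := by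
    rw [Fintype.sum_prod_type, Finset.sum_eq_single α.1]
    · rw [← Equiv.sum_comp wordEquiv.symm, Fintype.sum_prod_type,
        Finset.sum_eq_single (wordInit α.2)]
      · refine Finset.sum_congr rfl fun a _ => ?_
        rw [if_pos ⟨rfl, by simp [wordEquiv]⟩, one_mul]
        rfl
      · intro w _ hw
        refine Finset.sum_eq_zero fun a _ => ?_
        rw [if_neg (fun h => hw (by simpa [wordEquiv] using h.2.symm)), zero_mul]
      · simp
    · intro k _ hk
      refine Finset.sum_eq_zero fun w _ => ?_
      rw [if_neg (fun h => hk h.1.symm), zero_mul]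
    · simp
  have h2 : ∑ β, (if α = β then 1 else 0) * I β = I α := by simp
  rw [← h1]
  nth_rw 1 [← h2]
  rw [Finset.mul_sum, ← Finset.sum_sub_distrib]
  refine Finset.sum_congr rfl fun β _ => ?_
  rw [cellCoeff, N_succ]
  push_cast
  field_simp

/-- The deviation of a function on `F_{i+1}` from its fiber average, along a cell. -/
noncomputable def fiberDev (f : F j n (i + 1) → ℝ) (α : Cell j n (i + 1)) (θ : ℝ) : ℝ :=
  f (cellMap j n (i + 1) α θ) - fiberAvg f (phi j n i (cellMap j n (i + 1) α θ))

lemma continuous_fiberDev {f : F j n (i + 1) → ℝ} (hf : Continuous f) (α : Cell j n (i + 1)) :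
    Continuous (fiberDev f α) :=
  (hf.comp (continuous_cellMap α)).sub
    ((continuous_fiberAvg hf).comp (continuous_phi.comp (continuous_cellMap α)))

lemma cellMap_sibling_boundary (hj : ∀ l, 1 ≤ l → 2 ≤ j l) (α : Cell j n (i + 1))
    (a : Fin (n (i + 1))) {θ : ℝ} (hθ : θ = 0 ∨ θ = L j (i + 1)) :
    cellMap j n (i + 1) (sibling α a) θ = cellMap j n (i + 1) α θ :=
  point_eq_of_mem_junctionAngles (boundary_mem_junctionAngles hj α.1.2 hθ) (by simp [sibling])

lemma fiberAvg_boundary (hj : ∀ l, 1 ≤ l → 2 ≤ j l) (hn : ∀ l, 1 ≤ l → 2 ≤ n l)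
    (f : F j n (i + 1) → ℝ) (α : Cell j n (i + 1)) {θ : ℝ} (hθ : θ = 0 ∨ θ = L j (i + 1)) :
    fiberAvg f (phi j n i (cellMap j n (i + 1) α θ)) = f (cellMap j n (i + 1) α θ) := by
  have hn' := cast_succ_ne_zero hn i
  rw [fiberAvg_phi_cellMap]
  simp_rw [cellMap_sibling_boundary hj α _ hθ]
  rw [Finset.sum_const, Finset.card_univ, Fintype.card_fin, nsmul_eq_mul]
  field_simp

lemma fiberDev_boundary (hj : ∀ l, 1 ≤ l → 2 ≤ j l) (hn : ∀ l, 1 ≤ l → 2 ≤ n l)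
    (f : F j n (i + 1) → ℝ) (α : Cell j n (i + 1)) {θ : ℝ} (hθ : θ = 0 ∨ θ = L j (i + 1)) :
    fiberDev f α θ = 0 := by
  rw [fiberDev, fiberAvg_boundary hj hn f α hθ, sub_self]

lemma integral_p_succ_mul (hj : ∀ l, 1 ≤ l → 2 ≤ j l) (hn : ∀ l, 1 ≤ l → 2 ≤ n l)
    {f : F j n (i + 1) → ℝ} (hf : Continuous f) {t : ℝ} (ht : 0 < t) (α : Cell j n (i + 1)) {θ : ℝ}
    (hθ : θ ∈ Icc 0 (L j (i + 1))) :
    ∫ y, p j n (i + 1) t (cellMap j n (i + 1) α θ) y * f y ∂(mu j n (i + 1)) =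
      ∫ y, p j n i t (phi j n i (cellMap j n (i + 1) α θ)) (phi j n i y) * f y ∂(mu j n (i + 1)) +
        ∑ β, 1 / (N n (i + 1) : ℝ) * (cellCoeff α β * ∫ θ' in (0)..(L j (i + 1)),
          correction j (i + 1) t θ θ' * f (cellMap j n (i + 1) β θ')) := by
  have hfst : Continuous fun y =>
      p j n i t (phi j n i (cellMap j n (i + 1) α θ)) (phi j n i y) * f y :=
    ((continuous_p_left hj ht _).comp continuous_phi).mul hf
  have hcor : Continuous fun θ' => correction j (i + 1) t θ θ' :=
    continuous_correction_right hj ht θ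
  rw [integral_mu hj hn (continuous_p_mul hj ht _ hf), integral_mu hj hn hfst,
    ← Finset.sum_add_distrib]
  refine Finset.sum_congr rfl fun β _ => ?_
  have h1 : Continuous fun θ' => p j n i t (phi j n i (cellMap j n (i + 1) α θ))
      (phi j n i (cellMap j n (i + 1) β θ')) * f (cellMap j n (i + 1) β θ') :=
    hfst.comp (continuous_cellMap β)
  have h2 : Continuous fun θ' =>
      cellCoeff α β * (correction j (i + 1) t θ θ' * f (cellMap j n (i + 1) β θ')) :=
    continuous_const.mul (hcor.mul (hf.comp (continuous_cellMap β)))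
  rw [← mul_add]
  congr 1
  rw [← intervalIntegral.integral_const_mul, ← intervalIntegral.integral_add
    (h1.intervalIntegrable _ _) (h2.intervalIntegrable _ _)]
  refine intervalIntegral.integral_congr fun θ' hθ' => ?_
  rw [uIcc_of_le (L_pos hj (i + 1)).le] at hθ'
  rw [p_succ_cellMap hj ht α β hθ hθ']
  ring

/-- The semigroup acts on fiber averages as the semigroup of the previous level, and on deviations
from them as the Dirichlet semigroup of the cells. -/
lemma kernelOp_succ (hj : ∀ l, 1 ≤ l → 2 ≤ j l) (hn : ∀ l, 1 ≤ l → 2 ≤ n l)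
    {f : F j n (i + 1) → ℝ} (hf : Continuous f) {t : ℝ} (ht : 0 < t) (α : Cell j n (i + 1)) {θ : ℝ}
    (hθ : θ ∈ Icc 0 (L j (i + 1))) :
    kernelOp (mu j n (i + 1)) (p j n (i + 1)) t f (cellMap j n (i + 1) α θ) =
      kernelOp (mu j n i) (p j n i) t (fiberAvg f) (phi j n i (cellMap j n (i + 1) α θ)) +
        circleHeat (cellExt j (i + 1) α.1 (fiberDev f α)) t (cellStart j (i + 1) α.1 + θ) := by
  have hfst : Continuous fun y =>
      p j n i t (phi j n i (cellMap j n (i + 1) α θ)) (phi j n i y) * f y :=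
    ((continuous_p_left hj ht _).comp continuous_phi).mul hf
  have hcor : Continuous fun θ' => correction j (i + 1) t θ θ' :=
    continuous_correction_right hj ht θ
  have hint : ∀ β : Cell j n (i + 1), IntervalIntegrable (fun θ' =>
      correction j (i + 1) t θ θ' * f (cellMap j n (i + 1) β θ')) volume 0 (L j (i + 1)) := fun β =>
    (hcor.mul (hf.comp (continuous_cellMap β))).intervalIntegrable _ _
  have hsum : Continuous fun θ' => 1 / (n (i + 1) : ℝ) *
      ∑ a, correction j (i + 1) t θ θ' * f (cellMap j n (i + 1) (sibling α a) θ') :=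
    continuous_const.mul (continuous_finsetSum _ fun a _ =>
      hcor.mul (hf.comp (continuous_cellMap _)))
  rw [circleHeat_cellExt (continuous_fiberDev hf α) (fiberDev_boundary hj hn f α (Or.inl rfl))
    (fiberDev_boundary hj hn f α (Or.inr rfl)) _ hj ht, kernelOp_of_pos _ _ ht,
    kernelOp_of_pos _ _ ht, integral_p_succ_mul hj hn hf ht α hθ, integral_mu_succ hj hn hfst,
    sum_cellCoeff_mul hn]
  congr 1
  · refine integral_congr_ae (ae_of_all _ fun y => ?_)
    exact fiberAvg_comp_phi_mul (fun z => p j n i t (phi j n i (cellMap j n (i + 1) α θ)) z) f y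
  · rw [← intervalIntegral.integral_finsetSum fun a _ => hint (sibling α a),
      ← intervalIntegral.integral_const_mul, ← intervalIntegral.integral_sub (hint α)
      (hsum.intervalIntegrable _ _)]
    refine intervalIntegral.integral_congr fun θ' _ => ?_
    simp only [fiberDev]
    rw [fiberAvg_phi_cellMap, ← Finset.mul_sum]
    ring

/-! ### Representation of the semigroup on cells by the circle -/

/-- The cells of level `i + 1` (up to words) as pairs of a cell of level `i` and the position
inside it. -/
def subcellEquiv (j : ℕ → ℕ) (i : ℕ) :
    Fin (2 * J j i) × Fin (j (i + 1)) ≃ Fin (2 * J j (i + 1)) :=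
  finProdFinEquiv.trans (finCongr (by rw [J_succ, mul_assoc]))

lemma subcellEquiv_val (q : Fin (2 * J j i) × Fin (j (i + 1))) :
    (subcellEquiv j i q : ℕ) = q.2 + j (i + 1) * q.1 := rfl

lemma L_eq_mul_L_succ (hj : ∀ l, 1 ≤ l → 2 ≤ j l) : L j i = j (i + 1) * L j (i + 1) := by
  have h1 := (J_cast_pos hj i).ne'
  have h2 := cast_succ_ne_zero hj i
  rw [L, L, J_succ]
  push_cast
  field_simp

lemma cellStart_succ_level (hj : ∀ l, 1 ≤ l → 2 ≤ j l) (k r : ℕ) :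
    cellStart j (i + 1) (r + j (i + 1) * k) = cellStart j i k + r * L j (i + 1) := by
  rw [cellStart_eq, cellStart_eq, L_eq_mul_L_succ (i := i) hj]
  push_cast
  ring

/-- The cell of `F_i` that contains the image of a cell of `F_{i+1}`. -/
def parent (α : Cell j n (i + 1)) : Cell j n i :=
  (((subcellEquiv j i).symm α.1).1, wordInit α.2)

/-- The position of a cell of `F_{i+1}` in the cell of `F_i` that contains its image. -/
noncomputable def offset (α : Cell j n (i + 1)) : ℝ :=
  (((subcellEquiv j i).symm α.1).2 : ℕ) * L j (i + 1)

lemma cellStart_parent (hj : ∀ l, 1 ≤ l → 2 ≤ j l) (α : Cell j n (i + 1)) :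
    cellStart j (i + 1) α.1 = cellStart j i (parent α).1 + offset α := by
  conv_lhs => rw [← (subcellEquiv j i).apply_symm_apply α.1]
  rw [subcellEquiv_val, cellStart_succ_level hj]
  rfl

lemma offset_add_mem (hj : ∀ l, 1 ≤ l → 2 ≤ j l) (α : Cell j n (i + 1)) {θ : ℝ}
    (hθ : θ ∈ Icc 0 (L j (i + 1))) : offset α + θ ∈ Icc 0 (L j i) := by
  have hL := (L_pos hj (i + 1)).le
  have h1 : (((((subcellEquiv j i).symm α.1).2 : ℕ) : ℝ) + 1) ≤ j (i + 1) := by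
    exact_mod_cast ((subcellEquiv j i).symm α.1).2.2
  have h2 := mul_le_mul_of_nonneg_right h1 hL
  rw [L_eq_mul_L_succ hj, offset]
  exact ⟨add_nonneg (mul_nonneg (Nat.cast_nonneg _) hL) hθ.1, by linarith [hθ.2]⟩

lemma phi_cellMap (hj : ∀ l, 1 ≤ l → 2 ≤ j l) (α : Cell j n (i + 1)) (θ : ℝ) :
    phi j n i (cellMap j n (i + 1) α θ) = cellMap j n i (parent α) (offset α + θ) := by
  rw [cellMap_eq, phi_point, cellMap_eq, cellStart_parent hj, add_assoc]
  rfl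

lemma sum_cell_succ (I : Cell j n (i + 1) → ℝ) :
    ∑ α, I α = ∑ k, ∑ w, ∑ a, I (k, wordSnoc w a) := by
  rw [Fintype.sum_prod_type]
  refine Finset.sum_congr rfl fun k _ => ?_
  rw [← Equiv.sum_comp wordEquiv.symm, Fintype.sum_prod_type]
  rfl

lemma differentiable_circleHeat {H : ℝ → ℝ} (hH : Continuous H) {t : ℝ} (ht : 0 < t) :
    Differentiable ℝ (circleHeat H t) := by
  rw [circleHeat_eq_heatSeries hH ht]
  exact fun x => (hasDerivAt_heatSeries_space (subexp_cosCoeff hH) (subexp_sinCoeff hH) ht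
    x).differentiableAt

lemma periodic_circleHeat (H : ℝ → ℝ) (t : ℝ) :
    Function.Periodic (circleHeat H t) (2 * Real.pi) := fun x => by
  simp only [circleHeat]
  refine intervalIntegral.integral_congr fun y _ => ?_
  exact congrArg (· * H y) (circleKernel_periodic_left t y x)

lemma circleHeat_sum {ι : Type*} (s : Finset ι) {H : ι → ℝ → ℝ} (hH : ∀ a, Continuous (H a))
    {t : ℝ} (ht : 0 < t) (x : ℝ) :
    circleHeat (fun y => ∑ a ∈ s, H a y) t x = ∑ a ∈ s, circleHeat (H a) t x := by
  simp only [circleHeat, Finset.mul_sum]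
  exact intervalIntegral.integral_finsetSum fun a _ =>
    intervalIntegrable_circleKernel_mul (hH a) ht x _ _

lemma cellExt_sum {ι : Type*} (s : Finset ι) (k : ℕ) (g : ι → ℝ → ℝ) (x : ℝ) :
    ∑ a ∈ s, cellExt j i k (g a) x = cellExt j i k (fun θ => ∑ a ∈ s, g a θ) x := by
  simp only [cellExt, oddExt]
  split_ifs <;> simp

/-- The deviations in the cells of a bundle add up to zero. -/
lemma sum_fiberDev_sibling (hn : ∀ l, 1 ≤ l → 2 ≤ n l) (f : F j n (i + 1) → ℝ)
    (α : Cell j n (i + 1)) (θ : ℝ) : ∑ a, fiberDev f (sibling α a) θ = 0 := by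
  have hn' := cast_succ_ne_zero hn i
  have h : ∀ a, sibling (sibling α a) = sibling α := fun a => by
    funext b; simp [sibling]
  simp only [fiberDev, Finset.sum_sub_distrib, fiberAvg_phi_cellMap, h, Finset.sum_const,
    Finset.card_univ, Fintype.card_fin, nsmul_eq_mul]
  field_simp
  simp

/-- The initial value on the circle whose heat evolution describes the Dirichlet part of the
semigroup on a cell. -/
noncomputable def devExt (f : F j n (i + 1) → ℝ) (α : Cell j n (i + 1)) : ℝ → ℝ :=
  cellExt j (i + 1) α.1 (fiberDev f α)

lemma continuous_devExt (hj : ∀ l, 1 ≤ l → 2 ≤ j l) (hn : ∀ l, 1 ≤ l → 2 ≤ n l)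
    {f : F j n (i + 1) → ℝ} (hf : Continuous f) (α : Cell j n (i + 1)) :
    Continuous (devExt f α) :=
  continuous_cellExt (continuous_fiberDev hf α) (fiberDev_boundary hj hn f α (Or.inl rfl))
    (fiberDev_boundary hj hn f α (Or.inr rfl)) _

lemma sum_circleHeat_devExt (hj : ∀ l, 1 ≤ l → 2 ≤ j l) (hn : ∀ l, 1 ≤ l → 2 ≤ n l)
    {f : F j n (i + 1) → ℝ} (hf : Continuous f) (α : Cell j n (i + 1)) {t : ℝ} (ht : 0 < t)
    (x : ℝ) : ∑ a, circleHeat (devExt f (sibling α a)) t x = 0 := by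
  rw [← circleHeat_sum _ (fun a => continuous_devExt hj hn hf _) ht]
  have : ∀ y, ∑ a, devExt f (sibling α a) y = 0 := by
    intro y
    have h1 : ∀ a, devExt f (sibling α a) = cellExt j (i + 1) α.1 (fiberDev f (sibling α a)) :=
      fun a => rfl
    simp_rw [h1]
    rw [cellExt_sum]
    simp only [sum_fiberDev_sibling hn, cellExt, oddExt, neg_zero, ite_self]
  simp [this, circleHeat]

/-- Functions on the circle, one for each cell, whose heat evolution is the evolution of `f` on
the cell; together they satisfy the Kirchhoff condition at the vertices, here in the weak form of a
vanishing sum of boundary terms. -/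
structure IsCellRep (f : F j n i → ℝ) (H : Cell j n i → ℝ → ℝ) : Prop where
  continuous : ∀ α, Continuous (H α)
  periodic : ∀ α, Function.Periodic (H α) (2 * Real.pi)
  kernelOp_eq : ∀ t, 0 < t → ∀ α, ∀ θ ∈ Icc 0 (L j i),
    kernelOp (mu j n i) (p j n i) t f (cellMap j n i α θ) =
      circleHeat (H α) t (cellStart j i α.1 + θ)
  initial : ∀ α, ∀ θ ∈ Icc 0 (L j i), H α (cellStart j i α.1 + θ) = f (cellMap j n i α θ)
  kirchhoff : ∀ t, 0 < t → ∀ g : F j n i → ℝ, Continuous g →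
    ∑ α : Cell j n i, (deriv (circleHeat (H α) t) (cellStart j i α.1 + L j i) *
        g (cellMap j n i α (L j i)) -
      deriv (circleHeat (H α) t) (cellStart j i α.1 + 0) * g (cellMap j n i α 0)) = 0

/-- On the circle the boundary terms of consecutive arcs cancel by periodicity. -/
lemma isCellRep_zero (hj : ∀ l, 1 ≤ l → 2 ≤ j l) (hn : ∀ l, 1 ≤ l → 2 ≤ n l) {f : F j n 0 → ℝ}
    (hf : Continuous f) : IsCellRep f fun α x => f (point j n 0 (x : S1) α.2) where
  continuous α := hf.comp (continuous_point α.2)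
  periodic α x := by simp only [AddCircle.coe_add_period]
  kernelOp_eq t ht α θ _ := kernelOp_zero_point hj hn hf ht _ _
  initial α θ _ := rfl
  kirchhoff t ht g hg := by
    rw [Fintype.sum_prod_type_right, Fintype.sum_unique]
    dsimp only
    set u := circleHeat (fun x => f (point j n 0 (x : S1) default)) t with hu
    set Φ : ℝ → ℝ := fun x => deriv u x * g (point j n 0 (x : S1) default) with hΦ
    have h1 : ∀ k : Fin (2 * J j 0), deriv u (cellStart j 0 k + L j 0) *
        g (cellMap j n 0 (k, default) (L j 0)) -
        deriv u (cellStart j 0 k + 0) * g (cellMap j n 0 (k, default) 0) =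
        Φ (cellStart j 0 ((k : ℕ) + 1)) - Φ (cellStart j 0 k) := by
      intro k
      rw [cellMap_eq, cellMap_eq, hΦ]
      simp only [cellStart_succ, add_zero]
    simp only [h1]
    rw [Fin.sum_univ_eq_sum_range (fun k => Φ (cellStart j 0 (k + 1)) - Φ (cellStart j 0 k)),
      Finset.sum_range_sub (fun k => Φ (cellStart j 0 k)), cellStart_two_mul_J hj, cellStart_zero,
      hΦ]
    have h2 : deriv u (2 * Real.pi) = deriv u 0 := by
      have := deriv_comp_add_const u (2 * Real.pi) 0
      rw [zero_add] at this
      rw [← this]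
      congr 1
      exact funext (periodic_circleHeat _ t)
    simp only [h2, AddCircle.coe_period]
    simp

/-- Boundary terms over the cells of level `i + 1` telescope to those over the cells of level
`i`. -/
lemma sum_parent_boundary (hj : ∀ l, 1 ≤ l → 2 ≤ j l) (Φ : Cell j n i → ℝ → ℝ) (w : Word n i) :
    ∑ k : Fin (2 * J j (i + 1)),
      (Φ (((subcellEquiv j i).symm k).1, w) (cellStart j (i + 1) k + L j (i + 1)) -
        Φ (((subcellEquiv j i).symm k).1, w) (cellStart j (i + 1) k + 0)) =
    ∑ k : Fin (2 * J j i),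
      (Φ (k, w) (cellStart j i k + L j i) - Φ (k, w) (cellStart j i k + 0)) := by
  rw [← Equiv.sum_comp (subcellEquiv j i), Fintype.sum_prod_type]
  refine Finset.sum_congr rfl fun k _ => ?_
  have h : ∀ r : Fin (j (i + 1)),
      Φ (((subcellEquiv j i).symm (subcellEquiv j i (k, r))).1, w)
          (cellStart j (i + 1) (subcellEquiv j i (k, r)) + L j (i + 1)) -
        Φ (((subcellEquiv j i).symm (subcellEquiv j i (k, r))).1, w)
          (cellStart j (i + 1) (subcellEquiv j i (k, r)) + 0) =
      Φ (k, w) (cellStart j i k + (((r : ℕ) + 1 : ℕ) : ℝ) * L j (i + 1)) -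
        Φ (k, w) (cellStart j i k + ((r : ℕ) : ℝ) * L j (i + 1)) := by
    intro r
    rw [Equiv.symm_apply_apply, subcellEquiv_val, cellStart_succ_level hj]
    simp only [add_zero, Nat.cast_add, Nat.cast_one, add_mul, one_mul, add_assoc]
  simp only [h]
  rw [Fin.sum_univ_eq_sum_range (fun r => Φ (k, w) (cellStart j i k + ((r + 1 : ℕ) : ℝ) *
    L j (i + 1)) - Φ (k, w) (cellStart j i k + (r : ℝ) * L j (i + 1))),
    Finset.sum_range_sub (fun r => Φ (k, w) (cellStart j i k + (r : ℝ) * L j (i + 1))),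
    ← L_eq_mul_L_succ hj]
  simp

/-- The representation of `f` on a cell is that of the fiber average on the cell of the previous
level that contains its image, plus the extension of the deviation. In the Kirchhoff condition the
deviations of a bundle cancel, and the rest telescopes to the condition of the previous level. -/
lemma IsCellRep.succ (hj : ∀ l, 1 ≤ l → 2 ≤ j l) (hn : ∀ l, 1 ≤ l → 2 ≤ n l)
    {f : F j n (i + 1) → ℝ} (hf : Continuous f) {H : Cell j n i → ℝ → ℝ}
    (hH : IsCellRep (fiberAvg f) H) :
    IsCellRep f fun α x => H (parent α) x + devExt f α x where
  continuous α := (hH.continuous _).add (continuous_devExt hj hn hf α)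
  periodic α := (hH.periodic _).add (periodic_cellExt _ _ _ _)
  kernelOp_eq t ht α θ hθ := by
    rw [kernelOp_succ hj hn hf ht α hθ, phi_cellMap hj,
      hH.kernelOp_eq t ht _ _ (offset_add_mem hj α hθ), ← add_assoc, ← cellStart_parent hj,
      circleHeat_add (hH.continuous _) (continuous_devExt hj hn hf α) ht]
    rfl
  initial α θ hθ := by
    have h1 := hH.initial (parent α) _ (offset_add_mem hj α hθ)
    rw [← add_assoc, ← cellStart_parent hj, ← phi_cellMap hj] at h1
    rw [h1, devExt, cellExt_cellStart_add hj _ _ hθ, fiberDev]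
    ring
  kirchhoff t ht g hg := by
    have hd : ∀ α x, deriv (circleHeat (fun x => H (parent α) x + devExt f α x) t) x =
        deriv (circleHeat (H (parent α)) t) x + deriv (circleHeat (devExt f α) t) x := by
      intro α x
      have : circleHeat (fun x => H (parent α) x + devExt f α x) t =
          fun x => circleHeat (H (parent α)) t x + circleHeat (devExt f α) t x :=
        funext fun x => circleHeat_add (hH.continuous _) (continuous_devExt hj hn hf α) ht x
      rw [this]
      exact deriv_fun_add (differentiable_circleHeat (hH.continuous _) ht x)
        (differentiable_circleHeat (continuous_devExt hj hn hf α) ht x)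
    have hzero : ∀ k w x, ∑ a, deriv (circleHeat (devExt f (k, wordSnoc w a)) t) x = 0 := by
      intro k w x
      have ha0 : Nonempty (Fin (n (i + 1))) := ⟨⟨0, by have := hn (i + 1) (by omega); omega⟩⟩
      obtain ⟨a₀⟩ := ha0
      have hs : ∀ a, sibling ((k, wordSnoc w a₀) : Cell j n (i + 1)) a = (k, wordSnoc w a) :=
        fun a => by simp [sibling]
      have h1 := fun y => sum_circleHeat_devExt hj hn hf
        ((k, wordSnoc w a₀) : Cell j n (i + 1)) ht y
      simp only [hs] at h1
      rw [← deriv_fun_sum fun a _ =>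
        differentiable_circleHeat (continuous_devExt hj hn hf (k, wordSnoc w a)) ht x]
      simp only [h1, deriv_const]
    set Φ : Cell j n i → ℝ → ℝ := fun β x => deriv (circleHeat (H β) t) x *
      fiberAvg g (point j n i (x : S1) β.2) with hΦ
    have hG : ∀ (k : Fin (2 * J j (i + 1))) (w : Word n i) (a : Fin (n (i + 1))) (θ : ℝ),
        (θ = 0 ∨ θ = L j (i + 1)) → g (cellMap j n (i + 1) (k, wordSnoc w a) θ) =
          fiberAvg g (point j n i ((cellStart j (i + 1) k + θ : ℝ) : S1) w) := by
      intro k w a θ hθ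
      rw [← fiberAvg_boundary hj hn g _ hθ, cellMap_eq, phi_point, wordInit_snoc]
    have hp : ∀ (k : Fin (2 * J j (i + 1))) (w : Word n i) (a : Fin (n (i + 1))),
        parent ((k, wordSnoc w a) : Cell j n (i + 1)) = (((subcellEquiv j i).symm k).1, w) := by
      intro k w a
      simp [parent]
    have key : ∀ (k : Fin (2 * J j (i + 1))) (w : Word n i),
        ∑ a, (deriv (circleHeat (fun x => H (parent ((k, wordSnoc w a) : Cell j n (i + 1))) x +
            devExt f (k, wordSnoc w a) x) t) (cellStart j (i + 1) k + L j (i + 1)) *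
            g (cellMap j n (i + 1) (k, wordSnoc w a) (L j (i + 1))) -
          deriv (circleHeat (fun x => H (parent ((k, wordSnoc w a) : Cell j n (i + 1))) x +
            devExt f (k, wordSnoc w a) x) t) (cellStart j (i + 1) k + 0) *
            g (cellMap j n (i + 1) (k, wordSnoc w a) 0)) =
        n (i + 1) *
          (Φ (((subcellEquiv j i).symm k).1, w) (cellStart j (i + 1) k + L j (i + 1)) -
          Φ (((subcellEquiv j i).symm k).1, w) (cellStart j (i + 1) k + 0)) := by
      intro k w
      simp only [hd]
      simp only [hG k w _ _ (Or.inl rfl), hG k w _ _ (Or.inr rfl), hp]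
      rw [Finset.sum_sub_distrib, ← Finset.sum_mul, ← Finset.sum_mul, Finset.sum_add_distrib,
        Finset.sum_add_distrib, hzero, hzero, hΦ]
      simp only [Finset.sum_const, Finset.card_univ, Fintype.card_fin, nsmul_eq_mul]
      ring
    rw [sum_cell_succ]
    simp only [key]
    simp only [← Finset.mul_sum]
    rw [Finset.sum_comm]
    simp only [sum_parent_boundary hj Φ]
    have := hH.kirchhoff t ht (fiberAvg g) (continuous_fiberAvg hg)
    rw [Fintype.sum_prod_type_right] at this
    rw [mul_eq_zero]
    exact Or.inr this

lemma exists_isCellRep (hj : ∀ l, 1 ≤ l → 2 ≤ j l) (hn : ∀ l, 1 ≤ l → 2 ≤ n l) {f : F j n i → ℝ}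
    (hf : Continuous f) : ∃ H, IsCellRep f H := by
  induction i with
  | zero => exact ⟨_, isCellRep_zero hj hn hf⟩
  | succ i ih =>
    obtain ⟨H, hH⟩ := ih (continuous_fiberAvg hf)
    exact ⟨_, hH.succ hj hn hf⟩

/-! ### Positivity -/

lemma circleHeat_devExt_boundary (hj : ∀ l, 1 ≤ l → 2 ≤ j l) (hn : ∀ l, 1 ≤ l → 2 ≤ n l)
    {f : F j n (i + 1) → ℝ} (hf : Continuous f) (α : Cell j n (i + 1)) {t : ℝ} (ht : 0 < t) {θ : ℝ}
    (hθ : θ = 0 ∨ θ = L j (i + 1)) :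
    circleHeat (devExt f α) t (cellStart j (i + 1) α.1 + θ) = 0 := by
  rw [devExt, circleHeat_cellExt (continuous_fiberDev hf α)
    (fiberDev_boundary hj hn f α (Or.inl rfl)) (fiberDev_boundary hj hn f α (Or.inr rfl)) _ hj ht]
  have : ∀ θ', correction j (i + 1) t θ θ' = 0 := fun θ' =>
    correction_boundary hj ht (by tauto)
  simp [this]

/-- On each cell the evolution of a nonnegative `f` solves the heat equation with initial value
`f ≥ 0`, and at the ends of the cell it is the evolution of the fiber average at the previous
level, so that the maximum principle applies. -/
lemma kernelOp_nonneg (hj : ∀ l, 1 ≤ l → 2 ≤ j l) (hn : ∀ l, 1 ≤ l → 2 ≤ n l) {f : F j n i → ℝ}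
    (hf : Continuous f) (h0 : ∀ x, 0 ≤ f x) {t : ℝ} (ht : 0 < t) (x : F j n i) :
    0 ≤ kernelOp (mu j n i) (p j n i) t f x := by
  induction i generalizing t with
  | zero =>
    obtain ⟨α, θ, hθ, rfl⟩ := exists_cellMap_eq hj x
    rw [cellMap_eq, kernelOp_zero_point hj hn hf ht]
    exact circleHeat_nonneg (fun _ => h0 _) ht _
  | succ i ih =>
    obtain ⟨α, θ, hθ, rfl⟩ := exists_cellMap_eq hj x
    obtain ⟨H, hH⟩ := exists_isCellRep hj hn hf
    have hL := (L_pos hj (i + 1)).le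
    have hb : ∀ θ, (θ = 0 ∨ θ = L j (i + 1)) → ∀ t, 0 < t →
        0 ≤ circleHeat (H α) t (cellStart j (i + 1) α.1 + θ) := by
      intro θ hθ t ht
      have hmem : θ ∈ Icc 0 (L j (i + 1)) := by
        rcases hθ with rfl | rfl
        exacts [left_mem_Icc.2 hL, right_mem_Icc.2 hL]
      rw [← hH.kernelOp_eq t ht α θ hmem, kernelOp_succ hj hn hf ht α hmem]
      have h1 := circleHeat_devExt_boundary hj hn hf α ht hθ
      rw [devExt] at h1
      rw [h1, add_zero]
      refine ih (continuous_fiberAvg hf) (fun y => ?_) ht _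
      exact mul_nonneg (by positivity) (Finset.sum_nonneg fun a _ => h0 _)
    rw [hH.kernelOp_eq t ht α θ hθ]
    refine circleHeat_nonneg_of_boundary (hH.continuous α) (hH.periodic α)
      (a := cellStart j (i + 1) α.1 + 0) (b := cellStart j (i + 1) α.1 + L j (i + 1))
      (fun y hy => ?_) (hb 0 (Or.inl rfl)) (hb _ (Or.inr rfl)) ht
      ⟨by linarith [hθ.1], by linarith [hθ.2]⟩
    have h1 := hH.initial α (y - cellStart j (i + 1) α.1)
      ⟨by linarith [hy.1], by linarith [hy.2]⟩
    rw [add_sub_cancel] at h1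
    rw [h1]
    exact h0 _

/-- `μ_i` has full support. -/
lemma eq_zero_of_integral_mu_eq_zero (hj : ∀ l, 1 ≤ l → 2 ≤ j l) (hn : ∀ l, 1 ≤ l → 2 ≤ n l)
    {G : F j n i → ℝ} (hG : Continuous G) (h0 : ∀ x, 0 ≤ G x) (hint : ∫ x, G x ∂(mu j n i) ≤ 0)
    (x : F j n i) : G x = 0 := by
  have hL := L_pos hj i
  have hN : (0 : ℝ) < N n i := by exact_mod_cast N_pos hn i
  have hGc : ∀ α : Cell j n i, Continuous fun θ => G (cellMap j n i α θ) := fun α =>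
    hG.comp (continuous_cellMap α)
  obtain ⟨α, θ, hθ, rfl⟩ := exists_cellMap_eq hj x
  by_contra hne
  have hpos : 0 < ∫ θ in (0)..(L j i), G (cellMap j n i α θ) :=
    intervalIntegral.integral_pos hL (hGc α).continuousOn (fun _ _ => h0 _)
      ⟨θ, hθ, (h0 _).lt_of_ne' hne⟩
  rw [integral_mu hj hn hG] at hint
  refine absurd hint (not_le.2 (Finset.sum_pos' (fun β _ => ?_) ⟨α, Finset.mem_univ _, ?_⟩))
  · exact mul_nonneg (by positivity) (intervalIntegral.integral_nonneg hL.le fun _ _ => h0 _)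
  · positivity

lemma p_nonneg (hj : ∀ l, 1 ≤ l → 2 ≤ j l) (hn : ∀ l, 1 ≤ l → 2 ≤ n l) {t : ℝ} (ht : 0 < t)
    (x y : F j n i) : 0 ≤ p j n i t x y := by
  -- test the operator against the negative part of the kernel itself
  have hc := continuous_p_left hj ht x
  have hneg : Continuous fun y => max (-p j n i t x y) 0 := hc.neg.max continuous_const
  have h1 := kernelOp_nonneg hj hn hneg (fun _ => le_max_right _ _) ht x
  rw [kernelOp_of_pos _ _ ht] at h1
  have h2 : ∀ y, p j n i t x y * max (-p j n i t x y) 0 = -(max (-p j n i t x y) 0) ^ 2 := by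
    intro y
    rcases le_total (-p j n i t x y) 0 with h | h
    · simp [max_eq_right h]
    · rw [max_eq_left h]; ring
  simp only [h2] at h1
  rw [integral_neg] at h1
  have h3 := eq_zero_of_integral_mu_eq_zero hj hn (hneg.pow 2) (fun _ => sq_nonneg _)
    (neg_nonneg.1 h1) y
  have h4 : max (-p j n i t x y) 0 = 0 := by simpa using h3
  have := le_max_left (-p j n i t x y) 0
  linarith

/-! ### The semigroup property -/

/-- A `2π`-periodic odd function is the odd extension of its restriction to `[0, π]`. -/
lemma oddExt_eq_self {V : ℝ → ℝ} (hodd : ∀ x, V (-x) = -V x)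
    (hp : Function.Periodic V (2 * Real.pi)) : oddExt V = V := by
  funext x
  set y := Real.arccos (Real.cos x) with hy
  have hcos : Real.cos y = Real.cos x :=
    Real.cos_arccos (Real.neg_one_le_cos _) (Real.cos_le_one _)
  have hsin : 0 ≤ Real.sin y :=
    Real.sin_nonneg_of_mem_Icc ⟨Real.arccos_nonneg _, Real.arccos_le_pi _⟩
  have hzero : ∀ x, Real.sin x = 0 → V x = 0 := by
    intro x hx
    obtain ⟨m, rfl⟩ := Real.sin_eq_zero_iff.1 hx
    have h1 := hp.int_mul m (-(m * Real.pi))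
    rw [show -(m * Real.pi) + m * (2 * Real.pi) = m * Real.pi by ring, hodd] at h1
    linarith
  rw [oddExt, ← hy]
  obtain ⟨k, hk | hk⟩ := Real.cos_eq_cos_iff.1 hcos
  · have h1 : x = y + k * (2 * Real.pi) := by rw [hk]; ring
    have hs : Real.sin x = Real.sin y := by rw [h1, Real.sin_add_int_mul_two_pi]
    have hV : V x = V y := by rw [h1]; exact hp.int_mul k y
    rw [if_pos (hs ▸ hsin), hV]
  · have h1 : x = -y + k * (2 * Real.pi) := by rw [hk]; ring
    have hs : Real.sin x = -Real.sin y := by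
      rw [h1, Real.sin_add_int_mul_two_pi, Real.sin_neg]
    have hV : V x = -V y := by rw [h1, ← hodd]; exact hp.int_mul k (-y)
    split_ifs with h
    · have h2 : Real.sin y = 0 := by linarith
      rw [hV, hzero y h2, neg_zero]
    · rw [hV]

lemma oddExt_congr {h h' : ℝ → ℝ} (hh : ∀ x ∈ Icc 0 Real.pi, h x = h' x) :
    oddExt h = oddExt h' := by
  funext x
  simp only [oddExt, hh _ ⟨Real.arccos_nonneg (Real.cos x), Real.arccos_le_pi _⟩]

lemma circleHeat_oddExt_neg {h : ℝ → ℝ} (hc : Continuous h) (h0 : h 0 = 0) (hpi : h Real.pi = 0)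
    {t : ℝ} (ht : 0 < t) (x : ℝ) :
    circleHeat (oddExt h) t (-x) = -circleHeat (oddExt h) t x := by
  have hK : ∀ y z, circleKernel t (-y) z = circleKernel t y (-z) := by
    intro y z
    simp only [circleKernel]
    congr 3 with k
    rw [← Real.cos_neg]
    ring_nf
  rw [circleHeat_oddExt hc h0 hpi ht, circleHeat_oddExt hc h0 hpi ht,
    ← intervalIntegral.integral_neg]
  refine intervalIntegral.integral_congr fun y _ => ?_
  simp only [hK, neg_neg]
  ring

/-- The heat evolution of the circle preserves the reflection symmetries of a cell. -/
lemma cellExt_eq_circleHeat (hj : ∀ l, 1 ≤ l → 2 ≤ j l) {g g' : ℝ → ℝ} (hg : Continuous g)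
    (h0 : g 0 = 0) (hL : g (L j i) = 0) (k : ℕ) {t : ℝ} (ht : 0 < t)
    (hg' : ∀ θ ∈ Icc 0 (L j i), g' θ = circleHeat (cellExt j i k g) t (cellStart j i k + θ)) :
    cellExt j i k g' = circleHeat (cellExt j i k g) t := by
  have hJ := J_cast_pos hj i
  have hh0 : (fun s => g (s / J j i)) 0 = 0 := by simpa using h0
  have hhc : Continuous fun s => g (s / J j i) := hg.comp (by fun_prop)
  have hτ : 0 < (J j i : ℝ) ^ 2 * t := by positivity
  have hscale : ∀ x, circleHeat (cellExt j i k g) t x =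
      circleHeat (oddExt fun s => g (s / J j i)) ((J j i : ℝ) ^ 2 * t) (J j i * x - k * Real.pi) :=
    fun x => circleHeat_comp_mul_sub (continuous_oddExt hhc hh0 hL) (periodic_oddExt _)
      (J_pos hj i) _ ht x
  set V := circleHeat (oddExt fun s => g (s / J j i)) ((J j i : ℝ) ^ 2 * t) with hV
  have h1 : oddExt (fun s => g' (s / J j i)) = V := by
    rw [← oddExt_eq_self (V := V) (fun x => circleHeat_oddExt_neg hhc hh0 hL hτ x)
      (periodic_circleHeat _ _)]
    refine oddExt_congr fun s hs => ?_
    have hs' : s / J j i ∈ Icc 0 (L j i) := by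
      refine ⟨div_nonneg hs.1 hJ.le, ?_⟩
      rw [L]
      exact div_le_div_of_nonneg_right hs.2 hJ.le
    rw [hg' _ hs', hscale]
    congr 1
    rw [cellStart]
    field_simp
    ring
  funext x
  rw [hscale, cellExt, h1]

/-- The strong Feller property, by dominated convergence. -/
lemma continuous_kernelOp (hj : ∀ l, 1 ≤ l → 2 ≤ j l) (hn : ∀ l, 1 ≤ l → 2 ≤ n l) {t : ℝ}
    (ht : 0 < t) {f : F j n i → ℝ} (hf : Measurable f) {C : ℝ} (hC : ∀ x, |f x| ≤ C) :
    Continuous (kernelOp (mu j n i) (p j n i) t f) := by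
  have := isFiniteMeasure_mu (j := j) (i := i) hn
  have := compactSpace_F (n := n) (i := i) hj
  obtain ⟨M, hM⟩ := isCompact_univ.exists_bound_of_continuousOn
    (continuous_p (n := n) (i := i) hj ht).continuousOn
  have hop : kernelOp (mu j n i) (p j n i) t f = fun x => ∫ y, p j n i t x y * f y ∂(mu j n i) :=
    funext fun x => kernelOp_of_pos _ _ ht f x
  rw [hop]
  refine continuous_of_cells hj fun α => Continuous.continuousOn ?_
  refine continuous_of_dominated (bound := fun _ => M * C)
    (fun θ => ((continuous_p_left hj ht _).measurable.mul hf).aestronglyMeasurable)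
    (fun θ => ae_of_all _ fun y => ?_) (integrable_const _) (ae_of_all _ fun y => ?_)
  · rw [norm_mul]
    exact mul_le_mul (hM (_, y) (mem_univ _)) (hC y) (norm_nonneg _)
      ((norm_nonneg _).trans (hM (cellMap j n i α θ, y) (mem_univ _)))
  · exact ((continuous_p hj ht).comp
      ((continuous_cellMap α).prodMk continuous_const)).mul continuous_const

lemma exists_bound_of_continuous (hj : ∀ l, 1 ≤ l → 2 ≤ j l) {f : F j n i → ℝ}
    (hf : Continuous f) : ∃ C, ∀ x, |f x| ≤ C := by
  have := compactSpace_F (n := n) (i := i) hj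
  obtain ⟨C, hC⟩ := isCompact_univ.exists_bound_of_continuousOn hf.continuousOn
  exact ⟨C, fun x => hC x (mem_univ _)⟩

lemma continuous_kernelOp_of_continuous (hj : ∀ l, 1 ≤ l → 2 ≤ j l) (hn : ∀ l, 1 ≤ l → 2 ≤ n l)
    {t : ℝ} (ht : 0 < t) {f : F j n i → ℝ} (hf : Continuous f) :
    Continuous (kernelOp (mu j n i) (p j n i) t f) :=
  let ⟨_, hC⟩ := exists_bound_of_continuous hj hf
  continuous_kernelOp hj hn ht hf.measurable hC

lemma exists_phi_cellMap_eq (hj : ∀ l, 1 ≤ l → 2 ≤ j l) (hn : ∀ l, 1 ≤ l → 2 ≤ n l)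
    (z : F j n i) : ∃ α : Cell j n (i + 1), ∃ θ ∈ Icc 0 (L j (i + 1)),
      phi j n i (cellMap j n (i + 1) α θ) = z := by
  obtain ⟨α, θ, hθ, h⟩ := exists_cellMap_eq hj
    (proj j n i (z, ⟨0, by have := hn (i + 1) (by omega); omega⟩))
  exact ⟨α, θ, hθ, by rw [h, phi_proj]⟩

/-- Averaging over fibers intertwines the operators of consecutive levels, since the Dirichlet parts
in the cells of a bundle add up to zero. -/
lemma fiberAvg_kernelOp (hj : ∀ l, 1 ≤ l → 2 ≤ j l) (hn : ∀ l, 1 ≤ l → 2 ≤ n l)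
    {f : F j n (i + 1) → ℝ} (hf : Continuous f) {t : ℝ} (ht : 0 < t) :
    fiberAvg (kernelOp (mu j n (i + 1)) (p j n (i + 1)) t f) =
      kernelOp (mu j n i) (p j n i) t (fiberAvg f) := by
  have hn' := cast_succ_ne_zero hn i
  funext z
  obtain ⟨α, θ, hθ, rfl⟩ := exists_phi_cellMap_eq hj hn z
  have hphi : ∀ a, phi j n i (cellMap j n (i + 1) (sibling α a) θ) =
      phi j n i (cellMap j n (i + 1) α θ) := by
    intro a
    rw [cellMap_eq, cellMap_eq, phi_point, phi_point]
    simp [sibling]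
  have h1 : ∀ a, kernelOp (mu j n (i + 1)) (p j n (i + 1)) t f
      (cellMap j n (i + 1) (sibling α a) θ) =
      kernelOp (mu j n i) (p j n i) t (fiberAvg f) (phi j n i (cellMap j n (i + 1) α θ)) +
        circleHeat (devExt f (sibling α a)) t (cellStart j (i + 1) α.1 + θ) := by
    intro a
    rw [kernelOp_succ hj hn hf ht _ hθ, hphi]
    rfl
  rw [fiberAvg_phi_cellMap]
  simp only [h1]
  rw [Finset.sum_add_distrib, sum_circleHeat_devExt hj hn hf α ht, Finset.sum_const,
    Finset.card_univ, Fintype.card_fin, nsmul_eq_mul]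
  field_simp
  ring

/-- The semigroup property: both the averages and the reflected deviations evolve by semigroups. -/
lemma kernelOp_add (hj : ∀ l, 1 ≤ l → 2 ≤ j l) (hn : ∀ l, 1 ≤ l → 2 ≤ n l) {f : F j n i → ℝ}
    (hf : Continuous f) {s t : ℝ} (hs : 0 < s) (ht : 0 < t) :
    kernelOp (mu j n i) (p j n i) (s + t) f =
      kernelOp (mu j n i) (p j n i) s (kernelOp (mu j n i) (p j n i) t f) := by
  induction i with
  | zero =>
    funext x
    obtain ⟨α, θ, hθ, rfl⟩ := exists_cellMap_eq hj x
    rw [cellMap_eq, kernelOp_zero_point hj hn hf (add_pos hs ht),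
      kernelOp_zero_point hj hn (continuous_kernelOp_of_continuous hj hn ht hf) hs]
    simp only [kernelOp_zero_point hj hn hf ht]
    exact (circleHeat_circleHeat (hf.comp (continuous_point α.2))
      (fun x => by simp only [Function.comp, AddCircle.coe_add_period]) hs ht _).symm
  | succ i ih =>
    funext x
    obtain ⟨α, θ, hθ, rfl⟩ := exists_cellMap_eq hj x
    have hc := continuous_kernelOp_of_continuous hj hn ht hf
    have hdev : cellExt j (i + 1) α.1
        (fiberDev (kernelOp (mu j n (i + 1)) (p j n (i + 1)) t f) α) =
        circleHeat (cellExt j (i + 1) α.1 (fiberDev f α)) t := by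
      refine cellExt_eq_circleHeat hj (continuous_fiberDev hf α)
        (fiberDev_boundary hj hn f α (Or.inl rfl)) (fiberDev_boundary hj hn f α (Or.inr rfl)) _ ht
        fun σ hσ => ?_
      rw [fiberDev, fiberAvg_kernelOp hj hn hf ht, kernelOp_succ hj hn hf ht α hσ]
      ring
    rw [kernelOp_succ hj hn hf (add_pos hs ht) α hθ, kernelOp_succ hj hn hc hs α hθ,
      fiberAvg_kernelOp hj hn hf ht, ih (continuous_fiberAvg hf), hdev]
    exact congrArg _ (circleHeat_circleHeat (continuous_devExt hj hn hf α)
      (periodic_cellExt _ _ _ _) hs ht _).symm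

lemma kernelOp_one (hj : ∀ l, 1 ≤ l → 2 ≤ j l) (hn : ∀ l, 1 ≤ l → 2 ≤ n l) {t : ℝ} (ht : 0 < t) :
    kernelOp (mu j n i) (p j n i) t (fun _ => 1) = fun _ => 1 := by
  induction i with
  | zero =>
    funext x
    obtain ⟨α, θ, hθ, rfl⟩ := exists_cellMap_eq hj x
    rw [cellMap_eq, kernelOp_zero_point hj hn continuous_const ht, circleHeat_one ht]
  | succ i ih =>
    funext x
    obtain ⟨α, θ, hθ, rfl⟩ := exists_cellMap_eq hj x
    have hn' := cast_succ_ne_zero hn i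
    have h1 : fiberAvg (fun _ : F j n (i + 1) => (1 : ℝ)) = fun _ => 1 := by
      funext z
      simp [fiberAvg, hn']
    have h2 : fiberDev (fun _ : F j n (i + 1) => (1 : ℝ)) α = fun _ => 0 := by
      funext θ
      simp [fiberDev, h1]
    rw [kernelOp_succ hj hn continuous_const ht α hθ, h1, ih, h2]
    simp [cellExt, oddExt, circleHeat]

lemma integrable_of_continuous (hj : ∀ l, 1 ≤ l → 2 ≤ j l) (hn : ∀ l, 1 ≤ l → 2 ≤ n l)
    {f : F j n i → ℝ} (hf : Continuous f) : Integrable f (mu j n i) := by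
  have := isFiniteMeasure_mu (j := j) (i := i) hn
  obtain ⟨C, hC⟩ := exists_bound_of_continuous hj hf
  exact Integrable.of_bound hf.aestronglyMeasurable C (ae_of_all _ hC)

/-- Only finitely many evolutions on the circle, one for each cell, have to converge. -/
lemma tendstoUniformly_kernelOp (hj : ∀ l, 1 ≤ l → 2 ≤ j l) (hn : ∀ l, 1 ≤ l → 2 ≤ n l)
    {f : F j n i → ℝ} (hf : Continuous f) :
    TendstoUniformly (fun t => kernelOp (mu j n i) (p j n i) t f) f (𝓝[>] 0) := by
  obtain ⟨H, hH⟩ := exists_isCellRep hj hn hf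
  rw [Metric.tendstoUniformly_iff]
  intro ε hε
  have h1 : ∀ᶠ t in 𝓝[>] (0 : ℝ), ∀ α, ∀ x, dist (H α x) (circleHeat (H α) t x) < ε :=
    eventually_all.2 fun α => Metric.tendstoUniformly_iff.1
      (tendstoUniformly_circleHeat (hH.continuous α) (hH.periodic α)) ε hε
  filter_upwards [h1, self_mem_nhdsWithin] with t h2 ht x
  obtain ⟨α, θ, hθ, rfl⟩ := exists_cellMap_eq hj x
  rw [hH.kernelOp_eq t ht α θ hθ, ← hH.initial α θ hθ]
  exact h2 α _

lemma isStrongFellerSemigroup (hj : ∀ l, 1 ≤ l → 2 ≤ j l) (hn : ∀ l, 1 ≤ l → 2 ≤ n l) :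
    IsStrongFellerSemigroup (kernelOp (mu j n i) (p j n i)) := by
  have h0 : ∀ f, kernelOp (mu j n i) (p j n i) 0 f = f := fun f => funext fun x => if_pos rfl
  refine ⟨fun t ht f hf => ?_, fun t ht f g hf hg a b => ?_, fun f _ => h0 f,
    fun s t hs ht f hf => ?_, fun t ht f hf hpos x => ?_, fun t ht f hf C hC x => ?_,
    fun t ht => ?_, fun f hf => tendstoUniformly_kernelOp hj hn hf,
    fun t ht f hf ⟨C, hC⟩ => continuous_kernelOp hj hn ht hf hC⟩
  · rcases ht.eq_or_lt with rfl | ht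
    · rwa [h0]
    · exact continuous_kernelOp_of_continuous hj hn ht hf
  · rcases ht.eq_or_lt with rfl | ht
    · simp only [h0]
    · funext x
      simp only [kernelOp_of_pos _ _ ht]
      rw [← integral_const_mul, ← integral_const_mul, ← integral_add
        ((integrable_of_continuous hj hn (continuous_p_mul hj ht x hf)).const_mul a)
        ((integrable_of_continuous hj hn (continuous_p_mul hj ht x hg)).const_mul b)]
      congr 1
      funext y
      ring
  · rcases hs.eq_or_lt with rfl | hs
    · rw [h0, zero_add]
    rcases ht.eq_or_lt with rfl | ht
    · rw [h0, add_zero]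
    exact kernelOp_add hj hn hf hs ht
  · rcases ht.eq_or_lt with rfl | ht
    · rw [h0]; exact hpos x
    · exact kernelOp_nonneg hj hn hf hpos ht x
  · rcases ht.eq_or_lt with rfl | ht
    · rw [h0]; exact hC x
    · have h1 : ∫ y, p j n i t x y * C ∂(mu j n i) = C := by
        have := congrFun (kernelOp_one (j := j) (n := n) (i := i) hj hn ht) x
        rw [kernelOp_of_pos _ _ ht] at this
        simp only [mul_one] at this
        rw [integral_mul_const, this, one_mul]
      rw [kernelOp_of_pos _ _ ht, ← h1, ← Real.norm_eq_abs]
      refine norm_integral_le_of_norm_le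
        (integrable_of_continuous hj hn (continuous_p_mul hj ht x continuous_const))
        (ae_of_all _ fun y => ?_)
      rw [norm_mul, Real.norm_of_nonneg (p_nonneg hj hn ht x y)]
      exact mul_le_mul_of_nonneg_left (hC y) (p_nonneg hj hn ht x y)
  · rcases ht.eq_or_lt with rfl | ht
    · rw [h0]
    · exact kernelOp_one hj hn ht

/-! ### Weak derivatives on an interval -/

section Interval

/-- Smooth functions with compact support in `(0, l)`. -/
structure IsTest (l : ℝ) (ψ : ℝ → ℝ) : Prop where
  contDiff : ContDiff ℝ ∞ ψ
  hasCompactSupport : HasCompactSupport ψ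
  tsupport_subset : tsupport ψ ⊆ Ioo 0 l

variable {l : ℝ}

lemma IsTest.eq_zero {ψ : ℝ → ℝ} (h : IsTest l ψ) {x : ℝ} (hx : x ∉ Ioo 0 l) : ψ x = 0 :=
  image_eq_zero_of_notMem_tsupport fun hx' => hx (h.tsupport_subset hx')

lemma integral_Ioo_eq (hl : 0 ≤ l) (f : ℝ → ℝ) :
    ∫ x in Ioo 0 l, f x = ∫ x in (0)..l, f x := by
  rw [intervalIntegral.integral_of_le hl, integral_Ioc_eq_integral_Ioo]

/-- A test function with vanishing integral is the derivative of a test function. -/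
lemma IsTest.exists_primitive {φ : ℝ → ℝ} (h : IsTest l φ)
    (hint : ∫ x in (0)..l, φ x = 0) : ∃ ψ, IsTest l ψ ∧ deriv ψ = φ := by
  have hc := h.contDiff.continuous
  have hder : ∀ x, HasDerivAt (fun x => ∫ y in (0)..x, φ y) (φ x) x := fun x =>
    intervalIntegral.integral_hasDerivAt_right (hc.intervalIntegrable _ _)
      hc.aestronglyMeasurable.stronglyMeasurableAtFilter hc.continuousAt
  have hderiv : deriv (fun x => ∫ y in (0)..x, φ y) = φ := funext fun x => (hder x).deriv
  have hsub : tsupport (fun x => ∫ y in (0)..x, φ y) ⊆ Ioo 0 l := by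
    intro x hx
    by_contra hxl
    refine notMem_tsupport_iff_eventuallyEq.2 ?_ hx
    rcases le_or_gt x 0 with h0 | h0
    · obtain ⟨r, hr, hball⟩ := Metric.eventually_nhds_iff.1
        (notMem_tsupport_iff_eventuallyEq.1 fun h' => (h.tsupport_subset h').1.false :
          φ =ᶠ[𝓝 0] 0)
      filter_upwards [Iio_mem_nhds (show x < r by linarith)] with y hy
      refine intervalIntegral.integral_zero_ae (ae_of_all _ fun z hz => ?_)
      by_cases hz0 : z ≤ 0
      · exact h.eq_zero fun h' => h'.1.not_ge hz0
      · have hz1 : z ≤ max 0 y := hz.2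
        refine hball ?_
        rw [Real.dist_eq, sub_zero, abs_of_pos (not_le.1 hz0)]
        exact hz1.trans_lt (max_lt hr hy)
    · have hxl' : l ≤ x := not_lt.1 fun h' => hxl ⟨h0, h'⟩
      obtain ⟨r, hr, hball⟩ := Metric.eventually_nhds_iff.1
        (notMem_tsupport_iff_eventuallyEq.1 fun h' => (h.tsupport_subset h').2.false :
          φ =ᶠ[𝓝 l] 0)
      filter_upwards [Ioi_mem_nhds (show l - r < x by linarith)] with y hy
      rw [← intervalIntegral.integral_add_adjacent_intervals (hc.intervalIntegrable 0 l)
        (hc.intervalIntegrable l y), hint, zero_add]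
      refine intervalIntegral.integral_zero_ae (ae_of_all _ fun z hz => ?_)
      by_cases hz0 : l ≤ z
      · exact h.eq_zero fun h' => h'.2.not_ge hz0
      · have hz1 : min l y < z := hz.1
        refine hball ?_
        rw [Real.dist_eq, abs_of_neg (by linarith [not_le.1 hz0])]
        have : l - r < min l y := lt_min (by linarith) hy
        linarith
  refine ⟨_, ⟨?_, ?_, hsub⟩, hderiv⟩
  · rw [contDiff_infty_iff_deriv, hderiv]
    exact ⟨fun x => (hder x).differentiableAt, h.contDiff⟩
  · exact isCompact_Icc.of_isClosed_subset (isClosed_tsupport _) (hsub.trans Ioo_subset_Icc_self)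

lemma IsTest.sub_const_mul {φ ψ : ℝ → ℝ} (hφ : IsTest l φ) (hψ : IsTest l ψ) (m : ℝ) :
    IsTest l fun x => φ x - m * ψ x := by
  have hs : tsupport (fun x => φ x - m * ψ x) ⊆ Ioo 0 l := by
    refine (tsupport_sub φ fun x => m * ψ x).trans (union_subset hφ.tsupport_subset ?_)
    exact (tsupport_smul_subset_right (fun _ => m) ψ).trans hψ.tsupport_subset
  exact ⟨hφ.contDiff.sub (contDiff_const.mul hψ.contDiff),
    isCompact_Icc.of_isClosed_subset (isClosed_tsupport _) (hs.trans Ioo_subset_Icc_self), hs⟩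

lemma exists_isTest_integral_one (hl : 0 < l) : ∃ φ, IsTest l φ ∧ ∫ x in (0)..l, φ x = 1 := by
  -- a bump supported in `[l/4, 3l/4]`
  let f : ContDiffBump (l / 2) := ⟨l / 8, l / 4, by linarith, by linarith⟩
  have hs : tsupport (f.normed volume) ⊆ Ioo 0 l := by
    rw [f.tsupport_normed_eq, Real.closedBall_eq_Icc]
    intro x hx
    have h1 : l / 2 - l / 4 ≤ x := hx.1
    have h2 : x ≤ l / 2 + l / 4 := hx.2
    exact ⟨by linarith, by linarith⟩
  have ht : IsTest l (f.normed volume) := ⟨f.contDiff_normed,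
    isCompact_Icc.of_isClosed_subset (isClosed_tsupport _) (hs.trans Ioo_subset_Icc_self), hs⟩
  refine ⟨_, ht, ?_⟩
  rw [← integral_Ioo_eq hl.le, setIntegral_eq_integral_of_forall_compl_eq_zero
    fun x hx => ht.eq_zero hx, f.integral_normed]

/-- The fundamental lemma of the calculus of variations. -/
lemma ae_eq_zero_of_test {f : ℝ → ℝ} (hf : IntegrableOn f (Ioo 0 l))
    (h : ∀ ψ, IsTest l ψ → ∫ x in Ioo 0 l, f x * ψ x = 0) : f =ᵐ[volume.restrict (Ioo 0 l)] 0 := by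
  rw [EventuallyEq, ae_restrict_iff' measurableSet_Ioo]
  refine isOpen_Ioo.ae_eq_zero_of_integral_contDiff_smul_eq_zero hf.locallyIntegrableOn
    fun ψ h1 h2 h3 => ?_
  have ht : IsTest l ψ := ⟨h1, h2, h3⟩
  rw [← h ψ ht, setIntegral_eq_integral_of_forall_compl_eq_zero
    fun x hx => by rw [ht.eq_zero hx, mul_zero]]
  simp only [smul_eq_mul, mul_comm]

/-- The lemma of du Bois-Reymond. -/
lemma eq_const_of_integral_mul_deriv_eq_zero (hl : 0 < l) {k : ℝ → ℝ} (hk : Continuous k)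
    (h : ∀ ψ, IsTest l ψ → ∫ x in (0)..l, k x * deriv ψ x = 0) : ∃ c, ∀ x ∈ Icc 0 l, k x = c := by
  obtain ⟨φ₀, hφ₀, hint₀⟩ := exists_isTest_integral_one hl
  set c := ∫ x in (0)..l, k x * φ₀ x with hc
  have key : (fun x => k x - c) =ᵐ[volume.restrict (Ioo 0 l)] 0 := by
    refine ae_eq_zero_of_test ((hk.sub continuous_const).integrableOn_Icc.mono_set
      Ioo_subset_Icc_self) fun φ hφ => ?_
    have hi : ∀ f : ℝ → ℝ, Continuous f → IntervalIntegrable f volume 0 l := fun f hf =>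
      hf.intervalIntegrable _ _
    have c1 := hφ.contDiff.continuous
    have c2 := hφ₀.contDiff.continuous
    obtain ⟨ψ, hψ, hd⟩ := (hφ.sub_const_mul hφ₀ (∫ x in (0)..l, φ x)).exists_primitive (by
      rw [intervalIntegral.integral_sub (hi _ c1) (hi _ (by fun_prop)),
        intervalIntegral.integral_const_mul, hint₀]
      ring)
    have h1 := h ψ hψ
    rw [hd] at h1
    have h2 : ∀ x, k x * (φ x - (∫ x in (0)..l, φ x) * φ₀ x) =
        k x * φ x - (∫ x in (0)..l, φ x) * (k x * φ₀ x) := fun x => by ring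
    simp only [h2] at h1
    rw [intervalIntegral.integral_sub (hi _ (by fun_prop)) (hi _ (by fun_prop)),
      intervalIntegral.integral_const_mul, ← hc] at h1
    rw [integral_Ioo_eq hl.le]
    simp only [sub_mul]
    rw [intervalIntegral.integral_sub (hi _ (by fun_prop)) (hi _ (by fun_prop)),
      intervalIntegral.integral_const_mul]
    linarith
  refine ⟨c, fun x hx => ?_⟩
  rw [restrict_Ioo_eq_restrict_Icc] at key
  have := Measure.eqOn_Icc_of_ae_eq volume hl.ne key (hk.sub continuous_const).continuousOn
    continuousOn_const hx
  simpa [sub_eq_zero] using this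

/-- Integration by parts up to the boundary: a continuous function with a weak derivative against
a continuously differentiable function. -/
lemma IsWeakDeriv.integral_deriv_mul (hl : 0 < l) {g h v : ℝ → ℝ} (hg : Continuous g)
    (hgh : IsWeakDeriv l g h) (hv : ContDiff ℝ 1 v) :
    ∫ x in (0)..l, deriv v x * g x = v l * g l - v 0 * g 0 - ∫ x in Ioo 0 l, v x * h x := by
  have hint : Integrable h (volume.restrict (Ioo 0 l)) := hgh.1.integrable (by norm_num)
  -- compare `g` with the absolutely continuous primitive `G` of its weak derivative
  set h' : ℝ → ℝ := (Ioo 0 l).indicator h with hh'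
  have hint' : Integrable h' := (integrable_indicator_iff measurableSet_Ioo).2 hint
  set G : ℝ → ℝ := fun x => ∫ y in (0)..x, h' y with hG
  have hGc : Continuous G := intervalIntegral.continuous_primitive
    (fun a b => hint'.intervalIntegrable) 0
  have hG0 : G 0 = 0 := intervalIntegral.integral_same
  have hGac : AbsolutelyContinuousOnInterval G 0 l :=
    hint'.intervalIntegrable.absolutelyContinuousOnInterval_intervalIntegral left_mem_uIcc
  have hset : ∀ v : ℝ → ℝ, ∫ x in (0)..l, v x * h' x = ∫ x in Ioo 0 l, v x * h x := by
    intro v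
    rw [← integral_Ioo_eq hl.le]
    refine setIntegral_congr_fun measurableSet_Ioo fun x hx => ?_
    simp only [hh', indicator_of_mem hx]
  have parts : ∀ v : ℝ → ℝ, ContDiff ℝ 1 v →
      ∫ x in (0)..l, deriv v x * G x = v l * G l - ∫ x in Ioo 0 l, v x * h x := by
    intro v hv
    have h1 := AbsolutelyContinuousOnInterval.integral_mul_deriv_eq_deriv_mul
      (hv.contDiffOn.absolutelyContinuousOnInterval (a := 0) (b := l)) hGac
    have h2 : ∫ x in (0)..l, v x * deriv G x = ∫ x in (0)..l, v x * h' x := by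
      refine intervalIntegral.integral_congr_ae ?_
      filter_upwards [(hint'.intervalIntegrable (a := 0) (b := l)).ae_hasDerivAt_integral]
        with x hx hxl
      rw [(hx (uIoc_subset_uIcc hxl) 0 left_mem_uIcc).deriv]
    rw [h2, hset, hG0] at h1
    linarith
  have hi : ∀ f : ℝ → ℝ, Continuous f → IntervalIntegrable f volume 0 l := fun f hf =>
    hf.intervalIntegrable _ _
  obtain ⟨c, hc⟩ := eq_const_of_integral_mul_deriv_eq_zero hl (hg.sub hGc) fun ψ hψ => by
    have hψ1 : ContDiff ℝ 1 ψ := hψ.contDiff.of_le (by norm_cast)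
    have hψd : Continuous (deriv ψ) := hψ1.continuous_deriv le_rfl
    have h1 := hgh.2 ψ hψ.contDiff hψ.hasCompactSupport hψ.tsupport_subset
    have h2 := parts ψ hψ1
    rw [hψ.eq_zero (fun h => h.2.false), zero_mul, zero_sub] at h2
    rw [integral_Ioo_eq hl.le] at h1
    have h3 : ∀ x, (g - G) x * deriv ψ x = g x * deriv ψ x - deriv ψ x * G x := fun x => by
      simp only [Pi.sub_apply]; ring
    simp only [h3]
    rw [intervalIntegral.integral_sub (hi _ (by fun_prop)) (hi _ (by fun_prop)), h1, h2]
    simp only [mul_comm]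
    ring
  have hvd : Continuous (deriv v) := hv.continuous_deriv le_rfl
  have hc0 := hc 0 (left_mem_Icc.2 hl.le)
  have hcl := hc l (right_mem_Icc.2 hl.le)
  simp only [Pi.sub_apply, hG0, sub_zero] at hc0 hcl
  have h1 : ∫ x in (0)..l, deriv v x * g x = ∫ x in (0)..l, (deriv v x * G x + deriv v x * c) := by
    refine intervalIntegral.integral_congr fun x hx => ?_
    rw [uIcc_of_le hl.le] at hx
    have := hc x hx
    simp only [Pi.sub_apply] at this
    rw [← this]
    ring
  have h2 : ∫ x in (0)..l, deriv v x = v l - v 0 :=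
    intervalIntegral.integral_deriv_eq_sub
      (fun x _ => (hv.differentiable one_ne_zero) x) (hi _ hvd)
  rw [h1, intervalIntegral.integral_add (hi _ (by fun_prop)) (hi _ (by fun_prop)), parts v hv,
    intervalIntegral.integral_mul_const, h2, ← hc0, show g l = G l + g 0 by linarith]
  ring

/-- The classical derivative is a weak derivative. -/
lemma isWeakDeriv_deriv (hl : 0 < l) {f u : ℝ → ℝ} (hu : ContDiff ℝ 1 u)
    (hfu : EqOn f u (Ioo 0 l)) : IsWeakDeriv l f (deriv u) := by
  have hud : Continuous (deriv u) := hu.continuous_deriv le_rfl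
  constructor
  · obtain ⟨C, hC⟩ := (isCompact_Icc (a := 0) (b := l)).exists_bound_of_continuousOn
      hud.continuousOn
    exact MemLp.of_bound hud.aestronglyMeasurable C (by
      rw [ae_restrict_iff' measurableSet_Ioo]
      exact ae_of_all _ fun x hx => hC x (Ioo_subset_Icc_self hx))
  · intro ψ h1 h2 h3
    have ht : IsTest l ψ := ⟨h1, h2, h3⟩
    have hψ1 : ContDiff ℝ 1 ψ := h1.of_le (by norm_cast)
    have e : ∫ x in Ioo 0 l, f x * deriv ψ x = ∫ x in Ioo 0 l, u x * deriv ψ x :=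
      setIntegral_congr_fun measurableSet_Ioo fun x hx => by simp only [hfu hx]
    rw [e, integral_Ioo_eq hl.le, integral_Ioo_eq hl.le,
      intervalIntegral.integral_mul_deriv_eq_deriv_mul
        (fun x _ => (hu.differentiable one_ne_zero x).hasDerivAt)
        (fun x _ => (hψ1.differentiable one_ne_zero x).hasDerivAt)
        (hud.intervalIntegrable _ _) ((hψ1.continuous_deriv le_rfl).intervalIntegrable _ _),
      ht.eq_zero (fun h => h.2.false), ht.eq_zero (fun h => h.1.false)]
    ring

/-- Weak derivatives are unique almost everywhere. -/
lemma IsWeakDeriv.ae_eq {f h₁ h₂ : ℝ → ℝ} (H₁ : IsWeakDeriv l f h₁) (H₂ : IsWeakDeriv l f h₂) :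
    h₁ =ᵐ[volume.restrict (Ioo 0 l)] h₂ := by
  have i1 : IntegrableOn h₁ (Ioo 0 l) := H₁.1.integrable (by norm_num)
  have i2 : IntegrableOn h₂ (Ioo 0 l) := H₂.1.integrable (by norm_num)
  have key : (fun x => h₁ x - h₂ x) =ᵐ[volume.restrict (Ioo 0 l)] 0 := by
    refine ae_eq_zero_of_test (i1.sub i2) fun ψ hψ => ?_
    obtain ⟨C, hC⟩ := hψ.hasCompactSupport.exists_bound_of_continuous hψ.contDiff.continuous
    have hm : ∀ h, IntegrableOn h (Ioo 0 l) → IntegrableOn (fun x => h x * ψ x) (Ioo 0 l) :=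
      fun h hh => hh.mul_bdd hψ.contDiff.continuous.aestronglyMeasurable (ae_of_all _ hC)
    have e1 := H₁.2 ψ hψ.contDiff hψ.hasCompactSupport hψ.tsupport_subset
    have e2 := H₂.2 ψ hψ.contDiff hψ.hasCompactSupport hψ.tsupport_subset
    simp only [sub_mul]
    rw [integral_sub (hm _ i1) (hm _ i2)]
    linarith
  filter_upwards [key] with x hx
  simpa [sub_eq_zero] using hx

lemma isWeakDeriv_weakDeriv {f : ℝ → ℝ} (h : ∃ g, IsWeakDeriv l f g) :
    IsWeakDeriv l f (weakDeriv l f) := by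
  rw [weakDeriv, dif_pos h]
  exact h.choose_spec

end Interval

/-! ### The heat equation -/

lemma contDiff_circleHeat {H : ℝ → ℝ} (hH : Continuous H) {t : ℝ} (ht : 0 < t) :
    ContDiff ℝ ∞ (circleHeat H t) := by
  rw [circleHeat_eq_heatSeries hH ht]
  exact contDiff_heatSeries (subexp_cosCoeff hH) (subexp_sinCoeff hH) ht

lemma deriv_deriv_circleHeat {H : ℝ → ℝ} (hH : Continuous H) {t : ℝ} (ht : 0 < t) :
    deriv (deriv (circleHeat H t)) =
      heatSeries (fun k => k * -(k * cosCoeff H k)) (fun k => -(k * (k * sinCoeff H k))) t := by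
  have hc := subexp_cosCoeff hH
  have hs := subexp_sinCoeff hH
  have h1 : deriv (circleHeat H t) =
      heatSeries (fun k => k * sinCoeff H k) (fun k => -(k * cosCoeff H k)) t := by
    rw [circleHeat_eq_heatSeries hH ht]
    exact funext fun x => (hasDerivAt_heatSeries_space hc hs ht x).deriv
  rw [h1]
  exact funext fun x => (hasDerivAt_heatSeries_space hs.mul_nat hc.mul_nat.neg ht x).deriv

lemma hasDerivAt_circleHeat_time {H : ℝ → ℝ} (hH : Continuous H) {t : ℝ} (ht : 0 < t) (x : ℝ) :
    HasDerivAt (fun s => circleHeat H s x) (deriv (deriv (circleHeat H t)) x) t := by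
  rw [deriv_deriv_circleHeat hH ht]
  refine (hasDerivAt_heatSeries_time (subexp_cosCoeff hH) (subexp_sinCoeff hH) ht
    x).congr_of_eventuallyEq ?_
  filter_upwards [Ioi_mem_nhds ht] with s hs
  rw [circleHeat_eq_heatSeries hH hs]

lemma abs_deriv_deriv_circleHeat_le {H : ℝ → ℝ} (hH : Continuous H) {r : ℝ} (hr : 0 < r) :
    ∃ C, ∀ t, r ≤ t → ∀ x, |deriv (deriv (circleHeat H t)) x| ≤ C := by
  obtain ⟨C, hC⟩ := abs_heatSeries_le (subexp_cosCoeff hH).mul_nat.neg.mul_nat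
    (subexp_sinCoeff hH).mul_nat.mul_nat.neg hr
  exact ⟨C, fun t ht x => by
    rw [deriv_deriv_circleHeat hH (hr.trans_le ht)]
    exact hC t ht x⟩

lemma hasDerivAt_integral_circleHeat {H g : ℝ → ℝ} (hH : Continuous H) (hg : Continuous g)
    {t : ℝ} (ht : 0 < t) (a l : ℝ) :
    HasDerivAt (fun s => ∫ θ in (0)..l, circleHeat H s (a + θ) * g θ)
      (∫ θ in (0)..l, deriv (deriv (circleHeat H t)) (a + θ) * g θ) t := by
  obtain ⟨C, hC⟩ := abs_deriv_deriv_circleHeat_le hH (half_pos ht)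
  have hcont : ∀ s, 0 < s → Continuous fun θ => circleHeat H s (a + θ) * g θ := fun s hs =>
    ((continuous_circleHeat hH hs).comp (by fun_prop)).mul hg
  have hdd : Continuous fun θ => deriv (deriv (circleHeat H t)) (a + θ) * g θ := by
    have h1 := (contDiff_infty_iff_deriv.1 (contDiff_circleHeat hH ht)).2
    exact (((contDiff_infty_iff_deriv.1 h1).2.continuous).comp (by fun_prop)).mul hg
  refine (intervalIntegral.hasDerivAt_integral_of_dominated_loc_of_deriv_le
    (s := Ioi (t / 2)) (bound := fun θ => C * |g θ|)
    (F' := fun s θ => deriv (deriv (circleHeat H s)) (a + θ) * g θ)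
    (Ioi_mem_nhds (by linarith)) ?_ ((hcont t ht).intervalIntegrable _ _)
    hdd.aestronglyMeasurable ?_ ?_ ?_).2
  · filter_upwards [Ioi_mem_nhds ht] with s hs
    exact (hcont s hs).aestronglyMeasurable
  · refine ae_of_all _ fun θ _ s hs => ?_
    rw [norm_mul]
    exact mul_le_mul_of_nonneg_right (hC s (le_of_lt hs) _) (norm_nonneg _)
  · exact (continuous_const.mul hg.abs).intervalIntegrable _ _
  · refine ae_of_all _ fun θ _ s hs => ?_
    have hs0 : 0 < s := (half_pos ht).trans hs
    exact (hasDerivAt_circleHeat_time hH hs0 _).mul_const _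

lemma contDiff_circleHeat_cell {H : ℝ → ℝ} (hH : Continuous H) {t : ℝ} (ht : 0 < t) (a : ℝ) :
    ContDiff ℝ 1 fun θ => circleHeat H t (a + θ) :=
  ((contDiff_circleHeat hH ht).of_le (by norm_cast)).comp (contDiff_const.add contDiff_id)

lemma IsCellRep.isWeakDeriv (hj : ∀ l, 1 ≤ l → 2 ≤ j l) {f : F j n i → ℝ}
    {H : Cell j n i → ℝ → ℝ} (hH : IsCellRep f H) {t : ℝ} (ht : 0 < t) (α : Cell j n i) :
    IsWeakDeriv (L j i) (fun θ => kernelOp (mu j n i) (p j n i) t f (cellMap j n i α θ))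
      (fun θ => deriv (circleHeat (H α) t) (cellStart j i α.1 + θ)) := by
  have h1 := isWeakDeriv_deriv (L_pos hj i)
    (contDiff_circleHeat_cell (hH.continuous α) ht (cellStart j i α.1))
    (fun θ hθ => hH.kernelOp_eq t ht α θ (Ioo_subset_Icc_self hθ))
  rwa [show deriv (fun θ => circleHeat (H α) t (cellStart j i α.1 + θ)) =
    fun θ => deriv (circleHeat (H α) t) (cellStart j i α.1 + θ) from
    funext fun θ => deriv_comp_const_add _ _ _] at h1

/-- Along each cell the evolution is smooth up to the boundary. -/
lemma inDomain_kernelOp (hj : ∀ l, 1 ≤ l → 2 ≤ j l) (hn : ∀ l, 1 ≤ l → 2 ≤ n l) {f : F j n i → ℝ}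
    (hf : Continuous f) {t : ℝ} (ht : 0 < t) :
    InDomain j n i (kernelOp (mu j n i) (p j n i) t f) := by
  have hc := continuous_kernelOp_of_continuous hj hn ht hf
  obtain ⟨H, hH⟩ := exists_isCellRep hj hn hf
  obtain ⟨C, hC⟩ := exists_bound_of_continuous hj hc
  exact ⟨hc, fun α => ⟨MemLp.of_bound (hc.comp (continuous_cellMap α)).aestronglyMeasurable C
    (ae_of_all _ fun θ => hC _), _, hH.isWeakDeriv hj ht α⟩⟩

/-- Integration by parts on the cells; the boundary terms cancel by the Kirchhoff condition. -/
lemma IsCellRep.sum_integral_deriv_deriv (hj : ∀ l, 1 ≤ l → 2 ≤ j l) {f : F j n i → ℝ}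
    {H : Cell j n i → ℝ → ℝ} (hH : IsCellRep f H) {t : ℝ} (ht : 0 < t) {g : F j n i → ℝ}
    (hg : InDomain j n i g) :
    ∑ α : Cell j n i, 1 / (N n i : ℝ) * ∫ θ in (0)..(L j i),
      deriv (deriv (circleHeat (H α) t)) (cellStart j i α.1 + θ) * g (cellMap j n i α θ) =
      -energy j n i (kernelOp (mu j n i) (p j n i) t f) g := by
  have hparts : ∀ α : Cell j n i, ∫ θ in (0)..(L j i),
      deriv (deriv (circleHeat (H α) t)) (cellStart j i α.1 + θ) * g (cellMap j n i α θ) =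
      (deriv (circleHeat (H α) t) (cellStart j i α.1 + L j i) * g (cellMap j n i α (L j i)) -
        deriv (circleHeat (H α) t) (cellStart j i α.1 + 0) * g (cellMap j n i α 0)) -
      ∫ θ in Ioo 0 (L j i),
        weakDeriv (L j i) (fun s => kernelOp (mu j n i) (p j n i) t f (cellMap j n i α s)) θ *
          weakDeriv (L j i) (fun s => g (cellMap j n i α s)) θ := by
    intro α
    have h1 := (contDiff_infty_iff_deriv.1 (contDiff_circleHeat (hH.continuous α) ht)).2
    have hv : ContDiff ℝ 1 fun θ => deriv (circleHeat (H α) t) (cellStart j i α.1 + θ) :=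
      (h1.of_le (by norm_cast)).comp (contDiff_const.add contDiff_id)
    have h2 := (isWeakDeriv_weakDeriv (hg.2 α).2).integral_deriv_mul (L_pos hj i)
      (hg.1.comp (continuous_cellMap α)) hv
    have h3 : deriv (fun θ => deriv (circleHeat (H α) t) (cellStart j i α.1 + θ)) =
        fun θ => deriv (deriv (circleHeat (H α) t)) (cellStart j i α.1 + θ) :=
      funext fun θ => deriv_comp_const_add _ _ _
    rw [h3] at h2
    simp only [Function.comp_apply] at h2
    refine h2.trans (congrArg (HSub.hSub _) ?_)
    have h4 := hH.isWeakDeriv hj ht α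
    refine integral_congr_ae ?_
    filter_upwards [h4.ae_eq (isWeakDeriv_weakDeriv ⟨_, h4⟩)] with θ hθ
    rw [hθ]
  simp only [hparts, mul_sub (1 / (N n i : ℝ)) (_ - _)]
  rw [Finset.sum_sub_distrib, ← Finset.mul_sum, hH.kirchhoff t ht g hg.1, mul_zero, zero_sub]
  rfl

lemma hasDerivAt_integral_kernelOp (hj : ∀ l, 1 ≤ l → 2 ≤ j l) (hn : ∀ l, 1 ≤ l → 2 ≤ n l)
    {f g : F j n i → ℝ} (hf : Continuous f) (hg : InDomain j n i g) {t : ℝ} (ht : 0 < t) :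
    HasDerivAt (fun s => ∫ x, kernelOp (mu j n i) (p j n i) s f x * g x ∂(mu j n i))
      (-energy j n i (kernelOp (mu j n i) (p j n i) t f) g) t := by
  obtain ⟨H, hH⟩ := exists_isCellRep hj hn hf
  rw [← hH.sum_integral_deriv_deriv hj ht hg]
  have h1 : HasDerivAt (fun s => ∑ α : Cell j n i, 1 / (N n i : ℝ) * ∫ θ in (0)..(L j i),
      circleHeat (H α) s (cellStart j i α.1 + θ) * g (cellMap j n i α θ)) _ t :=
    HasDerivAt.fun_sum fun α _ => (hasDerivAt_integral_circleHeat (hH.continuous α)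
      (hg.1.comp (continuous_cellMap α)) ht (cellStart j i α.1) (L j i)).const_mul _
  refine h1.congr_of_eventuallyEq ?_
  filter_upwards [Ioi_mem_nhds ht] with s hs
  have hc : Continuous fun x => kernelOp (mu j n i) (p j n i) s f x * g x :=
    (continuous_kernelOp_of_continuous hj hn hs hf).mul hg.1
  rw [integral_mu hj hn hc]
  refine Finset.sum_congr rfl fun α _ => ?_
  congr 1
  refine intervalIntegral.integral_congr fun θ hθ => ?_
  rw [uIcc_of_le (L_pos hj i).le] at hθ
  exact congrArg (· * g (cellMap j n i α θ)) (hH.kernelOp_eq s hs α θ hθ)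

lemma isHeatKernel_p (hj : ∀ l, 1 ≤ l → 2 ≤ j l) (hn : ∀ l, 1 ≤ l → 2 ≤ n l) (i : ℕ) :
    IsHeatKernel j n i (p j n i) where
  continuous _ ht := continuous_p hj ht
  symm t _ x y := p_symm t x y
  nonneg _ ht x y := p_nonneg hj hn ht x y
  semigroup := isStrongFellerSemigroup hj hn
  inDomain _ ht _ hf := inDomain_kernelOp hj hn hf ht
  heat_equation _ ht _ hf _ hg := hasDerivAt_integral_kernelOp hj hn hf hg ht

end DiamondFractal

theorem theorem2 (j n : ℕ → ℕ) (hj : ∀ l, 1 ≤ l → 2 ≤ j l) (hn : ∀ l, 1 ≤ l → 2 ≤ n l) (i : ℕ) :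
    -- the recursively defined function is the heat kernel on the graph of level `i + 1`
    DiamondFractal.IsHeatKernel j n (i + 1) (DiamondFractal.p j n (i + 1)) ∧
    -- it is given by the Dirichlet kernels of the cells, according to the configuration of `x, y`
    ∀ (t : ℝ), 0 < t → ∀ x y : DiamondFractal.F j n (i + 1),
      (¬ DiamondFractal.SameBundle j n i x y →
        DiamondFractal.p j n (i + 1) t x y =
          DiamondFractal.p j n i t (DiamondFractal.phi j n i x) (DiamondFractal.phi j n i y)) ∧
      (DiamondFractal.SameBundle j n i x y → ¬ DiamondFractal.SameStrand j n (i + 1) x y →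
        DiamondFractal.p j n (i + 1) t x y =
          DiamondFractal.p j n i t (DiamondFractal.phi j n i x) (DiamondFractal.phi j n i y) -
            (DiamondFractal.N n i : ℝ) *
              DiamondFractal.dirichletKernel (DiamondFractal.L j (i + 1)) t
                (DiamondFractal.theta j n (i + 1) x) (DiamondFractal.theta j n (i + 1) y)) ∧
      (DiamondFractal.SameStrand j n (i + 1) x y →
        DiamondFractal.p j n (i + 1) t x y =
          DiamondFractal.p j n i t (DiamondFractal.phi j n i x) (DiamondFractal.phi j n i y) +
            (DiamondFractal.N n i : ℝ) * ((n (i + 1) : ℝ) - 1) *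
              DiamondFractal.dirichletKernel (DiamondFractal.L j (i + 1)) t
                (DiamondFractal.theta j n (i + 1) x) (DiamondFractal.theta j n (i + 1) y)) := by
  refine ⟨DiamondFractal.isHeatKernel_p hj hn (i + 1), fun t ht x y => ⟨fun hb => ?_,
    fun hb hs => ?_, fun hs => ?_⟩⟩
  · rw [DiamondFractal.p, if_neg fun hs => hb hs.sameBundle, if_neg hb]
  · rw [DiamondFractal.p, if_neg hs, if_pos hb, DiamondFractal.correction_eq_dirichletKernel hj ht]
  · rw [DiamondFractal.p, if_pos hs, DiamondFractal.correction_eq_dirichletKernel hj ht]
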